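/- **Model.** A team has $n\ge 2$ players with actions $\{C,N\}$. There are two stage games $g\in\{G,B\}$ with symmetric payoffs $\pi_g(a_i,\mathbf a_{-i})$ (depending on $\mathbf a_{-i}$ only up to permutation) such that: $C^n$ is the unique maximizer of $\sum_i\pi_g$; $N$ is strictly dominant; $\max_{a_i}\pi_g(a_i,\mathbf a_{-i})$ is minimized at $\mathbf a_{-i}=N^{n-1}$; $N^n$ is the unique maximizer of $\sum_i\pi_g$ on $A^n\setminus\{C^n\}$; and $\pi_g(N,\mathbf a_{-i})-\pi_g(C,\mathbf a_{-i})$ is smallest at $\mathbf a_{-i}=C^{n-1}$. Let $c_g=\pi_g(C,C^{n-1})-\pi_g(N,N^{n-1})$ and $d_g=\pi_g(N,C^{n-1})-\pi_g(C,C^{n-1})$. There are two tasks $t_G,t_B$; in a period on task $t_g$ the game $g$ arrives with probability $a_g\in(0,1]$, and otherwise no game is played (payoff $0$). The discount factor is $\delta\in(0,1)$. A *reactive assignment* is a map $m:\mathcal S\to\Delta(\{t_G,t_B\})$, where $\mathcal S=(\{t_G,t_B\}\times\{G,B,\emptyset\})^K$ for some integer $K\ge1$ (any $K$ is allowed): it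 gives the law of the next task as a function of the tasks and games of the last $K$ periods, the current one included. It induces a Markov chain on the states $\mathcal S$ (drop the oldest entry, append the new task and game). Given $m$, a reshuffling rate $r\in[0,1]$ and a steady state $\overline m$ of this chain, a team starts in a state $s_0$ with $\overline m(s_0)>0$ and plays the stochastic game with discount factor $(1-r)\delta$; (behaviour) strategies depend on the initial state and on all past tasks, games and actions and on the current task and game. An *equilibrium* is a subgame-perfect equilibrium in which no player randomizes on the equilibrium path; it is *player-optimal* if, for each such $s_0$, it maximizes the sum of the players' expected discounted payoffs among all equilibria. There is *cooperation in state $s$* if on the equilibrium path all players cooperate whenever the state is $s$. A *reactive team structure* is a finitely supported probability measure $\lambda$ on reactive assignments together with a rate $r_m$ and a steady state $\overline m$ for each $m\in\operatorname{supp}\lambda$. Given $q_{t}\ge0$ with $q_{t_G}+q_{t_B}=1$, it must satisfy $\sum_m\lambda(m)\sum_{s:\ \text{current task } t}\overline m(s)=q_t$ for both tasks $t$. Its social value is $\sum_m\lambda(m)\big(V_G\,\overline m(\mathcal G_m)+V_B\,\overline m(\mathcal B_m)\big)$, where $V_G>0>V_B$ and $\mathcal G_m$ (resp. $\mathcal B_m$)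 is the set of states in which the current game is $G$ (resp. $B$) and there is cooperation in a player-optimal equilibrium. A structure is *designer-optimal* if it satisfies the task constraint and has the largest social value among those that do. **Lemma.** Suppose that $d_G>\frac{\delta}{1-\delta}a_Gc_G$ and $\max\{d_G,d_B\}<\frac{\delta}{1-\delta}a_Bc_B$. Let $\lambda$ be a designer-optimal reactive team structure, $m\in\operatorname{supp}(\lambda)$ with reshuffling rate $r_m$ and steady state $\overline m$, and take any player-optimal equilibrium for $m$. Then for each state $s_0$ with $\overline m(s_0)>0$, one of the following holds: 1. $r_m=0$, and for all teams whose initial state is $s_0$ or a state reachable from $s_0$ under $m$, all players cooperate at all on-path histories and games; 2. for all teams whose initial state is $s_0$ or a state reachable from $s_0$ under $m$, all players do not cooperate at all on-path histories and games. In particular, if all states in the support of $\overline m$ can be reached from each other, then either all players in $m$ cooperate at all on-path histories and games, and $r_m=0$, or all players in $m$ do not cooperate at all on-path histories and games. -/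

import Mathlib

/-- The two actions of the stage games: cooperate, or not. -/
inductive Move
  | C
  | N
  deriving DecidableEq

instance : Fintype Move := ⟨{Move.C, Move.N}, fun x => by cases x <;> simp⟩

/-- The two stage games: the good game `G` and the bad game `B`. -/
inductive Game
  | G
  | B
  deriving DecidableEq

instance : Fintype Game := ⟨{Game.G, Game.B}, fun x => by cases x <;> simp⟩

/-- There is one task for each game: in task `t_g` only the game `g` can arrive, so the tasks
are labelled by the games (`G` is the good task, `B` the bad task). -/
abbrev WorkTask := Game

/-- What happens in a period as seen by the designer: the task, and the game, if any. -/
abbrev Obs := WorkTask × Option Game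

/-- Move profiles of `n` players. -/
abbrev Profile (n : ℕ) := Fin n → Move

/-- The profile in which every player plays `x`. -/
def allPlay (n : ℕ) (x : Move) : Profile n := fun _ => x

/-- The primitives of the model and the standing assumptions on them. -/
structure Env where
  /-- number of players of a team -/
  n : ℕ
  two_le_n : 2 ≤ n
  /-- `pay g i a` is the payoff of player `i` in game `g` at the action profile `a` -/
  pay : Game → Fin n → Profile n → ℝ
  /-- the payoff depends only on one's own action and on the others' actions up to permutation,
  by the same function for all players -/
  symmetric : ∀ g (e : Equiv.Perm (Fin n)) (a : Profile n) i, pay g i (a ∘ e) = pay g (e i) a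
  /-- complete cooperation is the unique maximizer of the aggregate payoff -/
  coop_max : ∀ g (a : Profile n), a ≠ allPlay n Move.C →
    ∑ i, pay g i a < ∑ i, pay g i (allPlay n Move.C)
  /-- not cooperating is strictly dominant -/
  dominant : ∀ g i (a : Profile n),
    pay g i (Function.update a i Move.C) < pay g i (Function.update a i Move.N)
  /-- complete non-cooperation of the others minimizes a player's best payoff -/
  minmax : ∀ g i (a : Profile n),
    max (pay g i (Function.update (allPlay n Move.N) i Move.C))
        (pay g i (Function.update (allPlay n Move.N) i Move.N)) ≤
      max (pay g i (Function.update a i Move.C)) (pay g i (Function.update a i Move.N))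
  /-- complete non-cooperation is the unique maximizer of the aggregate payoff among the
  profiles other than complete cooperation -/
  noncoop_max : ∀ g (a : Profile n), a ≠ allPlay n Move.C → a ≠ allPlay n Move.N →
    ∑ i, pay g i a < ∑ i, pay g i (allPlay n Move.N)
  /-- the gain from not cooperating is smallest when all others cooperate -/
  gain_min : ∀ g i (a : Profile n),
    pay g i (Function.update (allPlay n Move.C) i Move.N)
        - pay g i (Function.update (allPlay n Move.C) i Move.C) ≤
      pay g i (Function.update a i Move.N) - pay g i (Function.update a i Move.C)
  /-- discount factor -/
  δ : ℝ
  δ_pos : 0 < δ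
  δ_lt_one : δ < 1
  /-- `arrival g` is the probability that game `g` arrives in a period on task `t_g` -/
  arrival : Game → ℝ
  arrival_pos : ∀ g, 0 < arrival g
  arrival_le_one : ∀ g, arrival g ≤ 1
  /-- social value of cooperation in each of the games -/
  V : Game → ℝ
  V_good : 0 < V Game.G
  V_bad : V Game.B < 0
  /-- shares of the teams that have to cover the tasks -/
  q : WorkTask → ℝ
  q_nonneg : ∀ t, 0 ≤ q t
  q_sum : ∑ t, q t = 1

noncomputable section

namespace Env

variable (E : Env)

/-- A player (by symmetry it does not matter which one). -/
def player : Fin E.n := ⟨0, lt_of_lt_of_le Nat.zero_lt_two E.two_le_n⟩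

/-- The cooperation benefit `c_g = π_g(C, C^{n-1}) - π_g(N, N^{n-1})`. -/
def c (g : Game) : ℝ :=
  E.pay g E.player (allPlay E.n Move.C) - E.pay g E.player (allPlay E.n Move.N)

/-- The deviation temptation `d_g = π_g(N, C^{n-1}) - π_g(C, C^{n-1})`. -/
def d (g : Game) : ℝ :=
  E.pay g E.player (Function.update (allPlay E.n Move.C) E.player Move.N)
    - E.pay g E.player (allPlay E.n Move.C)

/-- Probability that in a period on task `t` the game is `o` (`none` if no game arrives). -/
def gameProb (t : WorkTask) : Option Game → ℝ
  | none => 1 - E.arrival t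
  | some g => if g = t then E.arrival t else 0

end Env

/-! ### Reactive assignments -/

/-- The states for memory length `K = k + 1 ≥ 1`: tasks and games of the last `K` periods, from the
oldest one to the current one, which is the entry `Fin.last k`. -/
abbrev State (k : ℕ) := Fin (k + 1) → Obs

/-- The next state: the oldest entry is dropped and the new one is appended. -/
def State.push {k : ℕ} (s : State k) (x : Obs) : State k :=
  Fin.snoc (α := fun _ => Obs) (Fin.tail (α := fun _ => Obs) s) x

/-- The current task. -/
def State.task {k : ℕ} (s : State k) : WorkTask := (s (Fin.last k)).1

/-- The current game, if any. -/
def State.game {k : ℕ} (s : State k) : Option Game := (s (Fin.last k)).2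

/-- A reactive assignment: a memory length `K = k + 1` and a map from the states to the probability
distributions on the tasks (the distribution of the task of the next period). -/
structure Assignment where
  k : ℕ
  next : State k → stdSimplex ℝ WorkTask

namespace Env

variable (E : Env)

/-- Probability of the observation `x` in the period after state `s`. -/
def obsProb (m : Assignment) (s : State m.k) (x : Obs) : ℝ :=
  (m.next s).1 x.1 * E.gameProb x.1 x.2

/-- `E.trans m s s'` is the probability of moving from state `s` to state `s'`. -/
def trans (m : Assignment) (s s' : State m.k) : ℝ :=
  ∑ x : Obs, if s.push x = s' then E.obsProb m s x else 0

/-- `μ` is a steady-state distribution of the Markov chain on the states induced by `m`. -/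
def IsSteady (m : Assignment) (μ : State m.k → ℝ) : Prop :=
  μ ∈ stdSimplex ℝ (State m.k) ∧ ∀ s, μ s = ∑ s', E.trans m s' s * μ s'

/-! ### The stochastic game played by a team -/

/-- A transition between two periods: the action profile played in the earlier period (`none` if
there was no game), and the task and the game of the later period. -/
abbrev Step := Option (Profile E.n) × Obs

/-- A decision node of a team: its initial state and its history, with the most recent step first.
The task and the game of the current period belong to the node. -/
abbrev Node (k : ℕ) := State k × List E.Step

/-- The state of the assignment after a history. -/
def curState {k : ℕ} (s : State k) : List E.Step → State k
  | [] => s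
  | x :: l => (curState s l).push x.2

/-- The current game at a node, if any. -/
def game {k : ℕ} (h : E.Node k) : Option Game := (E.curState h.1 h.2).game

/-- The node after the node `h` and the step `x`. -/
def extend {k : ℕ} (h : E.Node k) (x : E.Step) : E.Node k := (h.1, x :: h.2)

/-- A strategy of a player gives a distribution over actions at every node (its values at nodes
without a current game are irrelevant). -/
abbrev Strategy (k : ℕ) := E.Node k → stdSimplex ℝ Move

/-- Strategy profiles of a team. -/
abbrev StratProfile (k : ℕ) := Fin E.n → E.Strategy k

/-- Probability that the profile `a` is played at `h`, the players randomizing independently. -/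
def profileProb {k : ℕ} (σ : E.StratProfile k) (h : E.Node k) (a : Profile E.n) : ℝ :=
  ∏ i, (σ i h).1 (a i)

/-- Distribution of the action record of the current period. -/
def recProb {k : ℕ} (σ : E.StratProfile k) (h : E.Node k) : Option (Profile E.n) → ℝ
  | none => if E.game h = none then 1 else 0
  | some a => if E.game h = none then 0 else E.profileProb σ h a

/-- Probability of the step `x` from the node `h`. -/
def stepProb (m : Assignment) (σ : E.StratProfile m.k) (h : E.Node m.k) (x : E.Step) : ℝ :=
  E.recProb σ h x.1 * E.obsProb m (E.curState h.1 h.2) x.2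

/-- Expected stage payoff of player `i` in the current period. -/
def stagePay {k : ℕ} (σ : E.StratProfile k) (i : Fin E.n) (h : E.Node k) : ℝ :=
  match E.game h with
  | none => 0
  | some g => ∑ a, E.profileProb σ h a * E.pay g i a

/-- Expected stage payoff of player `i`, evaluated at `h`, in the period `τ` periods later. -/
def laterPay (m : Assignment) (σ : E.StratProfile m.k) (i : Fin E.n) : ℕ → E.Node m.k → ℝ
  | 0, h => E.stagePay σ i h
  | τ + 1, h => ∑ x : E.Step, E.stepProb m σ h x * laterPay m σ i τ (E.extend h x)

/-- Expected discounted payoff of player `i` at `h`. Reshuffling at rate `r` amounts to the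
discount factor `(1 - r) δ`. -/
def util (m : Assignment) (r : ℝ) (σ : E.StratProfile m.k) (i : Fin E.n) (h : E.Node m.k) : ℝ :=
  ∑' τ : ℕ, ((1 - r) * E.δ) ^ τ * E.laterPay m σ i τ h

/-- Subgame-perfect equilibrium: after every history, no player gains by any change of strategy. -/
def IsSPE (m : Assignment) (r : ℝ) (σ : E.StratProfile m.k) : Prop :=
  ∀ (h : E.Node m.k) (i : Fin E.n) (ρ : E.Strategy m.k),
    E.util m r (Function.update σ i ρ) i h ≤ E.util m r σ i h

/-- The history `l` has positive probability for a team that starts in state `s` and plays `σ`. -/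
def OnPath (m : Assignment) (σ : E.StratProfile m.k) (s : State m.k) : List E.Step → Prop
  | [] => True
  | x :: l => OnPath m σ s l ∧ 0 < E.stepProb m σ (s, l) x

/-- No player randomizes on the equilibrium path (of the teams of the steady state `μ`). -/
def PureOnPath (m : Assignment) (μ : State m.k → ℝ) (σ : E.StratProfile m.k) : Prop :=
  ∀ s, 0 < μ s → ∀ l, E.OnPath m σ s l → E.game (s, l) ≠ none →
    ∀ i, ∃ a, (σ i (s, l)).1 a = 1

/-- A subgame-perfect equilibrium without randomization on the equilibrium path. -/
def IsEquilibrium (m : Assignment) (r : ℝ) (μ : State m.k → ℝ) (σ : E.StratProfile m.k) : Prop :=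
  E.IsSPE m r σ ∧ E.PureOnPath m μ σ

/-- A player-optimal equilibrium: for the teams of the steady state `μ` it maximizes the sum of the
players' expected discounted payoffs among all equilibria. -/
def IsPlayerOptimal (m : Assignment) (r : ℝ) (μ : State m.k → ℝ) (σ : E.StratProfile m.k) : Prop :=
  E.IsEquilibrium m r μ σ ∧
    ∀ σ', E.IsEquilibrium m r μ σ' → ∀ s, 0 < μ s →
      ∑ i, E.util m r σ' i (s, []) ≤ ∑ i, E.util m r σ i (s, [])

/-- All players play `x` at the node `h`. -/
def AllPlayAt {k : ℕ} (σ : E.StratProfile k) (x : Move) (h : E.Node k) : Prop :=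
  ∀ i, (σ i h).1 x = 1

/-- There is cooperation in state `s`: on the equilibrium path (of the teams of the steady state
`μ`), all players cooperate in the current game whenever the state is `s`. -/
def CoopInState (m : Assignment) (μ : State m.k → ℝ) (σ : E.StratProfile m.k)
    (s : State m.k) : Prop :=
  ∀ s₀, 0 < μ s₀ → ∀ l, E.OnPath m σ s₀ l → E.curState s₀ l = s → E.AllPlayAt σ Move.C (s₀, l)

/-- A team that starts in state `s` plays `x` (all players) at all on-path histories and games. -/
def AlwaysPlays (m : Assignment) (σ : E.StratProfile m.k) (x : Move) (s : State m.k) : Prop :=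
  ∀ l, E.OnPath m σ s l → E.game (s, l) ≠ none → E.AllPlayAt σ x (s, l)

/-- State `s'` can be reached from state `s` under the assignment `m`. -/
def Reaches (m : Assignment) (s s' : State m.k) : Prop :=
  Relation.ReflTransGen (fun x y => 0 < E.trans m x y) s s'

/-! ### Reactive team structures -/

/-- A reactive team structure: a probability measure with finite support on the reactive
assignments, and a reshuffling rate and a steady state for each assignment in the support. -/
structure TeamStructure where
  weight : Assignment →₀ ℝ
  weight_nonneg : ∀ m, 0 ≤ weight m
  weight_sum : (weight.sum fun _ w => w) = 1
  rate : Assignment → ℝ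
  rate_mem : ∀ m ∈ weight.support, rate m ∈ Set.Icc (0 : ℝ) 1
  steady : (m : Assignment) → State m.k → ℝ
  steady_isSteady : ∀ m ∈ weight.support, E.IsSteady m (steady m)

/-- The structure covers each task at the required rate. -/
def CoversTasks (T : E.TeamStructure) : Prop :=
  ∀ t : WorkTask, (T.weight.sum fun m w => w * ∑ s, if s.task = t then T.steady m s else 0) = E.q t

/-- Social value of cooperation in the current game of a state, `0` if there is no game. -/
def stateValue {k : ℕ} (s : State k) : ℝ :=
  match s.game with
  | none => 0
  | some g => E.V g

open Classical in
/-- Social value of a team structure in which the teams in the assignment `m` play `σ m`. -/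
def socialValue (T : E.TeamStructure) (σ : (m : Assignment) → E.StratProfile m.k) : ℝ :=
  T.weight.sum fun m w => w * ∑ s,
    if E.CoopInState m (T.steady m) (σ m) s then T.steady m s * E.stateValue s else 0

/-- `v` is the social value of `T` when the teams play player-optimal equilibria. -/
def IsSocialValue (T : E.TeamStructure) (v : ℝ) : Prop :=
  ∃ σ : (m : Assignment) → E.StratProfile m.k,
    (∀ m ∈ T.weight.support, E.IsPlayerOptimal m (T.rate m) (T.steady m) (σ m)) ∧
      v = E.socialValue T σ

/-- `T` maximizes the social value among the team structures that cover the tasks. -/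
def IsDesignerOptimal (T : E.TeamStructure) : Prop :=
  E.CoversTasks T ∧ ∃ v, E.IsSocialValue T v ∧
    ∀ (T' : E.TeamStructure) (v' : ℝ), E.CoversTasks T' → E.IsSocialValue T' v' → v' ≤ v

end Env

end

/-! The designer wants cooperation on good tasks and has to buy incentives with cooperation on bad
tasks: good tasks alone cannot sustain cooperation, while a stream of bad tasks sustains it in both
games. What counts is therefore the number of cooperative bad periods per cooperative good period. A
team that cooperates at times but is reshuffled, or has periods without cooperation, wastes
incentives that could have bought more good tasks.

Player-optimal play is read off from states. The states in which cooperation pays for itself form a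
largest set `coopSet`; trigger strategies cooperate exactly there, and every player-optimal
equilibrium plays all-C in it and all-N outside it, at all on-path games (`IsPlayerOptimal.play`).
Partial cooperation is excluded because any profile other than `C^n` gives a total of at most that
of `N^n`. The social value is then a linear function of the cooperation shares on the two tasks
(`IsPlayerOptimal.sum_value`).

Suppose that the class of `s₀` has some cooperation and some waste. Let `ρ` be the aggregate ratio
of bad to good cooperation. Either this class has ratio at most `ρ`, or, by averaging, some other
class has ratio below `ρ`. From such a class one builds an assignment with cooperation in every
state and ratio below `ρ` (`CoopChain.exists_assignment`). Used for a suitable share of the teams,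
with all other teams completely reshuffled, it yields the same good cooperation and less bad
cooperation, contradicting optimality.

The construction has three stages. Skipping the non-cooperative periods and dropping reshuffling
raises the value of future cooperation, strictly and everywhere if there was waste; the surplus
finances extra good periods at one state. The skipped moves are unobserved, so the state is replaced
by the belief about it given past tasks and games (`Scheme.toPlan`); values and costs are linear in
beliefs, hence the incentive constraints survive. The belief process needs unbounded memory, so it
is run for long stretches and restarted after a long run of bad tasks, recognizable from bounded
memory (`Plan.exists_assignment`). The bad tasks of the restarts are negligible per period and keep
incentives intact. -/

/-! ### Finite Markov chains, given by weighted moves -/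

namespace MoveChain

variable {X A : Type}

/-- `t` can be reached from `s` by moves of positive weight. -/
def Leads (ω : X → A → ℝ) (nx : X → A → X) (s t : X) : Prop :=
  Relation.ReflTransGen (fun x y => ∃ a, 0 < ω x a ∧ nx x a = y) s t

theorem Leads.mono {ω ω' : X → A → ℝ} {nx : X → A → X} (h : ∀ s a, 0 < ω s a → 0 < ω' s a)
    {s t : X} (hl : Leads ω nx s t) : Leads ω' nx s t :=
  Relation.ReflTransGen.mono (fun _ _ ⟨a, ha, he⟩ => ⟨a, h _ _ ha, he⟩) s t hl

variable [Fintype A]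

/-- A substochastic system of moves: the total weight at a state is at most `1`, and from every
state one can reach a state at which it is less than `1`. -/
structure Transient (ω : X → A → ℝ) (nx : X → A → X) : Prop where
  nonneg : ∀ s a, 0 ≤ ω s a
  sum_le_one : ∀ s, ∑ a, ω s a ≤ 1
  exit : ∀ s, ∃ t, Leads ω nx s t ∧ ∑ a, ω t a < 1

/-- Minimum principle: where the minimum `v` is attained, the weighted sum of `y - v` over the
successors is at most `v` times the missing mass, hence at most `0`. The sign of `v` makes
substochastic weights harmless. -/
theorem eq_of_leads_of_superharmonic {ω : X → A → ℝ} {nx : X → A → X}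
    (h0 : ∀ s a, 0 ≤ ω s a) (h1 : ∀ s, ∑ a, ω s a ≤ 1) {y : X → ℝ}
    (hy : ∀ s, ∑ a, ω s a * y (nx s a) ≤ y s) {v : ℝ} (hv : v ≤ 0) (hmin : ∀ s, v ≤ y s)
    {s t : X} (hs : y s = v) (hst : Leads ω nx s t) : y t = v := by
  induction hst with
  | refl => exact hs
  | tail _ hstep ih =>
    rename_i b c _
    obtain ⟨a, ha, rfl⟩ := hstep
    have h2 : ∑ a, ω b a * (y (nx b a) - v) ≤ 0 := by
      simp only [mul_sub, Finset.sum_sub_distrib, ← Finset.sum_mul]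
      have := hy b
      have := h1 b
      nlinarith
    have h3 : ∀ a ∈ Finset.univ, 0 ≤ ω b a * (y (nx b a) - v) := fun a _ =>
      mul_nonneg (h0 b a) (by linarith [hmin (nx b a)])
    have h4 := (Finset.sum_eq_zero_iff_of_nonneg h3).1 (le_antisymm h2 (Finset.sum_nonneg h3)) a
      (Finset.mem_univ a)
    rcases mul_eq_zero.1 h4 with h | h <;> linarith

namespace Transient

variable [Finite X] {ω : X → A → ℝ} {nx : X → A → X}

/-- A negative minimum would spread to an exit state, where the missing mass makes the weighted sum
strictly larger than the minimum. -/
theorem nonneg_of_superharmonic (h : Transient ω nx) {y : X → ℝ}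
    (hy : ∀ s, ∑ a, ω s a * y (nx s a) ≤ y s) (s : X) : 0 ≤ y s := by
  have : Nonempty X := ⟨s⟩
  obtain ⟨s₁, hs₁⟩ := Finite.exists_min y
  by_contra hneg
  have hlt : y s₁ < 0 := lt_of_le_of_lt (hs₁ s) (not_le.1 hneg)
  obtain ⟨t, ht, hsum⟩ := h.exit s₁
  have hyt := eq_of_leads_of_superharmonic h.nonneg h.sum_le_one hy hlt.le hs₁ rfl ht
  have h2 : y s₁ * ∑ a, ω t a ≤ ∑ a, ω t a * y (nx t a) := by
    rw [Finset.mul_sum]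
    refine Finset.sum_le_sum fun a _ => ?_
    rw [mul_comm]
    exact mul_le_mul_of_nonneg_left (hs₁ _) (h.nonneg t a)
  have := hy t
  nlinarith

theorem le_of_sub_super (h : Transient ω nx) {f y z : X → ℝ}
    (hy : ∀ s, y s ≤ f s + ∑ a, ω s a * y (nx s a))
    (hz : ∀ s, f s + ∑ a, ω s a * z (nx s a) ≤ z s) (s : X) : y s ≤ z s := by
  have := h.nonneg_of_superharmonic (y := fun s => z s - y s) (fun s => by
    simp only [mul_sub, Finset.sum_sub_distrib]
    linarith [hy s, hz s]) s
  linarith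

/-- The comparison principle makes `I - ω` injective, and in finite dimension injective
endomorphisms are surjective. -/
theorem exists_solution (h : Transient ω nx) (f : X → ℝ) :
    ∃ y : X → ℝ, ∀ s, y s = f s + ∑ a, ω s a * y (nx s a) := by
  let L : (X → ℝ) →ₗ[ℝ] (X → ℝ) :=
    { toFun := fun y s => y s - ∑ a, ω s a * y (nx s a)
      map_add' := fun y z => by
        funext s
        simp only [Pi.add_apply, mul_add, Finset.sum_add_distrib]
        ring
      map_smul' := fun c y => by
        funext s
        simp only [Pi.smul_apply, smul_eq_mul, RingHom.id_apply, mul_sub, Finset.mul_sum]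
        congr 1
        exact Finset.sum_congr rfl fun a _ => by ring }
  have hinj : Function.Injective L := by
    rw [← LinearMap.ker_eq_bot, LinearMap.ker_eq_bot']
    intro y hy
    have hy' : ∀ s, y s - ∑ a, ω s a * y (nx s a) = 0 := fun s => congrFun hy s
    funext s
    refine le_antisymm ?_ ?_
    · refine h.le_of_sub_super (f := 0) (z := 0) (fun s => ?_) (fun s => ?_) s
      · simp only [Pi.zero_apply]; linarith [hy' s]
      · simp
    · refine h.le_of_sub_super (f := 0) (y := 0) (fun s => ?_) (fun s => ?_) s
      · simp
      · simp only [Pi.zero_apply]; linarith [hy' s]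
  obtain ⟨y, hy⟩ := (LinearMap.injective_iff_surjective.1 hinj) f
  refine ⟨y, fun s => ?_⟩
  have : y s - ∑ a, ω s a * y (nx s a) = f s := congrFun hy s
  linarith

theorem solution_unique (h : Transient ω nx) {f y z : X → ℝ}
    (hy : ∀ s, y s = f s + ∑ a, ω s a * y (nx s a))
    (hz : ∀ s, z s = f s + ∑ a, ω s a * z (nx s a)) (s : X) : y s = z s :=
  le_antisymm (h.le_of_sub_super (fun s => (hy s).le) (fun s => (hz s).ge) s)
    (h.le_of_sub_super (fun s => (hz s).le) (fun s => (hy s).ge) s)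

end Transient

/-- Moves that are discounted at every state are transient. -/
theorem transient_of_lt_one {ω : X → A → ℝ} (nx : X → A → X) (h0 : ∀ s a, 0 ≤ ω s a)
    (h1 : ∀ s, ∑ a, ω s a < 1) : Transient ω nx :=
  ⟨h0, fun s => (h1 s).le, fun s => ⟨s, Relation.ReflTransGen.refl, h1 s⟩⟩

/-- If the moves are split in two parts, and a state at which the first part is positive can be
reached from everywhere, then the second part is transient. -/
theorem transient_of_split {vw sw : X → A → ℝ} {nx : X → A → X} (hv : ∀ s a, 0 ≤ vw s a)
    (hs : ∀ s a, 0 ≤ sw s a) (hsum : ∀ s, ∑ a, (vw s a + sw s a) = 1) {t : X}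
    (ht : 0 < ∑ a, vw t a) (hl : ∀ s, Leads (fun s a => vw s a + sw s a) nx s t) :
    Transient sw nx := by
  have hsum' : ∀ s, ∑ a, vw s a + ∑ a, sw s a = 1 := fun s => by
    rw [← Finset.sum_add_distrib, hsum]
  have hv' : ∀ s, 0 ≤ ∑ a, vw s a := fun s => Finset.sum_nonneg fun a _ => hv s a
  refine ⟨hs, fun s => by linarith [hsum' s, hv' s], fun s => ?_⟩
  induction hl s using Relation.ReflTransGen.head_induction_on with
  | refl => exact ⟨t, Relation.ReflTransGen.refl, by linarith [hsum' t]⟩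
  | head hstep hrest ih =>
    rename_i b c
    -- Either `b` itself loses mass, or the first part vanishes at `b` and the step towards `t` is a
    -- move of the second part.
    by_cases h : ∑ a, sw b a < 1
    · exact ⟨b, Relation.ReflTransGen.refl, h⟩
    · obtain ⟨a, ha, rfl⟩ := hstep
      have h0 : ∑ a, vw b a = 0 := le_antisymm (by linarith [hsum' b]) (hv' b)
      have ha0 : vw b a = 0 :=
        (Finset.sum_eq_zero_iff_of_nonneg fun a _ => hv b a).1 h0 a (Finset.mem_univ a)
      obtain ⟨e, he, he1⟩ := ih
      refine ⟨e, Relation.ReflTransGen.head ⟨a, ?_, rfl⟩ he, he1⟩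
      simpa [ha0] using ha

/-- A finite stochastic matrix has a stationary distribution. -/
theorem exists_stationary [Fintype X] [Nonempty X] [DecidableEq X] (P : X → X → ℝ) (h0 : ∀ s t, 0 ≤ P s t)
    (h1 : ∀ s, ∑ t, P s t = 1) :
    ∃ μ ∈ stdSimplex ℝ X, ∀ t, μ t = ∑ s, P s t * μ s := by
  let M : Matrix X X ℝ := 1 - Matrix.of P
  -- The constants lie in the kernel of `I - P`, so there is also a left null vector `v`, of unknown
  -- sign.
  have hdet : M.det = 0 := by
    refine Matrix.exists_mulVec_eq_zero_iff.1 ⟨fun _ => 1, ?_, ?_⟩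
    · intro h
      obtain ⟨x⟩ := ‹Nonempty X›
      exact one_ne_zero (congrFun h x)
    · funext s
      rw [Matrix.sub_mulVec, Matrix.one_mulVec]
      simp [Matrix.mulVec, dotProduct, h1]
  obtain ⟨v, hv0, hv⟩ := Matrix.exists_vecMul_eq_zero_iff.2 hdet
  have hv' : ∀ t, v t = ∑ s, P s t * v s := fun t => by
    have := congrFun hv t
    rw [Matrix.vecMul_sub, Matrix.vecMul_one] at this
    simp only [Pi.sub_apply, Matrix.vecMul, dotProduct, Matrix.of_apply, Pi.zero_apply] at this
    rw [sub_eq_zero.1 this]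
    exact Finset.sum_congr rfl fun s _ => mul_comm _ _
  have hle : ∀ t, |v t| ≤ ∑ s, P s t * |v s| := fun t => by
    conv_lhs => rw [hv' t]
    refine (Finset.abs_sum_le_sum_abs _ _).trans (Finset.sum_le_sum fun s _ => ?_)
    rw [abs_mul, abs_of_nonneg (h0 s t)]
  -- Both sides of the pointwise inequality `hle` have the same total, so it is an equality and
  -- `|v|` is stationary.
  have hsum : ∑ t, ∑ s, P s t * |v s| = ∑ t, |v t| := by
    rw [Finset.sum_comm]
    exact Finset.sum_congr rfl fun s _ => by rw [← Finset.sum_mul, h1, one_mul]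
  have heq : ∀ t, |v t| = ∑ s, P s t * |v s| := fun t =>
    (Finset.sum_eq_sum_iff_of_le fun t _ => hle t).1 hsum.symm t (Finset.mem_univ t)
  have hpos : 0 < ∑ t, |v t| := by
    obtain ⟨x, hx⟩ := Function.ne_iff.1 hv0
    exact Finset.sum_pos' (fun t _ => abs_nonneg _) ⟨x, Finset.mem_univ x, abs_pos.2 hx⟩
  refine ⟨fun t => |v t| / ∑ t, |v t|, ⟨fun t => by positivity, ?_⟩, fun t => ?_⟩
  · rw [← Finset.sum_div, div_self hpos.ne']
  · calc |v t| / ∑ t, |v t| = (∑ s, P s t * |v s|) / ∑ t, |v t| := by rw [← heq t]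
      _ = _ := by
        rw [Finset.sum_div]
        exact Finset.sum_congr rfl fun s _ => by ring

end MoveChain

/-! ### Elementary facts about the model -/

theorem Game.sum_eq (f : Game → ℝ) : ∑ t, f t = f Game.G + f Game.B := by
  change ∑ t ∈ {Game.G, Game.B}, f t = _
  rw [Finset.sum_pair (by decide)]

theorem Move.sum_eq (f : Move → ℝ) : ∑ t, f t = f Move.C + f Move.N := by
  change ∑ t ∈ {Move.C, Move.N}, f t = _
  rw [Finset.sum_pair (by decide)]

theorem sum_obs (f : Obs → ℝ) : ∑ x, f x = ∑ t, ∑ o, f (t, o) := Fintype.sum_prod_type _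

namespace Env

variable (E : Env)

/-- The cooperation benefit in a period, `0` if there is no game. -/
noncomputable def benefit : Option Game → ℝ
  | none => 0
  | some g => E.c g

/-- The expected cooperation benefit in a period on task `t`. -/
noncomputable def flow (t : WorkTask) : ℝ := E.arrival t * E.c t

theorem gameProb_nonneg (t : WorkTask) (o : Option Game) : 0 ≤ E.gameProb t o := by
  cases o with
  | none => exact sub_nonneg.2 (E.arrival_le_one t)
  | some g =>
    simp only [gameProb]
    split_ifs
    · exact (E.arrival_pos t).le
    · exact le_rfl

theorem sum_gameProb_mul (t : WorkTask) (f : Option Game → ℝ) :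
    ∑ o, E.gameProb t o * f o = (1 - E.arrival t) * f none + E.arrival t * f (some t) := by
  rw [Fintype.sum_option, Game.sum_eq]
  cases t <;> simp [gameProb]

theorem sum_gameProb (t : WorkTask) : ∑ o, E.gameProb t o = 1 := by
  have := E.sum_gameProb_mul t fun _ => 1
  simp only [mul_one] at this
  rw [this]
  ring

theorem sum_gameProb_benefit (t : WorkTask) : ∑ o, E.gameProb t o * E.benefit o = E.flow t := by
  rw [sum_gameProb_mul]
  simp [benefit, flow]

/-- The expectation over the observations that follow a distribution over tasks. -/
theorem sum_task_gameProb_const (p : WorkTask → ℝ) (f : WorkTask → ℝ) :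
    ∑ x : Obs, p x.1 * E.gameProb x.1 x.2 * f x.1 = ∑ t, p t * f t := by
  rw [sum_obs]
  refine Finset.sum_congr rfl fun t _ => ?_
  calc ∑ o, p t * E.gameProb t o * f t = p t * f t * ∑ o, E.gameProb t o := by
        rw [Finset.mul_sum]
        exact Finset.sum_congr rfl fun o _ => by ring
    _ = p t * f t := by rw [sum_gameProb, mul_one]

theorem sum_task_gameProb_benefit (p : WorkTask → ℝ) (f : WorkTask → ℝ) :
    ∑ x : Obs, p x.1 * E.gameProb x.1 x.2 * (E.benefit x.2 + f x.1)
      = ∑ t, p t * (E.flow t + f t) := by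
  simp only [mul_add, Finset.sum_add_distrib, sum_task_gameProb_const]
  congr 1
  rw [sum_obs]
  refine Finset.sum_congr rfl fun t _ => ?_
  rw [← sum_gameProb_benefit, Finset.mul_sum]
  exact Finset.sum_congr rfl fun o _ => by ring

theorem obsProb_nonneg (m : Assignment) (s : State m.k) (x : Obs) : 0 ≤ E.obsProb m s x :=
  mul_nonneg ((m.next s).2.1 _) (E.gameProb_nonneg _ _)

theorem sum_obsProb (m : Assignment) (s : State m.k) : ∑ x, E.obsProb m s x = 1 := by
  have := E.sum_task_gameProb_const (m.next s).1 fun _ => 1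
  simp only [mul_one, (m.next s).2.2] at this
  exact this

theorem sum_trans_mul (m : Assignment) (s : State m.k) (f : State m.k → ℝ) :
    ∑ s', E.trans m s s' * f s' = ∑ x, E.obsProb m s x * f (s.push x) := by
  simp only [trans, Finset.sum_mul]
  rw [Finset.sum_comm]
  refine Finset.sum_congr rfl fun x _ => ?_
  simp [ite_mul]

theorem trans_nonneg (m : Assignment) (s s' : State m.k) : 0 ≤ E.trans m s s' :=
  Finset.sum_nonneg fun x _ => by
    split_ifs
    · exact E.obsProb_nonneg m s x
    · exact le_rfl

theorem trans_pos_iff (m : Assignment) (s s' : State m.k) :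
    0 < E.trans m s s' ↔ ∃ x, 0 < E.obsProb m s x ∧ s.push x = s' := by
  constructor
  · intro h
    by_contra hne
    push Not at hne
    refine h.ne' (Finset.sum_eq_zero fun x _ => ?_)
    split_ifs with hx
    · exact le_antisymm (not_lt.1 fun hp => hne x hp hx) (E.obsProb_nonneg m s x)
    · rfl
  · rintro ⟨x, hx, rfl⟩
    refine Finset.sum_pos' (fun y _ => ?_) ⟨x, Finset.mem_univ x, by simpa using hx⟩
    split_ifs
    · exact E.obsProb_nonneg m s y
    · exact le_rfl

theorem IsSteady.sum_mul {E : Env} {m : Assignment} {μ : State m.k → ℝ} (h : E.IsSteady m μ)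
    (f : State m.k → ℝ) :
    ∑ s, μ s * f s = ∑ s, μ s * ∑ x, E.obsProb m s x * f (s.push x) := by
  simp only [← sum_trans_mul, Finset.mul_sum]
  rw [Finset.sum_comm]
  refine Finset.sum_congr rfl fun s _ => ?_
  conv_lhs => rw [h.2 s, Finset.sum_mul]
  exact Finset.sum_congr rfl fun s' _ => by ring

theorem exists_isSteady (m : Assignment) : ∃ μ, E.IsSteady m μ := by
  have hne : Nonempty (State m.k) := ⟨fun _ => (Game.G, none)⟩
  obtain ⟨μ, hμ, h⟩ := MoveChain.exists_stationary (E.trans m) (E.trans_nonneg m) fun s => by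
    have := E.sum_trans_mul m s fun _ => 1
    simp only [mul_one, sum_obsProb] at this
    exact this
  exact ⟨μ, hμ, h⟩

/-- The share of task `t` in a steady state is the expected probability of being assigned to it. -/
theorem IsSteady.sum_task {E : Env} {m : Assignment} {μ : State m.k → ℝ} (h : E.IsSteady m μ)
    (t : WorkTask) :
    (∑ s : State m.k, if s.task = t then μ s else 0) = ∑ s, μ s * (m.next s).1 t := by
  have h1 := h.sum_mul fun s => if s.task = t then 1 else 0
  simp only [mul_ite, mul_one, mul_zero] at h1
  rw [h1]
  refine Finset.sum_congr rfl fun s _ => ?_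
  congr 1
  have h2 := E.sum_task_gameProb_const (m.next s).1 fun t' => if t' = t then 1 else 0
  simp only [mul_ite, mul_one, mul_zero, Finset.sum_ite_eq', Finset.mem_univ, if_true] at h2
  rw [← h2]
  refine Finset.sum_congr rfl fun x _ => ?_
  simp only [State.task, State.push, Fin.snoc_last, obsProb]

theorem player_update_self (g : Game) (i : Fin E.n) (x : Move) :
    E.pay g i (allPlay E.n x) = E.pay g E.player (allPlay E.n x) := by
  have := E.symmetric g (Equiv.swap i E.player) (allPlay E.n x) i
  rw [Equiv.swap_apply_left] at this
  exact this

theorem pay_update_allPlay (g : Game) (i : Fin E.n) (x y : Move) :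
    E.pay g i (Function.update (allPlay E.n x) i y)
      = E.pay g E.player (Function.update (allPlay E.n x) E.player y) := by
  have h := E.symmetric g (Equiv.swap i E.player)
    (Function.update (allPlay E.n x) E.player y) i
  rw [Equiv.swap_apply_left] at h
  rw [← h]
  congr 1
  funext j
  simp only [Function.comp_apply, Function.update_apply, allPlay]
  have : (Equiv.swap i E.player) j = E.player ↔ j = i := by
    rw [← Equiv.eq_symm_apply, Equiv.symm_swap, Equiv.swap_apply_right]
  simp only [this]

theorem c_pos (g : Game) : 0 < E.c g := by
  have hne : allPlay E.n Move.N ≠ allPlay E.n Move.C := fun h => by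
    have := congrFun h E.player
    simp [allPlay] at this
  have h := E.coop_max g _ hne
  simp only [E.player_update_self g] at h
  simp only [Finset.sum_const, Finset.card_univ, Fintype.card_fin, nsmul_eq_mul] at h
  have hn : (0 : ℝ) < E.n := by
    have := E.two_le_n
    exact_mod_cast (by omega : 0 < E.n)
  have := lt_of_mul_lt_mul_left h hn.le
  simp only [c]
  linarith

theorem d_pos (g : Game) : 0 < E.d g := by
  have h := E.dominant g E.player (allPlay E.n Move.C)
  have h2 : Function.update (allPlay E.n Move.C) E.player Move.C = allPlay E.n Move.C :=
    Function.update_eq_self E.player (allPlay E.n Move.C)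
  rw [h2] at h
  simp only [d]
  linarith

theorem flow_pos (t : WorkTask) : 0 < E.flow t := mul_pos (E.arrival_pos t) (E.c_pos t)

theorem benefit_nonneg (o : Option Game) : 0 ≤ E.benefit o := by
  cases o with
  | none => exact le_rfl
  | some g => exact (E.c_pos g).le

end Env

/-! ### Assignments that cycle through a plan -/

/-- The cost of a period on a bad task is `1`, a period on a good task earns `ρ`. -/
def taskCost (ρ : ℝ) : WorkTask → ℝ
  | Game.G => -ρ
  | Game.B => 1

/-- The number of the most recent periods that were all on the bad task (most recent first). -/
def badRun : List Obs → ℕ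
  | [] => 0
  | x :: l => if x.1 = Game.B then badRun l + 1 else 0

theorem badRun_le_length (l : List Obs) : badRun l ≤ l.length := by
  induction l with
  | nil => simp [badRun]
  | cons x l ih =>
    simp only [badRun, List.length_cons]
    split_ifs <;> omega

theorem badRun_dropLast (l : List Obs) : badRun l.dropLast = min (badRun l) (l.length - 1) := by
  induction l with
  | nil => simp [badRun]
  | cons x l ih =>
    cases l with
    | nil => simp [badRun]
    | cons y l =>
      rw [List.dropLast_cons_cons]
      simp only [badRun, List.length_cons] at ih ⊢
      simp only [ih]
      split_ifs <;> omega

/-- The observations in the memory, the most recent one first. -/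
def State.toList {k : ℕ} (s : State k) : List Obs := (List.ofFn s).reverse

theorem State.length_toList {k : ℕ} (s : State k) : s.toList.length = k + 1 := by
  simp [State.toList]

/-- Bounded memory thus amounts to the effect of `List.dropLast` on whatever is computed from the
list. -/
theorem State.toList_push {k : ℕ} (s : State k) (x : Obs) :
    (s.push x).toList = (x :: s.toList).dropLast := by
  have h : List.ofFn (s.push x) = (List.ofFn s).tail ++ [x] := by
    rw [State.push, List.ofFn_succ', List.ofFn_succ]
    simp [Fin.tail, List.concat_eq_append]
  have hne : (List.ofFn s).reverse ≠ [] := by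
    rw [ne_eq, List.reverse_eq_nil_iff, List.ofFn_eq_nil_iff]
    omega
  rw [State.toList, h, State.toList, List.reverse_append, List.dropLast_cons_of_ne_nil hne,
    List.dropLast_reverse]
  rfl

theorem State.toList_eq_cons {k : ℕ} (s : State k) :
    s.toList = s (Fin.last k) :: s.toList.tail := by
  rw [State.toList, List.ofFn_succ']
  simp [List.concat_eq_append]

namespace Env

/-- A plan describes tasks with complete cooperation, without a bound on the memory: `Z` are the
situations that may arise, `val` is a lower bound for the value of future cooperation, and `pot` is
a potential for the cost of the bad tasks net of `ρ` times the good tasks. -/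
structure Plan (E : Env) (Z : Type) where
  task : Z → WorkTask → ℝ
  task_nonneg : ∀ z t, 0 ≤ task z t
  task_sum : ∀ z, ∑ t, task z t = 1
  nxt : Z → Obs → Option Z
  nxt_none : ∀ z x, nxt z x = none → task z x.1 * E.gameProb x.1 x.2 = 0
  val : Z → ℝ
  val_le : ∀ z, val z ≤ ∑ x : Obs, task z x.1 * E.gameProb x.1 x.2 *
    (E.δ * (E.benefit x.2 + (nxt z x).elim 0 val))
  incentive : ∀ z x z', nxt z x = some z' → ∀ g, x.2 = some g → E.d g ≤ val z'
  start : Z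
  incentive_start : E.d Game.G ≤ val start
  ρ : ℝ
  pot : Z → ℝ
  pot_ge : ∀ z, ∑ x : Obs, task z x.1 * E.gameProb x.1 x.2 *
    (taskCost ρ x.1 + (nxt z x).elim 0 pot) ≤ pot z

/-- The modes of an assignment that cycles through a plan: bad tasks until there are enough of them
in a row, a block of bad tasks of random length, or the `j`-th period of the plan. -/
inductive Mode (Z : Type)
  | force
  | block
  | run (z : Z) (j : ℕ)

namespace Plan

variable {E : Env} {Z : Type} (P : E.Plan Z)

/-- The mode after the observation `x`, unless a block has been completed. -/
def stepMode (x : Obs) : Mode Z → Mode Z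
  | .force => .force
  -- The fallback to `.force` never matters: after a bad task `decode` still sees a long run and
  -- stays in `.block`, and the game `B` cannot arrive on the good task.
  | .block => if x.1 = Game.G ∧ x.2 ≠ some Game.B then .run P.start 1 else .force
  | .run z j => match P.nxt z x with
    | none => .force
    | some z' => .run z' (j + 1)

/-- The mode after a list of observations (most recent first), when blocks have length `L`. -/
def decode (L : ℕ) : List Obs → Mode Z
  | [] => .force
  -- A long run of bad tasks overrides every mode. It is the marker that makes the mode independent
  -- of the more distant past.
  | x :: l => if L ≤ badRun (x :: l) then .block else P.stepMode x (decode L l)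

/-- The memory needed to determine a mode. -/
def need (L : ℕ) : Mode Z → ℕ
  | .force => 0
  | .block => L
  -- The `j` periods of the run and the `L` last bad tasks of the marker before it.
  | .run _ j => j + L

theorem need_stepMode {L : ℕ} (x : Obs) (M : Mode Z) :
    P.stepMode x M = .force ∨ need L (P.stepMode x M) = need L M + 1 := by
  cases M with
  | force => exact Or.inl rfl
  | block =>
    simp only [stepMode]
    split_ifs
    · right; simp only [need]; omega
    · exact Or.inl rfl
  | run z j =>
    simp only [stepMode]
    cases P.nxt z x with
    | none => exact Or.inl rfl
    | some z' => right; simp only [need]; omega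

theorem need_decode_le (L : ℕ) (l : List Obs) : need L (P.decode L l) ≤ l.length := by
  induction l with
  | nil => simp [decode, need]
  | cons x l ih =>
    have h1 := badRun_le_length (x :: l)
    simp only [decode]
    split_ifs with h
    · exact h.trans h1
    · rcases P.need_stepMode (L := L) x (P.decode L l) with h2 | h2
      · rw [h2]; exact Nat.zero_le _
      · rw [h2, List.length_cons]; omega

/-- Forgetting the oldest observation is harmless until it cuts into the marker, and then the mode
falls back to `.force`. Induction works because each step either gives `.force` or needs exactly one
more observation, and `.force` persists until a new marker. -/
theorem decode_dropLast (L : ℕ) (hL : 0 < L) (l : List Obs) :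
    (need L (P.decode L l) < l.length → P.decode L l.dropLast = P.decode L l) ∧
      (need L (P.decode L l) = l.length → P.decode L l.dropLast = .force) := by
  have short : ∀ l : List Obs, l.length < L → P.decode L l = .force := by
    intro l
    induction l with
    | nil => intro; rfl
    | cons x l ih =>
      intro hl
      have h1 := badRun_le_length (x :: l)
      rw [decode, if_neg (by omega), ih (by simp only [List.length_cons] at hl; omega)]
      rfl
  induction l with
  | nil => exact ⟨fun _ => rfl, fun _ => rfl⟩
  | cons x l ih =>
    cases l with
    | nil =>
      refine ⟨fun h => ?_, fun _ => rfl⟩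
      simp only [List.length_cons, List.length_nil] at h
      have : P.decode L [x] = .force := by
        by_cases h1 : L ≤ badRun [x]
        · have h2 : P.decode L [x] = .block := by rw [decode, if_pos h1]
          rw [h2] at h; simp only [need] at h; omega
        · rw [decode, if_neg h1]; rfl
      rw [this]; rfl
    | cons y l =>
      have hd := badRun_dropLast (x :: y :: l)
      rw [List.dropLast_cons_cons] at hd ⊢
      by_cases h1 : L ≤ badRun (x :: y :: l)
      · have h2 : P.decode L (x :: y :: l) = .block := by rw [decode, if_pos h1]
        rw [h2]
        constructor
        · intro h
          simp only [need] at h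
          rw [decode, if_pos (by omega)]
        · intro h
          simp only [need] at h
          refine short _ ?_
          simp only [List.length_cons, List.length_dropLast] at h ⊢
          omega
      · have h2 : P.decode L (x :: y :: l) = P.stepMode x (P.decode L (y :: l)) := by
          rw [decode, if_neg h1]
        have h3 : P.decode L (x :: (y :: l).dropLast)
            = P.stepMode x (P.decode L (y :: l).dropLast) := by
          rw [decode, if_neg (by omega)]
        rw [h2, h3]
        have hlen : (x :: y :: l).length = (y :: l).length + 1 := rfl
        have hle := P.need_decode_le L (y :: l)
        rcases P.need_stepMode (L := L) x (P.decode L (y :: l)) with h4 | h4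
        · rw [h4]
          constructor
          · intro _
            rcases lt_or_eq_of_le hle with h5 | h5
            · rw [ih.1 h5, h4]
            · rw [ih.2 h5]; rfl
          · intro h; simp [need] at h
        · rw [h4, hlen]
          constructor
          · intro h; rw [ih.1 (by omega)]
          · intro h; rw [ih.2 (by omega)]; rfl

/-- A run opens with a good task. Hence a marker can arise within a run only after about `L` of its
periods. -/
theorem badRun_lt_of_run {L : ℕ} {l : List Obs} {z : Z} {j : ℕ} (h : P.decode L l = .run z j) :
    badRun l < j := by
  induction l generalizing z j with
  | nil => simp [decode] at h
  | cons x l ih =>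
    simp only [decode] at h
    split_ifs at h with h1
    cases hm : P.decode L l with
    | force => rw [hm] at h; simp [stepMode] at h
    | block =>
      rw [hm] at h
      simp only [stepMode] at h
      split_ifs at h with h2
      · simp only [Mode.run.injEq] at h
        simp [badRun, h2.1, ← h.2]
    | run z₁ j₁ =>
      rw [hm] at h
      simp only [stepMode] at h
      cases hn : P.nxt z₁ x with
      | none => rw [hn] at h; simp at h
      | some z' =>
        rw [hn] at h
        simp only [Mode.run.injEq] at h
        have := ih hm
        simp only [badRun]
        split_ifs <;> omega

theorem badRun_lt_of_force {L : ℕ} (hL : 0 < L) {l : List Obs} (h : P.decode L l = .force) :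
    badRun l < L := by
  cases l with
  | nil => simpa [badRun] using hL
  | cons x l =>
    simp only [decode] at h
    split_ifs at h with h1
    omega

theorem badRun_ge_of_block {L : ℕ} {l : List Obs} (h : P.decode L l = .block) :
    L ≤ badRun l := by
  cases l with
  | nil => simp [decode] at h
  | cons x l =>
    simp only [decode] at h
    split_ifs at h with h1
    · exact h1
    · exfalso
      cases hm : P.decode L l with
      | force => rw [hm] at h; simp [stepMode] at h
      | block => rw [hm] at h; simp only [stepMode] at h; split_ifs at h
      | run z₁ j₁ =>
        rw [hm] at h
        simp only [stepMode] at h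
        cases hn : P.nxt z₁ x <;> rw [hn] at h <;> simp at h

theorem incentive_of_run {L : ℕ} {l : List Obs} {x : Obs} {z : Z} {j : ℕ}
    (h : P.decode L (x :: l) = .run z j) {g : Game} (hg : x.2 = some g) : E.d g ≤ P.val z := by
  simp only [decode] at h
  split_ifs at h with h1
  cases hm : P.decode L l with
  | force => rw [hm] at h; simp [stepMode] at h
  | block =>
    rw [hm] at h
    simp only [stepMode] at h
    split_ifs at h with h2
    · simp only [Mode.run.injEq] at h
      rw [← h.1]
      cases g with
      | G => exact P.incentive_start
      | B => exact absurd hg h2.2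
  | run z₁ j₁ =>
    rw [hm] at h
    simp only [stepMode] at h
    cases hn : P.nxt z₁ x with
    | none => rw [hn] at h; simp at h
    | some z' =>
      rw [hn] at h
      simp only [Mode.run.injEq] at h
      rw [← h.1]
      exact P.incentive _ _ _ hn g hg

/-- The good task with probability `p`, and the bad task otherwise. -/
noncomputable def mixTask (p : ℝ) (h0 : 0 ≤ p) (h1 : p ≤ 1) : stdSimplex ℝ WorkTask :=
  ⟨fun t => match t with
    | Game.G => p
    | Game.B => 1 - p,
    fun t => by cases t <;> simp [h0, h1], by rw [Game.sum_eq]; ring⟩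

/-- The task distribution in a mode; blocks of bad tasks end at rate `p`. -/
noncomputable def nextOf (p : ℝ) (h0 : 0 ≤ p) (h1 : p ≤ 1) : Mode Z → stdSimplex ℝ WorkTask
  | .force => mixTask 0 le_rfl zero_le_one
  | .block => mixTask p h0 h1
  | .run z _ => ⟨P.task z, P.task_nonneg z, P.task_sum z⟩

/-- The assignment that cycles through the plan. -/
noncomputable def cycle (L k : ℕ) (p : ℝ) (h0 : 0 ≤ p) (h1 : p ≤ 1) : Assignment where
  k := k
  next s := P.nextOf p h0 h1 (P.decode L s.toList)

/-- A lower bound for the value of future cooperation in a mode. -/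
def modeVal (ub : ℝ) : Mode Z → ℝ
  | .force => ub
  | .block => ub
  | .run z _ => P.val z

/-- The potential of a mode, when the last `b` periods were on the bad task. -/
def modePot (L : ℕ) (ε C : ℝ) (b : ℕ) : Mode Z → ℝ
  -- The number of bad tasks still missing for a marker.
  | .force => L - b
  | .block => 0
  -- The drop to about `-C` on entering a run pays for the preceding block. The run repays it at `ε`
  -- per period until the next marker is affordable.
  | .run z j => (1 + ε) * P.pot z + ε * j - C

theorem decode_push {L k : ℕ} (hL : 0 < L) (s : State k) (x : Obs) :
    (need L (P.decode L (x :: s.toList)) < k + 2 →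
      P.decode L (s.push x).toList = P.decode L (x :: s.toList)) ∧
    (need L (P.decode L (x :: s.toList)) = k + 2 → P.decode L (s.push x).toList = .force) := by
  have h := P.decode_dropLast L hL (x :: s.toList)
  rw [State.toList_push]
  rw [List.length_cons, State.length_toList] at h
  exact h

/-- Markers and exhausted memory lead to `.block` or `.force`, which carry the largest bound `ub`.
Interrupting a run can therefore only raise the bound. -/
theorem modeVal_push {L k : ℕ} (hL : 0 < L) {ub : ℝ} (hub : ∀ z, P.val z ≤ ub) (s : State k)
    (x : Obs) : P.modeVal ub (P.stepMode x (P.decode L s.toList))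
      ≤ P.modeVal ub (P.decode L (s.push x).toList) := by
  have hle : ∀ M, P.modeVal ub M ≤ ub := fun M => by
    cases M with
    | force => exact le_rfl
    | block => exact le_rfl
    | run z j => exact hub z
  have h := P.decode_push hL s x
  have hn := P.need_decode_le L (x :: s.toList)
  rw [List.length_cons, State.length_toList] at hn
  rcases lt_or_eq_of_le hn with h1 | h1
  · rw [h.1 h1, decode]
    split_ifs
    · exact hle _
    · exact le_rfl
  · rw [h.2 h1]; exact hle _

/-- Runs inherit `val_le`; the bad tasks of the other modes are valuable enough to support `ub`,
even if a block may end with a less valuable run. -/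
theorem val_cycle {L k : ℕ} (hL : 0 < L) {p : ℝ} (h0 : 0 ≤ p) (h1 : p ≤ 1) {ub : ℝ}
    (hub : ∀ z, P.val z ≤ ub) (hforce : ub ≤ E.δ * (E.flow Game.B + ub))
    (hblock : ub ≤ E.δ * ((1 - p) * (E.flow Game.B + ub) + p * (E.flow Game.G + P.val P.start)))
    (s : State k) :
    P.modeVal ub (P.decode L s.toList) ≤ E.δ * ∑ x, E.obsProb (P.cycle L k p h0 h1) s x *
      (E.benefit x.2 + P.modeVal ub (P.decode L (s.push x).toList)) := by
  have hstep := P.modeVal_push hL hub s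
  have hop : ∀ x, E.obsProb (P.cycle L k p h0 h1) s x
      = (P.nextOf p h0 h1 (P.decode L s.toList)).1 x.1 * E.gameProb x.1 x.2 := fun x => rfl
  have mono : ∀ f : Obs → ℝ, (∀ x, f x ≤ P.modeVal ub (P.decode L (s.push x).toList)) →
      E.δ * ∑ x, E.obsProb (P.cycle L k p h0 h1) s x * (E.benefit x.2 + f x)
        ≤ E.δ * ∑ x, E.obsProb (P.cycle L k p h0 h1) s x *
          (E.benefit x.2 + P.modeVal ub (P.decode L (s.push x).toList)) := fun f hf => by
    refine mul_le_mul_of_nonneg_left (Finset.sum_le_sum fun x _ => ?_) E.δ_pos.le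
    exact mul_le_mul_of_nonneg_left (by linarith [hf x]) (E.obsProb_nonneg _ _ _)
  cases hm : P.decode L s.toList with
  | force =>
    rw [hm] at hstep
    refine le_trans ?_ (mono (fun _ => ub) fun x => hstep x)
    simp only [hop, hm]
    rw [E.sum_task_gameProb_benefit _ fun _ => ub, Game.sum_eq]
    simpa [nextOf, mixTask, modeVal] using hforce
  | block =>
    rw [hm] at hstep
    let lb : WorkTask → ℝ := fun t => match t with
      | Game.G => P.val P.start
      | Game.B => ub
    refine le_trans ?_ (mono (fun x => lb x.1) fun x => le_trans ?_ (hstep x))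
    · simp only [hop, hm]
      rw [E.sum_task_gameProb_benefit _ lb, Game.sum_eq]
      simp only [nextOf, mixTask, modeVal, lb]
      linarith
    · obtain ⟨t, o⟩ := x
      simp only [stepMode]
      split_ifs with h
      · cases t with
        | G => exact le_rfl
        | B => simp at h
      · cases t with
        | G => exact hub _
        | B => exact le_rfl
  | run z j =>
    rw [hm] at hstep
    refine (P.val_le z).trans ?_
    rw [Finset.mul_sum]
    refine Finset.sum_le_sum fun x _ => ?_
    rw [hop, hm]
    simp only [nextOf]
    cases hn : P.nxt z x with
    | none => rw [P.nxt_none z x hn]; simp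
    | some z' =>
      have h2 : P.val z' ≤ P.modeVal ub (P.decode L (s.push x).toList) := by
        have := hstep x
        simp only [stepMode, hn] at this
        exact this
      simp only [Option.elim_some]
      have h3 : 0 ≤ P.task z x.1 * E.gameProb x.1 x.2 :=
        mul_nonneg (P.task_nonneg _ _) (E.gameProb_nonneg _ _)
      have h4 := mul_le_mul_of_nonneg_left h2 (mul_nonneg E.δ_pos.le h3)
      linarith

/-- The three numerical hypotheses cover the three ways of changing mode: `hstart` a block that ends
at rate `p`, `hblock` a run interrupted by a marker arising within it, `hforce` a run that exhausts
the memory and has to pay for a whole new marker. -/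
theorem pot_cycle {L k : ℕ} (hL : 0 < L) (hLk : L ≤ k) {p : ℝ} (h0 : 0 ≤ p) (h1 : p ≤ 1)
    {ε C Φ : ℝ} (hε : 0 ≤ ε) (hΦ : ∀ z, |P.pot z| ≤ Φ)
    (hstart : 1 - p + p * (-((1 + ε) * P.ρ + ε) + ((1 + ε) * P.pot P.start + ε - C)) ≤ 0)
    (hblock : C + (1 + ε) * Φ ≤ ε * L) (hforce : L + C + (1 + ε) * Φ ≤ ε * (k + 2 - L))
    (s : State k) :
    ∑ x, E.obsProb (P.cycle L k p h0 h1) s x * (taskCost ((1 + ε) * P.ρ + ε) x.1 +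
        P.modePot L ε C (badRun (s.push x).toList) (P.decode L (s.push x).toList))
      ≤ P.modePot L ε C (badRun s.toList) (P.decode L s.toList) := by
  set ρ₁ := (1 + ε) * P.ρ + ε with hρ₁
  have hop : ∀ x, E.obsProb (P.cycle L k p h0 h1) s x
      = (P.nextOf p h0 h1 (P.decode L s.toList)).1 x.1 * E.gameProb x.1 x.2 := fun x => rfl
  have hpush := P.decode_push hL s
  have hblk : ∀ x, L ≤ badRun (x :: s.toList) → P.decode L (s.push x).toList = .block := by
    intro x hx
    have h2 : P.decode L (x :: s.toList) = .block := by rw [decode, if_pos hx]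
    rw [(hpush x).1 (by rw [h2]; simp only [need]; omega), h2]
  have hnon : ∀ x, ¬ L ≤ badRun (x :: s.toList) →
      P.decode L (x :: s.toList) = P.stepMode x (P.decode L s.toList) := fun x hx => by
    rw [decode, if_neg hx]
  -- It suffices to bound cost plus new potential at the observations of positive probability.
  have key : ∀ (f : Obs → ℝ) (b : ℝ),
      (∀ x, (P.nextOf p h0 h1 (P.decode L s.toList)).1 x.1 * E.gameProb x.1 x.2 = 0 ∨
        taskCost ρ₁ x.1 +
          P.modePot L ε C (badRun (s.push x).toList) (P.decode L (s.push x).toList) ≤ f x) →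
      ∑ x, E.obsProb (P.cycle L k p h0 h1) s x * f x ≤ b →
      ∑ x, E.obsProb (P.cycle L k p h0 h1) s x * (taskCost ρ₁ x.1 +
        P.modePot L ε C (badRun (s.push x).toList) (P.decode L (s.push x).toList)) ≤ b := by
    intro f b hf hb
    refine (Finset.sum_le_sum fun x _ => ?_).trans hb
    rcases hf x with h2 | h2
    · rw [hop, h2, zero_mul, zero_mul]
    · exact mul_le_mul_of_nonneg_left h2 (E.obsProb_nonneg _ _ _)
  cases hm : P.decode L s.toList with
  | force =>
    have hb := P.badRun_lt_of_force hL hm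
    rw [hm] at key
    refine key (fun _ => L - badRun s.toList) _ (fun x => ?_) ?_
    · obtain ⟨t, o⟩ := x
      cases t with
      | G => left; simp [nextOf, mixTask]
      | B =>
        right
        have hrun : badRun ((Game.B, o) :: s.toList) = badRun s.toList + 1 := by simp [badRun]
        by_cases h2 : L ≤ badRun ((Game.B, o) :: s.toList)
        · rw [hblk _ h2]
          have : (badRun s.toList : ℝ) + 1 ≤ L := by exact_mod_cast hb
          simp only [taskCost, modePot]
          linarith
        · have h3 := hnon _ h2
          rw [hm] at h3
          simp only [stepMode] at h3
          rw [(hpush _).1 (by rw [h3]; simp only [need]; omega), h3]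
          have h4 : badRun (s.push (Game.B, o)).toList = badRun s.toList + 1 := by
            rw [State.toList_push, badRun_dropLast, hrun, List.length_cons, State.length_toList]
            omega
          simp only [taskCost, modePot, h4]
          push_cast
          linarith
    · simp only [hop, hm]
      rw [E.sum_task_gameProb_const _ fun _ => (L - badRun s.toList : ℝ), Game.sum_eq]
      simp [nextOf, mixTask, modePot]
  | block =>
    have hb := P.badRun_ge_of_block hm
    rw [hm] at key
    let f : WorkTask → ℝ := fun t => match t with
      | Game.G => -ρ₁ + ((1 + ε) * P.pot P.start + ε - C)
      | Game.B => 1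
    refine key (fun x => f x.1) _ (fun x => ?_) ?_
    · obtain ⟨t, o⟩ := x
      cases t with
      | G =>
        by_cases ho : o = some Game.B
        · left; simp [ho, gameProb]
        · right
          have h2 : ¬ L ≤ badRun ((Game.G, o) :: s.toList) := by simp [badRun]; omega
          have h3 := hnon _ h2
          rw [hm] at h3
          simp only [stepMode, ne_eq, ho, not_false_eq_true, and_self, if_true] at h3
          rw [(hpush _).1 (by rw [h3]; simp only [need]; omega), h3]
          simp [taskCost, modePot, f]
      | B =>
        right
        rw [hblk _ (by simp only [badRun, if_true]; omega)]
        simp [taskCost, modePot, f]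
    · simp only [hop, hm]
      rw [E.sum_task_gameProb_const _ f, Game.sum_eq]
      simp only [nextOf, mixTask, modePot, f]
      linarith
  | run z j =>
    have hb := P.badRun_lt_of_run hm
    rw [hm] at key
    refine key (fun x => (1 + ε) * (taskCost P.ρ x.1 + (P.nxt z x).elim 0 P.pot) + (ε * j - C)) _
      (fun x => ?_) ?_
    · cases hn : P.nxt z x with
      | none => left; exact P.nxt_none z x hn
      | some z' =>
        right
        -- The rate `ρ₁` is designed for this identity: after scaling by `1 + ε`, each period of a
        -- run saves exactly `ε`, which accumulates as `ε * j`.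
        have hcost : taskCost ρ₁ x.1 + ε = (1 + ε) * taskCost P.ρ x.1 := by
          cases x.1 <;> simp only [taskCost, hρ₁] <;> ring
        simp only [Option.elim_some]
        have hpot := (abs_le.1 (hΦ z')).1
        have hpot' : -((1 + ε) * Φ) ≤ (1 + ε) * P.pot z' := by nlinarith
        suffices hs : P.modePot L ε C (badRun (s.push x).toList) (P.decode L (s.push x).toList)
            ≤ (1 + ε) * P.pot z' + ε * (j + 1) - C by linarith
        by_cases h2 : L ≤ badRun (x :: s.toList)
        · rw [hblk _ h2]
          have h3 : L ≤ j + 1 := by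
            have : badRun (x :: s.toList) ≤ badRun s.toList + 1 := by
              simp only [badRun]; split_ifs <;> omega
            omega
          have h4 : (L : ℝ) ≤ j + 1 := by exact_mod_cast h3
          have := mul_le_mul_of_nonneg_left h4 hε
          simp only [modePot]
          linarith
        · have h3 := hnon _ h2
          rw [hm] at h3
          simp only [stepMode, hn] at h3
          have hle := P.need_decode_le L (x :: s.toList)
          rw [List.length_cons, State.length_toList] at hle
          rcases lt_or_eq_of_le hle with h4 | h4
          · rw [(hpush x).1 h4, h3]
            simp [modePot]
          · rw [(hpush x).2 h4]
            rw [h3] at h4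
            simp only [need] at h4
            -- `k + 1` remembered observations and the new one make `k + 2`, of which `L` belong to
            -- the marker; this is the length of a run that exhausts the memory.
            have h5 : (j : ℝ) + 1 = k + 2 - L := by
              have : ((j + 1 + L : ℕ) : ℝ) = ((k + 1 + 1 : ℕ) : ℝ) := by exact_mod_cast h4
              push_cast at this
              linarith
            have h6 : (0 : ℝ) ≤ badRun (s.push x).toList := Nat.cast_nonneg _
            simp only [modePot]
            rw [h5]
            linarith
    · simp only [hop, hm, nextOf, modePot, mul_add, Finset.sum_add_distrib]
      have h2 := P.pot_ge z
      simp only [mul_add, Finset.sum_add_distrib] at h2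
      have h3 := E.sum_task_gameProb_const (P.task z) fun _ => 1
      simp only [mul_one, P.task_sum] at h3
      rw [← Finset.sum_mul, h3]
      have h4 : ∀ f : Obs → ℝ, ∑ x : Obs, P.task z x.1 * E.gameProb x.1 x.2 * ((1 + ε) * f x)
          = (1 + ε) * ∑ x : Obs, P.task z x.1 * E.gameProb x.1 x.2 * f x := fun f => by
        rw [Finset.mul_sum]
        exact Finset.sum_congr rfl fun x _ => by ring
      rw [h4, h4]
      nlinarith

/-- A plan can be approximated by an assignment with bounded memory. -/
theorem exists_assignment {ub Φ ρ₁ : ℝ} (hub : ∀ z, P.val z ≤ ub) (hd : ∀ g, E.d g ≤ ub)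
    (hlt : ub < E.δ * (E.flow Game.B + ub)) (hΦ : ∀ z, |P.pot z| ≤ Φ) (hρ : 0 ≤ P.ρ)
    (hρ₁ : P.ρ < ρ₁) :
    ∃ m : Assignment, m.k ≠ 0 ∧
      (∃ V : State m.k → ℝ,
        (∀ s, V s ≤ E.δ * ∑ x, E.obsProb m s x * (E.benefit x.2 + V (s.push x))) ∧
        ∀ s g, s.game = some g → E.d g ≤ V s) ∧
      ∃ W : State m.k → ℝ,
        ∀ s, ∑ x, E.obsProb m s x * (taskCost ρ₁ x.1 + W (s.push x)) ≤ W s := by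
  have hub0 : 0 < ub := (E.d_pos Game.G).trans_le (hd _)
  have hst : 0 < P.val P.start := (E.d_pos Game.G).trans_le P.incentive_start
  obtain ⟨p, hp0, hp1, hp⟩ : ∃ p : ℝ, 0 < p ∧ p ≤ 1 ∧
      ub ≤ E.δ * ((1 - p) * (E.flow Game.B + ub) + p * (E.flow Game.G + P.val P.start)) := by
    have hD : 0 < E.δ * (E.flow Game.B + ub) := hub0.trans hlt
    -- With this `p`, the event that the block continues already provides the value `ub`; the start
    -- of a run adds something nonnegative.
    refine ⟨1 - ub / (E.δ * (E.flow Game.B + ub)), ?_, ?_, ?_⟩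
    · rw [sub_pos, div_lt_one hD]; exact hlt
    · have : 0 < ub / (E.δ * (E.flow Game.B + ub)) := div_pos hub0 hD
      linarith
    · have h2 : ub / (E.δ * (E.flow Game.B + ub)) * (E.δ * (E.flow Game.B + ub)) = ub :=
        div_mul_cancel₀ _ hD.ne'
      have h3 : 0 ≤ 1 - ub / (E.δ * (E.flow Game.B + ub)) := by
        rw [sub_nonneg, div_le_one hD]; exact hlt.le
      have h4 : 0 ≤ (1 - ub / (E.δ * (E.flow Game.B + ub))) *
          (E.flow Game.G + P.val P.start) := mul_nonneg h3 (by linarith [E.flow_pos Game.G])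
      have h5 := mul_nonneg E.δ_pos.le h4
      nlinarith
  obtain ⟨ε, hε, hερ⟩ : ∃ ε : ℝ, 0 < ε ∧ (1 + ε) * P.ρ + ε = ρ₁ := by
    refine ⟨(ρ₁ - P.ρ) / (P.ρ + 1), div_pos (by linarith) (by linarith), ?_⟩
    field_simp
    ring
  have hΦ0 : 0 ≤ Φ := (abs_nonneg _).trans (hΦ P.start)
  -- `1 / p` covers the expected number of bad tasks in a block, the other terms the potential at
  -- the start of a run.
  obtain ⟨C, hC⟩ : ∃ C, C = 1 / p + (1 + ε) * Φ + ε := ⟨_, rfl⟩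
  have hstart : 1 - p + p * (-((1 + ε) * P.ρ + ε) + ((1 + ε) * P.pot P.start + ε - C)) ≤ 0 := by
    have h2 : p * (1 / p) = 1 := mul_one_div_cancel hp0.ne'
    have h3 := (abs_le.1 (hΦ P.start)).2
    have h4 : 0 ≤ p * ((1 + ε) * (Φ - P.pot P.start)) :=
      mul_nonneg hp0.le (mul_nonneg (by linarith) (by linarith))
    have h5 : 0 ≤ p * ((1 + ε) * P.ρ + ε) :=
      mul_nonneg hp0.le (add_nonneg (mul_nonneg (by linarith) hρ) hε.le)
    rw [hC]
    nlinarith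
  obtain ⟨L₀, hL₀⟩ := exists_nat_ge ((C + (1 + ε) * Φ) / ε)
  obtain ⟨L, hL⟩ : ∃ L, L = L₀ + 1 := ⟨_, rfl⟩
  have hL1 : C + (1 + ε) * Φ ≤ ε * L := by
    rw [div_le_iff₀ hε] at hL₀
    rw [hL]
    push_cast
    nlinarith
  -- The marker length is fixed first; the memory is then made long enough for a full run to pay for
  -- such a marker.
  obtain ⟨N, hN⟩ := exists_nat_ge ((L + C + (1 + ε) * Φ) / ε)
  have hk : L + C + (1 + ε) * Φ ≤ ε * (((L + N : ℕ) : ℝ) + 2 - L) := by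
    rw [div_le_iff₀ hε] at hN
    push_cast
    nlinarith
  have hLpos : 0 < L := by omega
  refine ⟨P.cycle L (L + N) p hp0.le hp1, ?_, ⟨fun s => P.modeVal ub (P.decode L s.toList),
    P.val_cycle hLpos hp0.le hp1 hub hlt.le hp, ?_⟩,
    fun s => P.modePot L ε C (badRun s.toList) (P.decode L s.toList), ?_⟩
  · change L + N ≠ 0
    omega
  · intro s g hg
    change E.d g ≤ P.modeVal ub (P.decode L (State.toList s))
    cases hm : P.decode L (State.toList s) with
    | force => exact hd g
    | block => exact hd g
    | run z j =>
      rw [State.toList_eq_cons] at hm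
      exact P.incentive_of_run hm hg
  · rw [← hερ]
    exact P.pot_cycle hLpos (Nat.le_add_right _ _) hp0.le hp1 hε.le hΦ hstart hL1 hk

end Plan

end Env

/-! ### Plans from Markov chains with unobserved moves -/

namespace Env

/-- A finite Markov chain some of whose moves are periods with complete cooperation (of weight
`vw`, with the observation `ob`), while its other moves (of weight `sw`) take no time. -/
structure Scheme (E : Env) (X A : Type) [Fintype X] [Fintype A] where
  vw : X → A → ℝ
  sw : X → A → ℝ
  nx : X → A → X
  ob : A → Obs
  task : X → WorkTask → ℝ
  vw_nonneg : ∀ s a, 0 ≤ vw s a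
  task_nonneg : ∀ s t, 0 ≤ task s t
  weight_sum : ∀ s, ∑ t, task s t + ∑ a, sw s a = 1
  vw_eq : ∀ s x, (∑ a, if ob a = x then vw s a else 0) = task s x.1 * E.gameProb x.1 x.2
  transient : MoveChain.Transient sw nx

namespace Scheme

variable {E : Env} {X A : Type} [Fintype X] [Fintype A] (S : E.Scheme X A)

open Classical in
/-- The probability that the first observed move from `s` gives the observation `x` and leads to
the state `s'`. -/
noncomputable def kernel (x : Obs) (s' : X) : X → ℝ :=
  (S.transient.exists_solution fun s => ∑ a, if S.ob a = x ∧ S.nx s a = s' then S.vw s a else 0).choose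

open Classical in
theorem kernel_eq (x : Obs) (s' s : X) :
    S.kernel x s' s = (∑ a, if S.ob a = x ∧ S.nx s a = s' then S.vw s a else 0)
      + ∑ a, S.sw s a * S.kernel x s' (S.nx s a) :=
  (S.transient.exists_solution fun s =>
    ∑ a, if S.ob a = x ∧ S.nx s a = s' then S.vw s a else 0).choose_spec s

/-- The distribution of the task of the first observed move. -/
noncomputable def firstTask (t : WorkTask) : X → ℝ :=
  (S.transient.exists_solution fun s => S.task s t).choose

theorem firstTask_eq (t : WorkTask) (s : X) :
    S.firstTask t s = S.task s t + ∑ a, S.sw s a * S.firstTask t (S.nx s a) :=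
  (S.transient.exists_solution fun s => S.task s t).choose_spec s

theorem kernel_nonneg (x : Obs) (s' s : X) : 0 ≤ S.kernel x s' s := by
  classical
  refine S.transient.nonneg_of_superharmonic (fun s => ?_) s
  rw [S.kernel_eq x s' s]
  have : 0 ≤ ∑ a, if S.ob a = x ∧ S.nx s a = s' then S.vw s a else 0 :=
    Finset.sum_nonneg fun a _ => by
      split_ifs
      · exact S.vw_nonneg s a
      · exact le_rfl
  linarith

theorem firstTask_nonneg (t : WorkTask) (s : X) : 0 ≤ S.firstTask t s := by
  refine S.transient.nonneg_of_superharmonic (fun s => ?_) s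
  rw [S.firstTask_eq t s]
  linarith [S.task_nonneg s t]

theorem sum_firstTask (s : X) : ∑ t, S.firstTask t s = 1 := by
  refine S.transient.solution_unique (f := fun s => ∑ t, S.task s t)
    (y := fun s => ∑ t, S.firstTask t s) (z := fun _ => 1) (fun s => ?_) (fun s => ?_) s
  · simp only [Finset.mul_sum]
    rw [Finset.sum_comm, ← Finset.sum_add_distrib]
    exact Finset.sum_congr rfl fun t _ => S.firstTask_eq t s
  · simp only [mul_one]
    exact (S.weight_sum s).symm

/-- First-step analysis: the first move is either observed, or silent and followed by a fresh start.
-/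
theorem sum_kernel_mul (F : Obs → X → ℝ) (s : X) :
    ∑ x, ∑ s', S.kernel x s' s * F x s' = ∑ a, S.vw s a * F (S.ob a) (S.nx s a)
      + ∑ a, S.sw s a * ∑ x, ∑ s', S.kernel x s' (S.nx s a) * F x s' := by
  classical
  have h1 : ∑ a, S.sw s a * ∑ x, ∑ s', S.kernel x s' (S.nx s a) * F x s'
      = ∑ x, ∑ s', (∑ a, S.sw s a * S.kernel x s' (S.nx s a)) * F x s' := by
    simp only [Finset.mul_sum, Finset.sum_mul]
    rw [Finset.sum_comm]
    refine Finset.sum_congr rfl fun x _ => ?_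
    rw [Finset.sum_comm]
    exact Finset.sum_congr rfl fun s' _ => Finset.sum_congr rfl fun a _ => by ring
  have h2 : ∑ a, S.vw s a * F (S.ob a) (S.nx s a)
      = ∑ x, ∑ s', (∑ a, if S.ob a = x ∧ S.nx s a = s' then S.vw s a else 0) * F x s' := by
    simp only [Finset.sum_mul]
    symm
    calc ∑ x, ∑ s', ∑ a, (if S.ob a = x ∧ S.nx s a = s' then S.vw s a else 0) * F x s'
        = ∑ x, ∑ a, ∑ s', (if S.ob a = x ∧ S.nx s a = s' then S.vw s a else 0) * F x s' :=
          Finset.sum_congr rfl fun x _ => Finset.sum_comm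
      _ = ∑ a, ∑ x, ∑ s', (if S.ob a = x ∧ S.nx s a = s' then S.vw s a else 0) * F x s' :=
          Finset.sum_comm
      _ = _ := Finset.sum_congr rfl fun a _ => by
          simp [ite_and, ite_mul, Finset.sum_ite_eq]
  rw [h1, h2, ← Finset.sum_add_distrib]
  refine Finset.sum_congr rfl fun x _ => ?_
  rw [← Finset.sum_add_distrib]
  refine Finset.sum_congr rfl fun s' _ => ?_
  rw [← add_mul, ← S.kernel_eq]

/-- Silent moves do not bias the games: given the task of the first observed move, the game has its
usual arrival law. An assignment, which controls the tasks only, can therefore reproduce the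
observed process. -/
theorem sum_kernel (x : Obs) (s : X) :
    ∑ s', S.kernel x s' s = S.firstTask x.1 s * E.gameProb x.1 x.2 := by
  have key := fun s => S.sum_kernel_mul (fun y _ => if y = x then 1 else 0) s
  simp only [mul_ite, mul_one, mul_zero, S.vw_eq] at key
  have h1 : ∀ s, (∑ y, ∑ s', if y = x then S.kernel y s' s else 0) = ∑ s', S.kernel x s' s :=
    fun s => by
      rw [Finset.sum_comm]
      exact Finset.sum_congr rfl fun s' _ => by simp
  simp only [h1] at key
  refine S.transient.solution_unique (f := fun s => S.task s x.1 * E.gameProb x.1 x.2)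
    (y := fun s => ∑ s', S.kernel x s' s)
    (z := fun s => S.firstTask x.1 s * E.gameProb x.1 x.2) key (fun s => ?_) s
  rw [S.firstTask_eq x.1 s, add_mul, Finset.sum_mul]
  congr 1
  exact Finset.sum_congr rfl fun a _ => by ring

/-- This confines the posterior after `x` to states entered by an observed move with observation
`x`, where the incentive constraint is known. -/
theorem kernel_eq_zero {x : Obs} {s' : X}
    (h : ∀ s a, S.ob a = x → S.nx s a = s' → S.vw s a = 0) (s : X) : S.kernel x s' s = 0 := by
  classical
  refine S.transient.solution_unique (f := fun _ => 0) (z := fun _ => 0) (fun s => ?_)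
    (fun s => by simp) s
  conv_lhs => rw [S.kernel_eq x s' s]
  congr 1
  refine Finset.sum_eq_zero fun a _ => ?_
  split_ifs with h1
  · exact h s a h1.1 h1.2
  · rfl

/-- The distribution of the next task, for a belief over the states. -/
noncomputable def beliefTask (ν : stdSimplex ℝ X) (t : WorkTask) : ℝ :=
  ∑ s, ν.1 s * S.firstTask t s

theorem beliefTask_mul (ν : stdSimplex ℝ X) (x : Obs) :
    S.beliefTask ν x.1 * E.gameProb x.1 x.2 = ∑ s', ∑ s, ν.1 s * S.kernel x s' s := by
  rw [Finset.sum_comm, beliefTask, Finset.sum_mul]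
  refine Finset.sum_congr rfl fun s _ => ?_
  rw [← Finset.mul_sum, sum_kernel, mul_assoc]

theorem belief_mul_nonneg (ν : stdSimplex ℝ X) (x : Obs) (s' : X) :
    0 ≤ ∑ s, ν.1 s * S.kernel x s' s :=
  Finset.sum_nonneg fun s _ => mul_nonneg (ν.2.1 s) (S.kernel_nonneg x s' s)

open Classical in
/-- The posterior belief after the observation `x`. -/
noncomputable def posterior (ν : stdSimplex ℝ X) (x : Obs) : Option (stdSimplex ℝ X) :=
  if h : S.beliefTask ν x.1 * E.gameProb x.1 x.2 = 0 then none
  else some ⟨fun s' => (∑ s, ν.1 s * S.kernel x s' s) / (S.beliefTask ν x.1 * E.gameProb x.1 x.2),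
    fun s' => div_nonneg (S.belief_mul_nonneg ν x s') (by
      rw [beliefTask_mul]; exact Finset.sum_nonneg fun s' _ => S.belief_mul_nonneg ν x s'), by
      rw [← Finset.sum_div, ← beliefTask_mul, div_self h]⟩

theorem beliefTask_mul_posterior (ν : stdSimplex ℝ X) (x : Obs) (f : X → ℝ) :
    S.beliefTask ν x.1 * E.gameProb x.1 x.2 *
        (S.posterior ν x).elim 0 (fun π => ∑ s', π.1 s' * f s')
      = ∑ s, ν.1 s * ∑ s', S.kernel x s' s * f s' := by
  have hr : ∑ s, ν.1 s * ∑ s', S.kernel x s' s * f s'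
      = ∑ s', (∑ s, ν.1 s * S.kernel x s' s) * f s' := by
    simp only [Finset.mul_sum, Finset.sum_mul]
    rw [Finset.sum_comm]
    exact Finset.sum_congr rfl fun s' _ => Finset.sum_congr rfl fun s _ => by ring
  rw [hr]
  unfold posterior
  split_ifs with h
  · rw [h, zero_mul]
    rw [beliefTask_mul] at h
    symm
    refine Finset.sum_eq_zero fun s' _ => ?_
    rw [(Finset.sum_eq_zero_iff_of_nonneg fun s' _ => S.belief_mul_nonneg ν x s').1 h s'
      (Finset.mem_univ s'), zero_mul]
  · simp only [Option.elim_some]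
    rw [Finset.mul_sum]
    refine Finset.sum_congr rfl fun s' _ => ?_
    rw [← mul_assoc, mul_comm _ (_ / _), div_mul_cancel₀ _ h]

/-- The law of iterated expectations. It lets functions that are linear in the belief inherit the
one-step inequalities of the states. -/
theorem sum_belief (ν : stdSimplex ℝ X) (f : Obs → ℝ) (g : X → ℝ) :
    ∑ x : Obs, S.beliefTask ν x.1 * E.gameProb x.1 x.2 *
        (f x + (S.posterior ν x).elim 0 fun π => ∑ s', π.1 s' * g s')
      = ∑ s, ν.1 s * ∑ x, ∑ s', S.kernel x s' s * (f x + g s') := by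
  simp only [mul_add, beliefTask_mul_posterior, Finset.sum_add_distrib, ← Finset.sum_mul,
    sum_kernel, Finset.mul_sum]
  congr 1
  · rw [Finset.sum_comm]
    refine Finset.sum_congr rfl fun x _ => ?_
    rw [beliefTask, Finset.sum_mul, Finset.sum_mul]
    exact Finset.sum_congr rfl fun s _ => by ring
  · rw [Finset.sum_comm]

open Classical in
/-- The belief that the state is `z`. -/
noncomputable def pointBelief (z : X) : stdSimplex ℝ X :=
  ⟨Pi.single z 1, single_mem_stdSimplex ℝ z⟩

/-- The plan over the beliefs about the state of a scheme. -/
noncomputable def toPlan (U φ : X → ℝ) (ρ : ℝ) (z₀ : X)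
    (hU : ∀ s, U s ≤ ∑ a, S.vw s a * (E.δ * (E.benefit (S.ob a).2 + U (S.nx s a)))
      + ∑ a, S.sw s a * U (S.nx s a))
    (hφ : ∀ s, ∑ a, S.vw s a * (taskCost ρ (S.ob a).1 + φ (S.nx s a))
      + ∑ a, S.sw s a * φ (S.nx s a) ≤ φ s)
    (hinc : ∀ s a, 0 < S.vw s a → ∀ g, (S.ob a).2 = some g → E.d g ≤ U (S.nx s a))
    (hz₀ : E.d Game.G ≤ U z₀) : E.Plan (stdSimplex ℝ X) where
  task := S.beliefTask
  task_nonneg ν t :=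
    Finset.sum_nonneg fun s _ => mul_nonneg (ν.2.1 s) (S.firstTask_nonneg t s)
  task_sum ν := by
    simp only [beliefTask]
    rw [Finset.sum_comm]
    simp only [← Finset.mul_sum, sum_firstTask, mul_one]
    exact ν.2.2
  nxt := S.posterior
  nxt_none ν x h := by
    unfold posterior at h
    split_ifs at h with h1
    exact h1
  val ν := ∑ s, ν.1 s * U s
  val_le ν := by
    have h1 := S.sum_belief ν (fun x => E.benefit x.2) U
    have h2 : ∑ x : Obs, S.beliefTask ν x.1 * E.gameProb x.1 x.2 *
        (E.δ * (E.benefit x.2 + (S.posterior ν x).elim 0 fun π => ∑ s', π.1 s' * U s'))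
        = E.δ * ∑ s, ν.1 s * ∑ x, ∑ s', S.kernel x s' s * (E.benefit x.2 + U s') := by
      rw [← h1, Finset.mul_sum]
      exact Finset.sum_congr rfl fun x _ => by ring
    rw [h2, Finset.mul_sum]
    refine Finset.sum_le_sum fun s _ => ?_
    have h3 : U s ≤ E.δ * ∑ x, ∑ s', S.kernel x s' s * (E.benefit x.2 + U s') := by
      refine S.transient.le_of_sub_super
        (z := fun s => E.δ * ∑ x, ∑ s', S.kernel x s' s * (E.benefit x.2 + U s'))
        hU (fun s => le_of_eq ?_) s
      rw [S.sum_kernel_mul (fun x s' => E.benefit x.2 + U s') s, mul_add, Finset.mul_sum,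
        Finset.mul_sum]
      congr 1 <;> exact Finset.sum_congr rfl fun a _ => by ring
    calc ν.1 s * U s ≤ ν.1 s * (E.δ * ∑ x, ∑ s', S.kernel x s' s * (E.benefit x.2 + U s')) :=
          mul_le_mul_of_nonneg_left h3 (ν.2.1 s)
      _ = _ := by ring
  incentive ν x π h g hg := by
    unfold posterior at h
    split_ifs at h with h1
    simp only [Option.some.injEq] at h
    have hπ : ∀ s', π.1 s' = (∑ s, ν.1 s * S.kernel x s' s) /
        (S.beliefTask ν x.1 * E.gameProb x.1 x.2) := fun s' => by rw [← h]
    -- The constraint holds at each state in the support of the posterior, hence for the mean.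
    have h2 : 0 ≤ ∑ s', π.1 s' * (U s' - E.d g) := Finset.sum_nonneg fun s' _ => by
      by_cases h3 : E.d g ≤ U s'
      · exact mul_nonneg (π.2.1 s') (sub_nonneg.2 h3)
      · have h4 : ∀ s, S.kernel x s' s = 0 := S.kernel_eq_zero fun s a ha hs => by
          by_contra h5
          refine h3 ?_
          rw [← hs]
          exact hinc s a (lt_of_le_of_ne (S.vw_nonneg s a) (Ne.symm h5)) g (by rw [ha, hg])
        rw [hπ]
        simp [h4]
    simp only [mul_sub, Finset.sum_sub_distrib, ← Finset.sum_mul, π.2.2, one_mul] at h2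
    linarith
  start := pointBelief z₀
  incentive_start := by
    classical
    simpa [pointBelief, Pi.single_apply] using hz₀
  ρ := ρ
  pot ν := ∑ s, ν.1 s * φ s
  pot_ge ν := by
    rw [S.sum_belief ν (fun x => taskCost ρ x.1) φ]
    refine Finset.sum_le_sum fun s _ => mul_le_mul_of_nonneg_left ?_ (ν.2.1 s)
    refine S.transient.le_of_sub_super
      (y := fun s => ∑ x, ∑ s', S.kernel x s' s * (taskCost ρ x.1 + φ s')) (fun s => le_of_eq ?_)
      hφ s
    exact S.sum_kernel_mul (fun x s' => taskCost ρ x.1 + φ s') s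

/-- A scheme with a value that makes cooperation incentive compatible and a potential for the cost
of its tasks can be approximated by an assignment. -/
theorem exists_assignment (U φ : X → ℝ) {ρ ρ₁ ub : ℝ} (z₀ : X)
    (hU : ∀ s, U s ≤ ∑ a, S.vw s a * (E.δ * (E.benefit (S.ob a).2 + U (S.nx s a)))
      + ∑ a, S.sw s a * U (S.nx s a))
    (hφ : ∀ s, ∑ a, S.vw s a * (taskCost ρ (S.ob a).1 + φ (S.nx s a))
      + ∑ a, S.sw s a * φ (S.nx s a) ≤ φ s)
    (hinc : ∀ s a, 0 < S.vw s a → ∀ g, (S.ob a).2 = some g → E.d g ≤ U (S.nx s a))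
    (hz₀ : E.d Game.G ≤ U z₀) (hub : ∀ s, U s ≤ ub) (hd : ∀ g, E.d g ≤ ub)
    (hlt : ub < E.δ * (E.flow Game.B + ub)) (hρ : 0 ≤ ρ) (hρ₁ : ρ < ρ₁) :
    ∃ m : Assignment, m.k ≠ 0 ∧
      (∃ V : State m.k → ℝ,
        (∀ s, V s ≤ E.δ * ∑ x, E.obsProb m s x * (E.benefit x.2 + V (s.push x))) ∧
        ∀ s g, s.game = some g → E.d g ≤ V s) ∧
      ∃ W : State m.k → ℝ,
        ∀ s, ∑ x, E.obsProb m s x * (taskCost ρ₁ x.1 + W (s.push x)) ≤ W s := by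
  refine (S.toPlan U φ ρ z₀ hU hφ hinc hz₀).exists_assignment (ub := ub) (Φ := ∑ s, |φ s|)
    (fun ν => ?_) hd hlt (fun ν => ?_) hρ hρ₁
  · calc ∑ s, ν.1 s * U s ≤ ∑ s, ν.1 s * ub :=
          Finset.sum_le_sum fun s _ => mul_le_mul_of_nonneg_left (hub s) (ν.2.1 s)
      _ = ub := by rw [← Finset.sum_mul, ν.2.2, one_mul]
  · refine (Finset.abs_sum_le_sum_abs _ _).trans (Finset.sum_le_sum fun s _ => ?_)
    rw [abs_mul, abs_of_nonneg (ν.2.1 s)]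
    have h1 : ν.1 s ≤ 1 := by
      rw [← ν.2.2]
      exact Finset.single_le_sum (fun s _ => ν.2.1 s) (Finset.mem_univ s)
    exact mul_le_of_le_one_left (abs_nonneg _) h1

end Scheme

end Env

/-! ### Irreducible chains with partial cooperation -/

namespace Env

/-- An irreducible Markov chain of tasks and games in which the players cooperate in some periods,
with effective discount factor `disc`; `u` is the value of future cooperation. -/
structure CoopChain (E : Env) (X : Type) [Fintype X] where
  task : X → WorkTask → ℝ
  task_nonneg : ∀ s t, 0 ≤ task s t
  task_sum : ∀ s, ∑ t, task s t = 1
  nx : X → Obs → X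
  irreducible : ∀ s t, MoveChain.Leads (fun s x => task s x.1 * E.gameProb x.1 x.2) nx s t
  μ : X → ℝ
  μ_pos : ∀ s, 0 < μ s
  stationary : ∀ f : X → ℝ,
    ∑ s, μ s * f s = ∑ s, μ s * ∑ x : Obs, task s x.1 * E.gameProb x.1 x.2 * f (nx s x)
  vis : X → WorkTask → Prop
  disc : ℝ
  disc_nonneg : 0 ≤ disc
  disc_le : disc ≤ E.δ
  u : X → ℝ
  /-- the observed moves: `coop s t` is the probability of cooperation on task `t` after `s` -/
  coop : X → WorkTask → ℝ
  coop_of_vis : ∀ s t, vis s t → coop s t = task s t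
  coop_of_not_vis : ∀ s t, ¬ vis s t → coop s t = 0
  u_eq : ∀ s, u s = disc * (∑ x : Obs, coop s x.1 * E.gameProb x.1 x.2 * E.benefit x.2
    + ∑ x : Obs, task s x.1 * E.gameProb x.1 x.2 * u (nx s x))
  incentive : ∀ s t, 0 < coop s t → E.d t ≤ u (nx s (t, some t))

namespace CoopChain

variable {E : Env} {X : Type} [Fintype X] (K : E.CoopChain X)

/-- The weights of all moves. -/
def w (s : X) (x : Obs) : ℝ := K.task s x.1 * E.gameProb x.1 x.2

/-- The weights of the moves with cooperation. -/
def v (s : X) (x : Obs) : ℝ := K.coop s x.1 * E.gameProb x.1 x.2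

/-- The weights of the moves without cooperation. -/
def h (s : X) (x : Obs) : ℝ := (K.task s x.1 - K.coop s x.1) * E.gameProb x.1 x.2

/-- The share of the periods on task `t` with cooperation. -/
def share (t : WorkTask) : ℝ := ∑ s, K.μ s * K.coop s t

theorem v_add_h (s : X) (x : Obs) : K.v s x + K.h s x = K.w s x := by
  simp only [v, h, w]; ring

theorem coop_nonneg (s : X) (t : WorkTask) : 0 ≤ K.coop s t := by
  by_cases hv : K.vis s t
  · rw [K.coop_of_vis s t hv]; exact K.task_nonneg s t
  · rw [K.coop_of_not_vis s t hv]

theorem coop_le (s : X) (t : WorkTask) : K.coop s t ≤ K.task s t := by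
  by_cases hv : K.vis s t
  · rw [K.coop_of_vis s t hv]
  · rw [K.coop_of_not_vis s t hv]; exact K.task_nonneg s t

theorem w_nonneg (s : X) (x : Obs) : 0 ≤ K.w s x :=
  mul_nonneg (K.task_nonneg _ _) (E.gameProb_nonneg _ _)

theorem v_nonneg (s : X) (x : Obs) : 0 ≤ K.v s x :=
  mul_nonneg (K.coop_nonneg _ _) (E.gameProb_nonneg _ _)

theorem h_nonneg (s : X) (x : Obs) : 0 ≤ K.h s x :=
  mul_nonneg (sub_nonneg.2 (K.coop_le _ _)) (E.gameProb_nonneg _ _)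

theorem sum_w (s : X) : ∑ x, K.w s x = 1 := by
  have := E.sum_task_gameProb_const (K.task s) fun _ => 1
  simp only [mul_one, K.task_sum] at this
  exact this

theorem sum_v_mul (s : X) (f : WorkTask → ℝ) : ∑ x, K.v s x * f x.1 = ∑ t, K.coop s t * f t :=
  E.sum_task_gameProb_const _ _

theorem sum_v_benefit (s : X) : ∑ x, K.v s x * E.benefit x.2 = ∑ t, K.coop s t * E.flow t := by
  have := E.sum_task_gameProb_benefit (K.coop s) fun _ => 0
  simp only [add_zero] at this
  exact this

theorem disc_lt_one : K.disc < 1 := K.disc_le.trans_lt E.δ_lt_one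

theorem u_eq' (s : X) : K.u s = K.disc * ∑ x, K.v s x * E.benefit x.2
    + ∑ x, K.disc * K.w s x * K.u (K.nx s x) := by
  rw [K.u_eq s, mul_add]
  congr 1
  rw [Finset.mul_sum]
  exact Finset.sum_congr rfl fun x _ => by simp only [w]; ring

theorem sum_v_benefit_nonneg (s : X) : 0 ≤ ∑ x, K.v s x * E.benefit x.2 :=
  Finset.sum_nonneg fun x _ => mul_nonneg (K.v_nonneg s x) (E.benefit_nonneg _)

theorem u_super (s : X) : ∑ x, K.disc * K.w s x * K.u (K.nx s x) ≤ K.u s := by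
  have h1 := K.u_eq' s
  have h2 := mul_nonneg K.disc_nonneg (K.sum_v_benefit_nonneg s)
  linarith

theorem discounted_nonneg (s : X) (x : Obs) : 0 ≤ K.disc * K.w s x :=
  mul_nonneg K.disc_nonneg (K.w_nonneg s x)

theorem sum_discounted (s : X) : ∑ x, K.disc * K.w s x = K.disc := by
  rw [← Finset.mul_sum, K.sum_w, mul_one]

theorem u_nonneg (s : X) : 0 ≤ K.u s :=
  (MoveChain.transient_of_lt_one K.nx K.discounted_nonneg fun s => by
    rw [K.sum_discounted]; exact K.disc_lt_one).nonneg_of_superharmonic K.u_super s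

/-- A cooperating player must have something to lose, so `u` is positive after cooperation and
`disc` is positive; irreducibility carries this to all states. -/
theorem u_pos {s₀ : X} {t₀ : WorkTask} (h₀ : 0 < K.coop s₀ t₀) (s : X) : 0 < K.u s := by
  have hd := (E.d_pos t₀).trans_le (K.incentive s₀ t₀ h₀)
  have hdisc : 0 < K.disc := by
    refine lt_of_le_of_ne K.disc_nonneg fun h0 => ?_
    have := K.u_eq (K.nx s₀ (t₀, some t₀))
    rw [← h0, zero_mul] at this
    linarith
  refine lt_of_le_of_ne (K.u_nonneg s) fun h0 => ?_
  have := MoveChain.eq_of_leads_of_superharmonic (y := K.u) (v := 0) K.discounted_nonneg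
    (fun s => by rw [K.sum_discounted]; exact K.disc_lt_one.le) K.u_super le_rfl K.u_nonneg h0.symm
    ((K.irreducible s (K.nx s₀ (t₀, some t₀))).mono
      (fun s x hx => mul_pos hdisc hx))
  linarith

/-- The moves discounted in periods with cooperation only. -/
def q (s : X) (x : Obs) : ℝ := E.δ * K.v s x + K.h s x

theorem sum_v_pos {s₀ : X} {t₀ : WorkTask} (h₀ : 0 < K.coop s₀ t₀) : 0 < ∑ x, K.v s₀ x := by
  have h1 := K.sum_v_mul s₀ fun _ => 1
  simp only [mul_one] at h1
  rw [h1]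
  exact Finset.sum_pos' (fun t _ => K.coop_nonneg s₀ t) ⟨t₀, Finset.mem_univ _, h₀⟩

/-- Each cooperative period loses the mass `1 - δ`, and by irreducibility such periods are reached
from everywhere. -/
theorem q_transient {s₀ : X} {t₀ : WorkTask} (h₀ : 0 < K.coop s₀ t₀) :
    MoveChain.Transient K.q K.nx := by
  have heq : (fun s x => (1 - E.δ) * K.v s x + K.q s x) = fun s x => K.w s x := by
    funext s x
    rw [← K.v_add_h]
    simp only [q]
    ring
  refine MoveChain.transient_of_split (vw := fun s x => (1 - E.δ) * K.v s x) (t := s₀)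
    (fun s x => mul_nonneg (sub_nonneg.2 E.δ_lt_one.le) (K.v_nonneg s x))
    (fun s x => add_nonneg (mul_nonneg E.δ_pos.le (K.v_nonneg s x)) (K.h_nonneg s x))
    (fun s => ?_) ?_ fun s => ?_
  · simp only [congrFun (congrFun heq s)]
    exact K.sum_w s
  · rw [← Finset.mul_sum]
    exact mul_pos (sub_pos.2 E.δ_lt_one) (K.sum_v_pos h₀)
  · rw [heq]
    exact K.irreducible s s₀

theorem q_nonneg (s : X) (x : Obs) : 0 ≤ K.q s x :=
  add_nonneg (mul_nonneg E.δ_pos.le (K.v_nonneg s x)) (K.h_nonneg s x)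

theorem leads_q (s t : X) : MoveChain.Leads K.q K.nx s t :=
  (K.irreducible s t).mono fun s x hx => by
    have h1 := K.v_add_h s x
    have h2 : 0 < K.w s x := hx
    have h3 := mul_nonneg E.δ_pos.le (K.v_nonneg s x)
    rcases (K.h_nonneg s x).lt_or_eq with h4 | h4
    · exact add_pos_of_nonneg_of_pos h3 h4
    · exact add_pos_of_pos_of_nonneg (mul_pos E.δ_pos (by linarith)) (K.h_nonneg s x)

/-- `û` is the value of future cooperation if the periods without cooperation take no time. -/
def IsValue (û : X → ℝ) : Prop :=
  ∀ s, û s = E.δ * ∑ x, K.v s x * E.benefit x.2 + ∑ x, K.q s x * û (K.nx s x)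

variable {K} {û : X → ℝ}

/-- The surplus `û - u` is superharmonic with two sources: benefits that reshuffling discounts too
much, and the delay of future benefits by non-cooperative periods. -/
theorem IsValue.slack_le (hû : K.IsValue û) {s₀ : X} {t₀ : WorkTask} (h₀ : 0 < K.coop s₀ t₀) (s : X) :
    ∑ x, K.q s x * (û (K.nx s x) - K.u (K.nx s x)) + ((E.δ - K.disc) * ∑ x, K.v s x * E.benefit x.2
      + (1 - K.disc) * ∑ x, K.h s x * K.u (K.nx s x)) ≤ û s - K.u s := by
  rw [hû s, K.u_eq' s]
  have h1 : ∑ x, K.disc * K.w s x * K.u (K.nx s x) = K.disc * ∑ x, K.v s x * K.u (K.nx s x)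
      + K.disc * ∑ x, K.h s x * K.u (K.nx s x) := by
    rw [Finset.mul_sum, Finset.mul_sum, ← Finset.sum_add_distrib]
    exact Finset.sum_congr rfl fun x _ => by rw [← K.v_add_h]; ring
  have h2 : ∑ x, K.q s x * (û (K.nx s x) - K.u (K.nx s x)) = ∑ x, K.q s x * û (K.nx s x)
      - (E.δ * ∑ x, K.v s x * K.u (K.nx s x) + ∑ x, K.h s x * K.u (K.nx s x)) := by
    rw [Finset.mul_sum, ← Finset.sum_add_distrib, ← Finset.sum_sub_distrib]
    exact Finset.sum_congr rfl fun x _ => by simp only [q]; ring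
  have h3 : 0 ≤ (E.δ - K.disc) * ∑ x, K.v s x * K.u (K.nx s x) :=
    mul_nonneg (sub_nonneg.2 K.disc_le) (Finset.sum_nonneg fun x _ =>
      mul_nonneg (K.v_nonneg s x) (K.u_pos h₀ _).le)
  rw [h1, h2]
  linarith

variable (K) in
theorem slack_nonneg {s₀ : X} {t₀ : WorkTask} (h₀ : 0 < K.coop s₀ t₀) (s : X) :
    0 ≤ (E.δ - K.disc) * ∑ x, K.v s x * E.benefit x.2 ∧
      0 ≤ (1 - K.disc) * ∑ x, K.h s x * K.u (K.nx s x) :=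
  ⟨mul_nonneg (sub_nonneg.2 K.disc_le) (K.sum_v_benefit_nonneg s),
    mul_nonneg (sub_nonneg.2 K.disc_lt_one.le) (Finset.sum_nonneg fun x _ =>
      mul_nonneg (K.h_nonneg s x) (K.u_pos h₀ _).le)⟩

theorem IsValue.u_le (hû : K.IsValue û) {s₀ : X} {t₀ : WorkTask} (h₀ : 0 < K.coop s₀ t₀) (s : X) : K.u s ≤ û s := by
  have := (K.q_transient h₀).nonneg_of_superharmonic (y := fun s => û s - K.u s) (fun s => by
    have h1 := hû.slack_le h₀ s
    have h2 := K.slack_nonneg h₀ s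
    linarith) s
  linarith

/-- If the surplus vanished at one state, it would vanish everywhere by irreducibility, and so would
both sources. But waste makes one of them positive, as `u` and the expected benefit at `s₀` are
positive. -/
theorem IsValue.u_lt (hû : K.IsValue û) {s₀ : X} {t₀ : WorkTask} (h₀ : 0 < K.coop s₀ t₀)
    (hbad : K.disc < E.δ ∨ ∃ s t, K.coop s t < K.task s t) (s : X) : K.u s < û s := by
  refine lt_of_le_of_ne (hû.u_le h₀ s) fun he => ?_
  have hzero : ∀ t, û t - K.u t = 0 := fun t =>
    MoveChain.eq_of_leads_of_superharmonic (y := fun s => û s - K.u s) (v := 0) K.q_nonneg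
      (K.q_transient h₀).sum_le_one (fun s => by
        have h1 := hû.slack_le h₀ s
        have h2 := K.slack_nonneg h₀ s
        linarith) le_rfl (fun s => by linarith [hû.u_le h₀ s]) (by rw [he, sub_self])
      (K.leads_q s t)
  have hslack : ∀ t, (E.δ - K.disc) * ∑ x, K.v t x * E.benefit x.2 ≤ 0 ∧
      (1 - K.disc) * ∑ x, K.h t x * K.u (K.nx t x) ≤ 0 := fun t => by
    have h1 := hû.slack_le h₀ t
    have h2 := K.slack_nonneg h₀ t
    simp only [hzero, mul_zero, Finset.sum_const_zero] at h1
    constructor <;> linarith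
  rcases hbad with hd | ⟨s₁, t₁, h1⟩
  · have h2 := (hslack s₀).1
    have h3 : 0 < ∑ x, K.v s₀ x * E.benefit x.2 := by
      rw [K.sum_v_benefit]
      exact Finset.sum_pos' (fun t _ => mul_nonneg (K.coop_nonneg s₀ t) (E.flow_pos t).le)
        ⟨t₀, Finset.mem_univ _, mul_pos h₀ (E.flow_pos t₀)⟩
    nlinarith
  · have h2 := (hslack s₁).2
    have h3 : 0 < ∑ x, K.h s₁ x * K.u (K.nx s₁ x) := by
      refine Finset.sum_pos' (fun x _ => mul_nonneg (K.h_nonneg s₁ x) (K.u_pos h₀ _).le)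
        ⟨(t₁, some t₁), Finset.mem_univ _, mul_pos (mul_pos (sub_pos.2 h1) ?_) (K.u_pos h₀ _)⟩
      simp only [gameProb, if_true]
      exact E.arrival_pos t₁
    have := K.disc_lt_one
    nlinarith

/-- Compare with bad tasks forever, worth `δ * flow B / (1 - δ)`. Every cooperative good period
falls short of it, and irreducibility makes the loss felt at every state. -/
theorem IsValue.lt_bad_value (hû : K.IsValue û) (hflow : E.flow Game.G < E.flow Game.B) {s₀ : X}
    (h₀ : 0 < K.coop s₀ Game.G) (s : X) : (1 - E.δ) * û s < E.δ * E.flow Game.B := by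
  have hδ := E.δ_lt_one
  have hsup : ∀ s, ∑ x, K.q s x * (E.δ * E.flow Game.B - (1 - E.δ) * û (K.nx s x)) +
      (1 - E.δ) * (E.δ * (K.coop s Game.G * (E.flow Game.B - E.flow Game.G)))
      = E.δ * E.flow Game.B - (1 - E.δ) * û s := fun s => by
    have h1 : ∑ x, K.q s x = 1 - (1 - E.δ) * (K.coop s Game.G + K.coop s Game.B) := by
      have h2 := K.sum_v_mul s fun _ => 1
      simp only [mul_one, Game.sum_eq] at h2
      rw [← h2]
      have h5 : ∑ x, K.q s x = ∑ x, K.w s x - (1 - E.δ) * ∑ x, K.v s x := by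
        rw [Finset.mul_sum, ← Finset.sum_sub_distrib]
        exact Finset.sum_congr rfl fun x _ => by rw [← K.v_add_h]; simp only [q]; ring
      rw [h5, K.sum_w]
    have h3 := K.sum_v_benefit s
    rw [Game.sum_eq] at h3
    have h4 : ∑ x, K.q s x * (E.δ * E.flow Game.B - (1 - E.δ) * û (K.nx s x))
        = (∑ x, K.q s x) * (E.δ * E.flow Game.B)
          - (1 - E.δ) * ∑ x, K.q s x * û (K.nx s x) := by
      rw [Finset.sum_mul, Finset.mul_sum, ← Finset.sum_sub_distrib]
      exact Finset.sum_congr rfl fun x _ => by ring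
    rw [h4, h1, hû s, h3]
    ring
  have hpos : ∀ s, 0 ≤ (1 - E.δ) * (E.δ * (K.coop s Game.G * (E.flow Game.B - E.flow Game.G))) :=
    fun s => mul_nonneg (by linarith) (mul_nonneg E.δ_pos.le
      (mul_nonneg (K.coop_nonneg _ _) (by linarith)))
  have hge := (K.q_transient h₀).nonneg_of_superharmonic
    (y := fun s => E.δ * E.flow Game.B - (1 - E.δ) * û s)
    (fun s => by linarith [hsup s, hpos s])
  refine lt_of_le_of_ne (by linarith [hge s]) fun he => ?_
  have hzero : ∀ t, E.δ * E.flow Game.B - (1 - E.δ) * û t = 0 := fun t =>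
    MoveChain.eq_of_leads_of_superharmonic
      (y := fun s => E.δ * E.flow Game.B - (1 - E.δ) * û s) (v := 0) K.q_nonneg
      (K.q_transient h₀).sum_le_one (fun s => by linarith [hsup s, hpos s]) le_rfl hge
      (by rw [he, sub_self]) (K.leads_q s t)
  have h1 := hsup s₀
  simp only [hzero, mul_zero, Finset.sum_const_zero, zero_add] at h1
  have h2 : 0 < (1 - E.δ) * (E.δ * (K.coop s₀ Game.G * (E.flow Game.B - E.flow Game.G))) :=
    mul_pos (by linarith) (mul_pos E.δ_pos (mul_pos h₀ (by linarith)))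
  linarith

end CoopChain

end Env

/-! ### Spending surplus incentives on additional good tasks -/

namespace Env

namespace CoopChain

variable {E : Env} {X : Type} [Fintype X] (K : E.CoopChain X)

/-- The expected cost of the periods with cooperation after `s`. -/
noncomputable def cost (ρ : ℝ) (s : X) : ℝ := ∑ t, K.coop s t * taskCost ρ t

theorem sum_μ_cost (ρ : ℝ) :
    ∑ s, K.μ s * K.cost ρ s = K.share Game.B - ρ * K.share Game.G := by
  simp only [cost, Game.sum_eq, taskCost, share, Finset.mul_sum, ← Finset.sum_sub_distrib]
  exact Finset.sum_congr rfl fun s _ => by ring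

/-- A potential for the cost of the periods with cooperation that vanishes at `z`; `φ₀ z` is the
expected cost until the return to `z`. -/
theorem exists_potential (ρ : ℝ) (z : X) : ∃ φ φ₀ : X → ℝ, φ z = 0 ∧ (∀ s, s ≠ z → φ s = φ₀ s) ∧
    (∀ s, φ₀ s = K.cost ρ s + ∑ x, K.w s x * φ (K.nx s x)) ∧
    K.μ z * φ₀ z = K.share Game.B - ρ * K.share Game.G := by
  classical
  -- Since `z` has positive mass, some state moves to `z`; hence the chain stopped on entering `z`
  -- is transient and its expected cost is finite.
  obtain ⟨p, hp⟩ : ∃ p, 0 < ∑ x, if K.nx p x = z then K.w p x else 0 := by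
    by_contra hne
    push Not at hne
    have h0 : ∀ p x, K.nx p x = z → K.w p x = 0 := fun p x hx => by
      have h1 := (Finset.sum_eq_zero_iff_of_nonneg fun x _ => by
        split_ifs
        · exact K.w_nonneg p x
        · exact le_rfl).1 (le_antisymm (hne p) (Finset.sum_nonneg fun x _ => by
          split_ifs
          · exact K.w_nonneg p x
          · exact le_rfl)) x (Finset.mem_univ x)
      simpa [hx] using h1
    have h1 := K.stationary fun s => if s = z then 1 else 0
    simp only [mul_ite, mul_one, mul_zero, Finset.sum_ite_eq', Finset.mem_univ, if_true] at h1
    have h2 := K.μ_pos z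
    rw [h1, Finset.sum_eq_zero] at h2
    · exact lt_irrefl _ h2
    · intro s _
      rw [Finset.sum_eq_zero, mul_zero]
      intro x _
      split_ifs with hx
      · exact h0 s x hx
      · rfl
  have hT : MoveChain.Transient (fun s x => if K.nx s x = z then 0 else K.w s x) K.nx := by
    have hsplit : ∀ s x, (if K.nx s x = z then K.w s x else 0)
        + (if K.nx s x = z then 0 else K.w s x) = K.w s x := fun s x => by split_ifs <;> simp
    refine MoveChain.transient_of_split (vw := fun s x => if K.nx s x = z then K.w s x else 0)
      (t := p) (fun s x => ?_) (fun s x => ?_) (fun s => ?_) hp fun s => ?_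
    · split_ifs
      · exact K.w_nonneg s x
      · exact le_rfl
    · split_ifs
      · exact le_rfl
      · exact K.w_nonneg s x
    · simp only [hsplit]
      exact K.sum_w s
    · simp only [hsplit]
      exact K.irreducible s p
  obtain ⟨φ₀, hφ₀⟩ := hT.exists_solution (K.cost ρ)
  have hφ : ∀ s, φ₀ s = K.cost ρ s
      + ∑ x, K.w s x * (if K.nx s x = z then 0 else φ₀ (K.nx s x)) := fun s => by
    rw [hφ₀ s]
    congr 1
    refine Finset.sum_congr rfl fun x _ => ?_
    split_ifs <;> simp
  refine ⟨fun s => if s = z then 0 else φ₀ s, φ₀, by simp, fun s hs => by simp [hs], hφ, ?_⟩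
  -- Kac's formula: integrate the equation for `φ₀` against `μ`. The potential and `φ₀` differ at
  -- `z` only, which leaves the term `μ z * φ₀ z`.
  have h1 := K.stationary fun s => if s = z then 0 else φ₀ s
  have h2 : ∑ s, K.μ s * φ₀ s = ∑ s, K.μ s * (if s = z then 0 else φ₀ s) + K.μ z * φ₀ z := by
    have : K.μ z * φ₀ z = ∑ s, if s = z then K.μ s * φ₀ s else 0 := by simp
    rw [this, ← Finset.sum_add_distrib]
    refine Finset.sum_congr rfl fun s _ => ?_
    split_ifs <;> simp
  have h3 : ∑ s, K.μ s * φ₀ s = ∑ s, K.μ s * K.cost ρ s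
      + ∑ s, K.μ s * ∑ x, K.w s x * (if K.nx s x = z then 0 else φ₀ (K.nx s x)) := by
    rw [← Finset.sum_add_distrib]
    exact Finset.sum_congr rfl fun s _ => by rw [← mul_add, ← hφ]
  rw [← K.sum_μ_cost]
  simp only [w] at h3
  linarith

open Classical in
/-- The periods with cooperation of a chain, with additional periods on the good task: they are
inserted in state `z` with probability `η`. -/
noncomputable def toScheme (z : X) {η : ℝ} (h0 : 0 ≤ η) (h1 : η < 1) {s₀ : X} {t₀ : WorkTask}
    (h₀ : 0 < K.coop s₀ t₀) : E.Scheme X (Obs × Bool) where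
  -- The Boolean of a move marks the inserted good periods; they exist at `z` only and return to
  -- `z`.
  vw s a := if a.2 then (if s = z then η else 0) * ((if a.1.1 = Game.G then 1 else 0) *
    E.gameProb a.1.1 a.1.2) else (1 - if s = z then η else 0) * K.v s a.1
  sw s a := if a.2 then 0 else (1 - if s = z then η else 0) * K.h s a.1
  nx s a := if a.2 then z else K.nx s a.1
  ob a := a.1
  task s t := (1 - if s = z then η else 0) * K.coop s t
    + (if s = z then η else 0) * (if t = Game.G then 1 else 0)
  vw_nonneg s a := by
    have := K.v_nonneg s a.1
    have := E.gameProb_nonneg a.1.1 a.1.2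
    have : 0 ≤ 1 - η := by linarith
    split_ifs <;> simp <;> positivity
  task_nonneg s t := by
    have := K.coop_nonneg s t
    have : 0 ≤ 1 - η := by linarith
    split_ifs <;> simp <;> positivity
  weight_sum s := by
    have h2 : ∑ x, K.h s x = 1 - ∑ t, K.coop s t := by
      have h3 := K.sum_v_mul s fun _ => 1
      simp only [mul_one] at h3
      rw [← h3, ← K.sum_w s, ← Finset.sum_sub_distrib]
      exact Finset.sum_congr rfl fun x _ => by rw [← K.v_add_h]; ring
    simp only [Fintype.sum_prod_type, Fintype.sum_bool, if_true, zero_add, Bool.false_eq_true,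
      if_false, Finset.sum_add_distrib, ← Finset.mul_sum]
    rw [← Fintype.sum_prod_type, h2]
    simp only [Finset.sum_ite_eq', Finset.mem_univ, if_true]
    ring
  vw_eq s x := by
    rw [Fintype.sum_prod_type]
    simp only [Fintype.sum_bool, if_true, Bool.false_eq_true, if_false]
    rw [Finset.sum_add_distrib, Finset.sum_ite_eq', Finset.sum_ite_eq']
    simp only [Finset.mem_univ, if_true, v]
    ring
  transient := by
    have hη : ∀ s, 0 ≤ (if s = z then η else 0) ∧ 0 < 1 - (if s = z then η else 0) := fun s => by
      split_ifs
      · exact ⟨h0, by linarith⟩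
      · norm_num
    refine MoveChain.transient_of_split (t := s₀)
      (vw := fun s a => if a.2 then (if s = z then η else 0) * ((if a.1.1 = Game.G then 1 else 0) *
        E.gameProb a.1.1 a.1.2) else (1 - if s = z then η else 0) * K.v s a.1)
      (fun s a => ?_) (fun s a => ?_) (fun s => ?_) ?_ fun s => ?_
    · obtain ⟨x, b⟩ := a
      cases b with
      | true =>
        exact mul_nonneg (hη s).1 (mul_nonneg (by split_ifs <;> norm_num) (E.gameProb_nonneg _ _))
      | false => exact mul_nonneg (hη s).2.le (K.v_nonneg _ _)
    · obtain ⟨x, b⟩ := a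
      cases b with
      | true => exact le_rfl
      | false => exact mul_nonneg (hη s).2.le (K.h_nonneg _ _)
    · rw [Fintype.sum_prod_type]
      simp only [Fintype.sum_bool, if_true, Bool.false_eq_true, if_false, add_zero, ← mul_add,
        K.v_add_h]
      rw [Finset.sum_add_distrib, ← Finset.mul_sum, ← Finset.mul_sum, K.sum_w]
      have h2 := E.sum_task_gameProb_const (fun t => if t = Game.G then (1 : ℝ) else 0) fun _ => 1
      simp only [mul_one, Finset.sum_ite_eq', Finset.mem_univ, if_true] at h2
      rw [h2]
      ring
    · rw [Fintype.sum_prod_type]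
      simp only [Fintype.sum_bool, if_true, Bool.false_eq_true, if_false]
      rw [Finset.sum_add_distrib, ← Finset.mul_sum, ← Finset.mul_sum]
      refine add_pos_of_nonneg_of_pos (mul_nonneg (hη s₀).1 (Finset.sum_nonneg fun x _ =>
        mul_nonneg (by split_ifs <;> norm_num) (E.gameProb_nonneg _ _))) ?_
      exact mul_pos (hη s₀).2 (K.sum_v_pos h₀)
    · refine Relation.ReflTransGen.mono (fun s' t' ⟨x, hx, he⟩ => ⟨(x, false), ?_, by simpa using he⟩)
        s s₀ (K.irreducible s s₀)
      simp only [Bool.false_eq_true, if_false, ← mul_add, K.v_add_h]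
      exact mul_pos (hη s').2 hx

open Classical in
theorem sum_toScheme_vw (z : X) {η : ℝ} (h0 : 0 ≤ η) (h1 : η < 1) {s₀ : X} {t₀ : WorkTask}
    (h₀ : 0 < K.coop s₀ t₀) (F : Obs → X → ℝ) (s : X) :
    ∑ a, (K.toScheme z h0 h1 h₀).vw s a *
        F ((K.toScheme z h0 h1 h₀).ob a) ((K.toScheme z h0 h1 h₀).nx s a)
      = (if s = z then η else 0) *
          ∑ x : Obs, (if x.1 = Game.G then 1 else 0) * E.gameProb x.1 x.2 * F x z
        + (1 - if s = z then η else 0) * ∑ x, K.v s x * F x (K.nx s x) := by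
  simp only [toScheme]
  rw [Fintype.sum_prod_type]
  simp only [Fintype.sum_bool, if_true, Bool.false_eq_true, if_false]
  rw [Finset.sum_add_distrib, Finset.mul_sum, Finset.mul_sum]
  congr 1 <;> exact Finset.sum_congr rfl fun x _ => by ring

open Classical in
theorem sum_toScheme_sw (z : X) {η : ℝ} (h0 : 0 ≤ η) (h1 : η < 1) {s₀ : X} {t₀ : WorkTask}
    (h₀ : 0 < K.coop s₀ t₀) (f : X → ℝ) (s : X) :
    ∑ a, (K.toScheme z h0 h1 h₀).sw s a * f ((K.toScheme z h0 h1 h₀).nx s a)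
      = (1 - if s = z then η else 0) * ∑ x, K.h s x * f (K.nx s x) := by
  simp only [toScheme]
  rw [Fintype.sum_prod_type]
  simp only [Fintype.sum_bool, if_true, Bool.false_eq_true, if_false, zero_mul, zero_add]
  rw [Finset.mul_sum]
  exact Finset.sum_congr rfl fun x _ => by ring

/-- If the cooperation on bad tasks is at most `ρ` times the cooperation on good tasks, and the
inequality is strict, or reshuffling or periods without cooperation waste incentives, then there is
an assignment with complete cooperation and less than `ρ` bad tasks for each good task. -/
theorem exists_assignment (hflow : E.flow Game.G < E.flow Game.B)
    (hd : ∀ g, (1 - E.δ) * E.d g < E.δ * E.flow Game.B) {ρ : ℝ} (hρ : 0 < ρ)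
    (hle : K.share Game.B ≤ ρ * K.share Game.G) (hpos : 0 < K.share Game.G)
    (hbad : K.share Game.B < ρ * K.share Game.G ∨ K.disc < E.δ ∨
      ∃ s t, K.coop s t < K.task s t) :
    ∃ m : Assignment, ∃ ρ₁ < ρ, m.k ≠ 0 ∧
      (∃ V : State m.k → ℝ,
        (∀ s, V s ≤ E.δ * ∑ x, E.obsProb m s x * (E.benefit x.2 + V (s.push x))) ∧
        ∀ s g, s.game = some g → E.d g ≤ V s) ∧
      ∃ W : State m.k → ℝ,
        ∀ s, ∑ x, E.obsProb m s x * (taskCost ρ₁ x.1 + W (s.push x)) ≤ W s := by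
  classical
  have hδ := E.δ_lt_one
  obtain ⟨s₀, h₀⟩ : ∃ s₀, 0 < K.coop s₀ Game.G := by
    by_contra hne
    push Not at hne
    refine hpos.ne' (Finset.sum_eq_zero fun s _ => ?_)
    rw [le_antisymm (hne s) (K.coop_nonneg s _), mul_zero]
  have hX : Nonempty X := ⟨s₀⟩
  have hB0 : 0 ≤ K.share Game.B := Finset.sum_nonneg fun s _ =>
    mul_nonneg (K.μ_pos s).le (K.coop_nonneg _ _)
  -- At `z` players have just cooperated in the good game, so the value there suffices for `d G`.
  -- Inserted good periods lead back to `z` and satisfy the same constraint.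
  set z := K.nx s₀ (Game.G, some Game.G) with hz
  have hqT := K.q_transient h₀
  obtain ⟨û, hû⟩ := hqT.exists_solution fun s => E.δ * ∑ x, K.v s x * E.benefit x.2
  -- `y` is the discounted number of visits to `z`; giving up `ε` at each visit costs `ε * y`.
  obtain ⟨y, hy⟩ := hqT.exists_solution fun s => if s = z then 1 else 0
  have hû' : K.IsValue û := hû
  have hy0 : ∀ s, 0 ≤ y s := hqT.nonneg_of_superharmonic fun s => by
    have : (0 : ℝ) ≤ if s = z then 1 else 0 := by split_ifs <;> norm_num
    linarith [hy s]
  have hμz := K.μ_pos z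
  have hûz : 0 < û z := (K.u_pos h₀ z).trans_le (hû'.u_le h₀ z)
  -- the parameters of the scheme
  obtain ⟨η, ε, ρ₀, hη0, hη1, hε0, hρ00, hρ0, hinc, hηε, hcost⟩ : ∃ η ε ρ₀ : ℝ, 0 ≤ η ∧ η < 1 ∧
      0 ≤ ε ∧ 0 ≤ ρ₀ ∧ ρ₀ < ρ ∧ (∀ s, K.u s ≤ û s - ε * y s) ∧ η * û z ≤ (1 - η) * ε ∧
      (1 - η) * (K.share Game.B - ρ₀ * K.share Game.G) ≤ η * ρ₀ * K.μ z := by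
    by_cases hstrict : K.share Game.B < ρ * K.share Game.G
    -- The ratio is already below `ρ`, so nothing needs to be inserted.
    · refine ⟨0, 0, K.share Game.B / K.share Game.G, le_rfl, one_pos, le_rfl,
        div_nonneg hB0 hpos.le, (div_lt_iff₀ hpos).2 hstrict, fun s => ?_, by simp, ?_⟩
      · simpa using hû'.u_le h₀ s
      · rw [div_mul_cancel₀ _ hpos.ne']; simp
    · have hlt := hû'.u_lt h₀ (hbad.resolve_left hstrict)
      obtain ⟨s₁, hs₁⟩ := Finite.exists_min fun s => û s - K.u s
      obtain ⟨s₂, hs₂⟩ := Finite.exists_max y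
      have hg : 0 < û s₁ - K.u s₁ := sub_pos.2 (hlt s₁)
      -- The smallest surplus over a bound on `y`, so that `û - ε * y` is still at least `u`
      -- everywhere.
      obtain ⟨ε, hε⟩ : ∃ ε, ε = (û s₁ - K.u s₁) / (y s₂ + 1) := ⟨_, rfl⟩
      have hy2 : 0 < y s₂ + 1 := by linarith [hy0 s₂]
      have hεpos : 0 < ε := by rw [hε]; exact div_pos hg hy2
      have hε2 : ε * (y s₂ + 1) = û s₁ - K.u s₁ := by rw [hε]; exact div_mul_cancel₀ _ hy2.ne'
      -- This solves `η * û z = (1 - η) * ε`: what is given up at each visit to `z` finances the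
      -- insertions.
      obtain ⟨η, hη⟩ : ∃ η, η = ε / (û z + ε) := ⟨_, rfl⟩
      have hsum : 0 < û z + ε := by linarith
      have hη2 : η * (û z + ε) = ε := by rw [hη]; exact div_mul_cancel₀ _ hsum.ne'
      have hηpos : 0 < η := by rw [hη]; exact div_pos hεpos hsum
      have hD : 0 < K.share Game.G + η * K.μ z := by positivity
      -- Only `η` additional good periods per visit to `z` are counted, fewer than the expected `η /
      -- (1 - η)`; this is enough for `ρ₀ < ρ`.
      obtain ⟨ρ₀, hρ₀⟩ : ∃ ρ₀, ρ₀ = ρ * K.share Game.G / (K.share Game.G + η * K.μ z) := ⟨_, rfl⟩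
      have hρ2 : ρ₀ * (K.share Game.G + η * K.μ z) = ρ * K.share Game.G := by
        rw [hρ₀]; exact div_mul_cancel₀ _ hD.ne'
      have hημ : 0 < η * K.μ z := mul_pos hηpos hμz
      have hη1 : η < 1 := by rw [hη, div_lt_one hsum]; linarith
      have hρ₀pos : 0 ≤ ρ₀ := by rw [hρ₀]; positivity
      refine ⟨η, ε, ρ₀, hηpos.le, hη1, hεpos.le, hρ₀pos, ?_, fun s => ?_, by linarith, ?_⟩
      · rw [hρ₀, div_lt_iff₀ hD]
        nlinarith
      · have := mul_le_mul_of_nonneg_left (hs₂ s) hεpos.le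
        have := hs₁ s
        linarith
      · have h5 : K.share Game.B - ρ₀ * K.share Game.G ≤ η * ρ₀ * K.μ z := by linarith
        have h6 : 0 ≤ η * ρ₀ * K.μ z := by positivity
        nlinarith
  obtain ⟨U, hU⟩ : ∃ U : X → ℝ, ∀ s, U s = û s - ε * y s := ⟨_, fun s => rfl⟩
  have hUû : ∀ s, U s ≤ û s := fun s => by
    rw [hU]; linarith [mul_nonneg hε0 (hy0 s)]
  have hUinc : ∀ s t, 0 < K.coop s t → E.d t ≤ U (K.nx s (t, some t)) := fun s t ht => by
    rw [hU]; exact (K.incentive s t ht).trans (hinc _)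
  have hUz : E.d Game.G ≤ U z := hUinc _ _ h₀
  have hUeq : ∀ s, ∑ x, K.v s x * (E.δ * (E.benefit x.2 + U (K.nx s x)))
      + ∑ x, K.h s x * U (K.nx s x) = U s + ε * (if s = z then 1 else 0) := fun s => by
    have h2 : ∑ x, K.v s x * (E.δ * (E.benefit x.2 + U (K.nx s x))) + ∑ x, K.h s x * U (K.nx s x)
        = E.δ * ∑ x, K.v s x * E.benefit x.2 + (∑ x, K.q s x * û (K.nx s x)
          - ε * ∑ x, K.q s x * y (K.nx s x)) := by
      rw [Finset.mul_sum, Finset.mul_sum, ← Finset.sum_sub_distrib, ← Finset.sum_add_distrib,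
        ← Finset.sum_add_distrib]
      exact Finset.sum_congr rfl fun x _ => by rw [hU]; simp only [q]; ring
    rw [h2, hU s]
    have h3 := hû s
    have h4 := hy s
    have h5 : ε * y s = ε * (if s = z then 1 else 0) + ε * ∑ x, K.q s x * y (K.nx s x) := by
      rw [← mul_add, ← h4]
    linarith
  obtain ⟨φ, φ₀, hφz, hφne, hφ₀, hφμ⟩ := K.exists_potential ρ₀ z
  have hφ₀' : ∀ s, ∑ x, K.v s x * (taskCost ρ₀ x.1 + φ (K.nx s x))
      + ∑ x, K.h s x * φ (K.nx s x) = φ₀ s := fun s => by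
    rw [hφ₀ s, cost, ← K.sum_v_mul, ← Finset.sum_add_distrib, ← Finset.sum_add_distrib]
    exact Finset.sum_congr rfl fun x _ => by rw [← K.v_add_h]; ring
  -- Bad tasks forever are worth strictly more than `û` and than each `d g`. The strict margin is
  -- what allows blocks to end with positive probability.
  obtain ⟨ub, hub, hubd, hublt⟩ : ∃ ub, (∀ s, û s ≤ ub) ∧ (∀ g, E.d g ≤ ub) ∧
      ub < E.δ * (E.flow Game.B + ub) := by
    obtain ⟨s₁, hs₁⟩ := Finite.exists_max û
    have : Nonempty Game := ⟨Game.G⟩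
    obtain ⟨g₁, hg₁⟩ := Finite.exists_max E.d
    refine ⟨max (û s₁) (E.d g₁), fun s => (hs₁ s).trans (le_max_left _ _),
      fun g => (hg₁ g).trans (le_max_right _ _), ?_⟩
    have h2 := hû'.lt_bad_value hflow h₀ s₁
    have h3 := hd g₁
    rcases max_choice (û s₁) (E.d g₁) with h4 | h4 <;> rw [h4] <;> linarith
  have hS := (K.toScheme z hη0 hη1 h₀).exists_assignment U φ (ρ := ρ₀) (ρ₁ := (ρ₀ + ρ) / 2)
    (ub := ub) z (fun s => ?_) (fun s => ?_) (fun s a ha g hg => ?_) hUz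
    (fun s => (hUû s).trans (hub s)) hubd hublt hρ00 (by linarith)
  · obtain ⟨m, hm⟩ := hS
    exact ⟨m, (ρ₀ + ρ) / 2, by linarith, hm⟩
  · rw [K.sum_toScheme_vw z hη0 hη1 h₀ (fun x s' => E.δ * (E.benefit x.2 + U s')),
      K.sum_toScheme_sw z hη0 hη1 h₀ U]
    have h2 := E.sum_task_gameProb_benefit (fun t => if t = Game.G then (1 : ℝ) else 0) fun _ => U z
    simp only [ite_mul, one_mul, zero_mul, Finset.sum_ite_eq', Finset.mem_univ, if_true] at h2
    have h3 : ∑ x : Obs, (if x.1 = Game.G then 1 else 0) * E.gameProb x.1 x.2 *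
        (E.δ * (E.benefit x.2 + U z)) = E.δ * (E.flow Game.G + U z) := by
      rw [← h2, Finset.mul_sum]
      refine Finset.sum_congr rfl fun x _ => ?_
      split_ifs <;> ring
    have h4 := hUeq s
    rw [h3]
    by_cases hs : s = z
    · simp only [hs, if_true, mul_one] at h4 ⊢
      have h5 : 0 ≤ η * (E.δ * (E.flow Game.G + U z)) := mul_nonneg hη0 (mul_nonneg E.δ_pos.le
        (by linarith [E.flow_pos Game.G, E.d_pos Game.G]))
      have h6 := mul_le_mul_of_nonneg_left (hUû z) hη0
      rw [add_assoc, ← mul_add, h4]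
      linarith
    · simp only [hs, if_false, mul_zero, add_zero] at h4 ⊢
      linarith
  · rw [K.sum_toScheme_vw z hη0 hη1 h₀ (fun x s' => taskCost ρ₀ x.1 + φ s'),
      K.sum_toScheme_sw z hη0 hη1 h₀ φ]
    have h2 := E.sum_task_gameProb_const (fun t => if t = Game.G then (1 : ℝ) else 0)
      fun t => taskCost ρ₀ t + φ z
    simp only [ite_mul, one_mul, zero_mul, Finset.sum_ite_eq', Finset.mem_univ, if_true] at h2
    have h3 : ∑ x : Obs, (if x.1 = Game.G then 1 else 0) * E.gameProb x.1 x.2 *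
        (taskCost ρ₀ x.1 + φ z) = -ρ₀ := by
      rw [hφz, taskCost, add_zero] at h2
      rw [← h2]
      refine Finset.sum_congr rfl fun x _ => ?_
      split_ifs <;> simp [hφz]
    have h4 := hφ₀' s
    rw [h3]
    by_cases hs : s = z
    · simp only [hs, if_true] at h4 ⊢
      rw [add_assoc, ← mul_add, h4, hφz]
      have h5 : K.μ z * ((1 - η) * φ₀ z + η * -ρ₀) ≤ 0 := by
        have h6 : K.μ z * ((1 - η) * φ₀ z + η * -ρ₀)
            = (1 - η) * (K.μ z * φ₀ z) - η * ρ₀ * K.μ z := by ring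
        rw [h6, hφμ]
        linarith
      have := nonpos_of_mul_nonpos_right h5 hμz
      linarith
    · simp only [hs, if_false] at h4 ⊢
      rw [hφne s hs]
      linarith
  · obtain ⟨⟨t, o⟩, b⟩ := a
    change o = some g at hg
    subst hg
    have hgame : ∀ c : ℝ, 0 < c * E.gameProb t (some g) → g = t := fun c hc => by
      by_contra hne
      simp [gameProb, hne] at hc
    cases b with
    | true =>
      change 0 < (if s = z then η else 0) * ((if t = Game.G then 1 else 0) *
        E.gameProb t (some g)) at ha
      rw [← mul_assoc] at ha
      obtain rfl := hgame _ ha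
      by_cases ht : g = Game.G
      · subst ht; exact hUz
      · simp [ht] at ha
    | false =>
      change 0 < (1 - if s = z then η else 0) * (K.coop s t * E.gameProb t (some g)) at ha
      have hg := ha
      rw [← mul_assoc] at hg
      obtain rfl := hgame _ hg
      refine hUinc s g (lt_of_le_of_ne (K.coop_nonneg s g) fun h0 => ?_)
      simp [← h0] at ha

end CoopChain

end Env

/-! ### The stochastic game -/

namespace Env

variable (E : Env)

theorem sum_profileProb {k : ℕ} (σ : E.StratProfile k) (h : E.Node k) :
    ∑ a, E.profileProb σ h a = 1 := by
  have h1 := Finset.prod_univ_sum (fun _ : Fin E.n => (Finset.univ : Finset Move))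
    fun i x => (σ i h).1 x
  rw [Fintype.piFinset_univ] at h1
  simp only [profileProb]
  rw [← h1]
  exact Finset.prod_eq_one fun i _ => (σ i h).2.2

theorem profileProb_nonneg {k : ℕ} (σ : E.StratProfile k) (h : E.Node k) (a : Profile E.n) :
    0 ≤ E.profileProb σ h a :=
  Finset.prod_nonneg fun i _ => (σ i h).2.1 _

theorem recProb_nonneg {k : ℕ} (σ : E.StratProfile k) (h : E.Node k)
    (a : Option (Profile E.n)) : 0 ≤ E.recProb σ h a := by
  cases a <;> simp only [recProb] <;> split_ifs
  any_goals norm_num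
  exact E.profileProb_nonneg σ h _

theorem stepProb_nonneg (m : Assignment) (σ : E.StratProfile m.k) (h : E.Node m.k) (x : E.Step) :
    0 ≤ E.stepProb m σ h x :=
  mul_nonneg (E.recProb_nonneg σ h _) (E.obsProb_nonneg m _ _)

theorem sum_stepProb_none (m : Assignment) (σ : E.StratProfile m.k) {h : E.Node m.k}
    (hg : E.game h = none) (F : E.Step → ℝ) : ∑ x, E.stepProb m σ h x * F x
      = ∑ y, E.obsProb m (E.curState h.1 h.2) y * F (none, y) := by
  rw [Fintype.sum_prod_type, Fintype.sum_option]
  simp [stepProb, recProb, hg]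

theorem sum_stepProb_some (m : Assignment) (σ : E.StratProfile m.k) {h : E.Node m.k} {g : Game}
    (hg : E.game h = some g) (F : E.Step → ℝ) : ∑ x, E.stepProb m σ h x * F x
      = ∑ a, E.profileProb σ h a *
          ∑ y, E.obsProb m (E.curState h.1 h.2) y * F (some a, y) := by
  rw [Fintype.sum_prod_type, Fintype.sum_option]
  simp [stepProb, recProb, hg, Finset.mul_sum, mul_assoc]

theorem sum_stepProb_obs (m : Assignment) (σ : E.StratProfile m.k) (h : E.Node m.k)
    (F : Obs → ℝ) : ∑ x, E.stepProb m σ h x * F x.2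
      = ∑ y, E.obsProb m (E.curState h.1 h.2) y * F y := by
  cases hg : E.game h with
  | none => exact E.sum_stepProb_none m σ hg _
  | some g =>
    rw [E.sum_stepProb_some m σ hg]
    dsimp only
    rw [← Finset.sum_mul, E.sum_profileProb, one_mul]

theorem sum_stepProb (m : Assignment) (σ : E.StratProfile m.k) (h : E.Node m.k) :
    ∑ x, E.stepProb m σ h x = 1 := by
  have := E.sum_stepProb_obs m σ h fun _ => 1
  simpa [E.sum_obsProb] using this

theorem exists_pay_bound : ∃ C, 0 ≤ C ∧ ∀ g i a, |E.pay g i a| ≤ C := by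
  refine ⟨∑ g, ∑ i, ∑ a, |E.pay g i a|, by positivity, fun g i a => ?_⟩
  calc |E.pay g i a| ≤ ∑ a, |E.pay g i a| :=
        Finset.single_le_sum (f := fun a => |E.pay g i a|) (fun _ _ => abs_nonneg _)
          (Finset.mem_univ a)
    _ ≤ ∑ i, ∑ a, |E.pay g i a| :=
        Finset.single_le_sum (f := fun i => ∑ a, |E.pay g i a|) (fun _ _ => by positivity)
          (Finset.mem_univ i)
    _ ≤ _ := Finset.single_le_sum (f := fun g => ∑ i, ∑ a, |E.pay g i a|)
        (fun _ _ => by positivity) (Finset.mem_univ g)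

theorem abs_sum_mul_le {ι : Type*} [Fintype ι] {p f : ι → ℝ} {C : ℝ} (hp : ∀ x, 0 ≤ p x)
    (h1 : ∑ x, p x = 1) (hf : ∀ x, |f x| ≤ C) : |∑ x, p x * f x| ≤ C := by
  calc |∑ x, p x * f x| ≤ ∑ x, |p x * f x| := Finset.abs_sum_le_sum_abs _ _
    _ ≤ ∑ x, p x * C := Finset.sum_le_sum fun x _ => by
        rw [abs_mul, abs_of_nonneg (hp x)]
        exact mul_le_mul_of_nonneg_left (hf x) (hp x)
    _ = C := by rw [← Finset.sum_mul, h1, one_mul]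

theorem exists_later_bound (m : Assignment) (σ : E.StratProfile m.k) (i : Fin E.n) :
    ∃ C, ∀ τ h, |E.laterPay m σ i τ h| ≤ C := by
  obtain ⟨C, hC, hpay⟩ := E.exists_pay_bound
  refine ⟨C, fun τ => ?_⟩
  induction τ with
  | zero =>
    intro h
    simp only [laterPay, stagePay]
    cases hg : E.game h with
    | none => simpa using hC
    | some g =>
      exact abs_sum_mul_le (E.profileProb_nonneg σ h) (E.sum_profileProb σ h) fun a => hpay g i a
  | succ τ ih =>
    intro h
    exact abs_sum_mul_le (E.stepProb_nonneg m σ h) (E.sum_stepProb m σ h) fun x => ih _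

/-! ### Bellman equation and comparison of discounted payoffs -/

section Discounting

variable {E} {m : Assignment} {r : ℝ}

theorem discount_nonneg (hr : r ∈ Set.Icc (0 : ℝ) 1) : 0 ≤ (1 - r) * E.δ :=
  mul_nonneg (sub_nonneg.2 hr.2) E.δ_pos.le

theorem discount_le (hr : r ∈ Set.Icc (0 : ℝ) 1) : (1 - r) * E.δ ≤ E.δ :=
  mul_le_of_le_one_left E.δ_pos.le (by linarith [hr.1])

theorem discount_lt_one (hr : r ∈ Set.Icc (0 : ℝ) 1) : (1 - r) * E.δ < 1 :=
  (discount_le hr).trans_lt E.δ_lt_one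

theorem summable_util (hr : r ∈ Set.Icc (0 : ℝ) 1) (σ : E.StratProfile m.k) (i : Fin E.n)
    (h : E.Node m.k) : Summable fun τ => ((1 - r) * E.δ) ^ τ * E.laterPay m σ i τ h := by
  obtain ⟨C, hC⟩ := E.exists_later_bound m σ i
  refine Summable.of_norm_bounded (g := fun τ => ((1 - r) * E.δ) ^ τ * C)
    ((summable_geometric_of_lt_one (discount_nonneg hr) (discount_lt_one hr)).mul_right C)
    fun τ => ?_
  rw [Real.norm_eq_abs, abs_mul, abs_of_nonneg (pow_nonneg (discount_nonneg hr) τ)]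
  exact mul_le_mul_of_nonneg_left (hC τ h) (pow_nonneg (discount_nonneg hr) τ)

theorem util_eq (hr : r ∈ Set.Icc (0 : ℝ) 1) (σ : E.StratProfile m.k) (i : Fin E.n)
    (h : E.Node m.k) : E.util m r σ i h = E.stagePay σ i h
      + (1 - r) * E.δ * ∑ x, E.stepProb m σ h x * E.util m r σ i (E.extend h x) := by
  rw [util, (summable_util hr σ i h).tsum_eq_zero_add]
  congr 1
  · simp [laterPay]
  · simp only [util]
    have h1 : ∀ x, E.stepProb m σ h x *
        ∑' τ, ((1 - r) * E.δ) ^ τ * E.laterPay m σ i τ (E.extend h x)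
        = ∑' τ, E.stepProb m σ h x *
          (((1 - r) * E.δ) ^ τ * E.laterPay m σ i τ (E.extend h x)) := fun x => tsum_mul_left.symm
    simp only [h1]
    rw [← Summable.tsum_finsetSum fun x _ => (summable_util hr σ i _).mul_left _, ← tsum_mul_left]
    refine tsum_congr fun τ => ?_
    simp only [laterPay, Finset.mul_sum]
    exact Finset.sum_congr rfl fun x _ => by ring

theorem exists_util_bound (hr : r ∈ Set.Icc (0 : ℝ) 1) (σ : E.StratProfile m.k) (i : Fin E.n) :
    ∃ C, ∀ h, |E.util m r σ i h| ≤ C := by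
  obtain ⟨C, hC⟩ := E.exists_later_bound m σ i
  refine ⟨∑' τ, ((1 - r) * E.δ) ^ τ * C, fun h => ?_⟩
  rw [← Real.norm_eq_abs]
  refine tsum_of_norm_bounded
    ((summable_geometric_of_lt_one (discount_nonneg hr) (discount_lt_one hr)).mul_right C).hasSum
    fun τ => ?_
  rw [Real.norm_eq_abs, abs_mul, abs_of_nonneg (pow_nonneg (discount_nonneg hr) τ)]
  exact mul_le_mul_of_nonneg_left (hC τ h) (pow_nonneg (discount_nonneg hr) τ)

/-- A function on the nodes that is bounded above, and at most its discounted expectation in the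
next period, is not positive. -/
theorem nonpos_of_le_discounted (hr : r ∈ Set.Icc (0 : ℝ) 1) (σ : E.StratProfile m.k)
    (S : Set (E.Node m.k)) (hS : ∀ h ∈ S, ∀ x, 0 < E.stepProb m σ h x → E.extend h x ∈ S)
    {Z : E.Node m.k → ℝ} {C : ℝ} (hC : ∀ h ∈ S, Z h ≤ C)
    (hZ : ∀ h ∈ S, Z h ≤ (1 - r) * E.δ * ∑ x, E.stepProb m σ h x * Z (E.extend h x))
    {h : E.Node m.k} (hh : h ∈ S) : Z h ≤ 0 := by
  have key : ∀ N : ℕ, ∀ h ∈ S, Z h ≤ ((1 - r) * E.δ) ^ N * C := by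
    intro N
    induction N with
    | zero => simpa using hC
    | succ N ih =>
      intro h hh
      refine (hZ h hh).trans ?_
      have h1 : ∑ x, E.stepProb m σ h x * Z (E.extend h x)
          ≤ ∑ x, E.stepProb m σ h x * (((1 - r) * E.δ) ^ N * C) := by
        refine Finset.sum_le_sum fun x _ => ?_
        rcases (E.stepProb_nonneg m σ h x).lt_or_eq with h2 | h2
        · exact mul_le_mul_of_nonneg_left (ih _ (hS h hh x h2)) h2.le
        · rw [← h2, zero_mul, zero_mul]
      rw [← Finset.sum_mul, E.sum_stepProb, one_mul] at h1
      calc _ ≤ (1 - r) * E.δ * (((1 - r) * E.δ) ^ N * C) :=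
            mul_le_mul_of_nonneg_left h1 (discount_nonneg hr)
        _ = _ := by ring
  have hlim : Filter.Tendsto (fun N : ℕ => ((1 - r) * E.δ) ^ N * C) Filter.atTop
      (nhds (0 * C)) :=
    (tendsto_pow_atTop_nhds_zero_of_lt_one (discount_nonneg hr) (discount_lt_one hr)).mul_const C
  rw [zero_mul] at hlim
  exact ge_of_tendsto' hlim fun N => key N h hh

end Discounting

/-! ### Pure profiles and unilateral deviations -/

theorem simplex_eq_zero_of_ne {p : stdSimplex ℝ Move} {x y : Move} (h : p.1 x = 1) (hxy : y ≠ x) :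
    p.1 y = 0 := by
  have h1 := p.2.2
  rw [Move.sum_eq] at h1
  cases x <;> cases y <;> first | exact absurd rfl hxy | linarith

/-- All players but `i` are pure, so only the profiles that agree with `b` off `i` have positive
probability. -/
theorem sum_profileProb_deviation {k : ℕ} {σ : E.StratProfile k} {h : E.Node k} {i : Fin E.n}
    {b : Profile E.n} (hb : ∀ j, j ≠ i → (σ j h).1 (b j) = 1) (F : Profile E.n → ℝ) :
    ∑ a, E.profileProb σ h a * F a = ∑ x, (σ i h).1 x * F (Function.update b i x) := by
  symm
  refine Fintype.sum_of_injective (fun x => Function.update b i x)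
    (fun x y hxy => by simpa using congrFun hxy i) _ _ (fun a ha => ?_) fun x => ?_
  · obtain ⟨j, hj, hne⟩ : ∃ j, j ≠ i ∧ a j ≠ b j := by
      by_contra hcon
      push Not at hcon
      refine ha ⟨a i, funext fun j => ?_⟩
      by_cases hj : j = i
      · subst hj; simp
      · simp [hj, hcon j hj]
    have : E.profileProb σ h a = 0 :=
      Finset.prod_eq_zero (Finset.mem_univ j) (simplex_eq_zero_of_ne (hb j hj) hne)
    rw [this, zero_mul]
  · congr 1
    have h1 : ∀ j, (σ j h).1 (Function.update b i x j) = if j = i then (σ i h).1 x else 1 :=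
      fun j => by
        by_cases hj : j = i
        · subst hj; simp
        · simp [hj, hb j hj]
    simp only [profileProb, h1]
    simp

theorem sum_profileProb_pure {k : ℕ} {σ : E.StratProfile k} {h : E.Node k} {b : Profile E.n}
    (hb : ∀ j, (σ j h).1 (b j) = 1) (F : Profile E.n → ℝ) :
    ∑ a, E.profileProb σ h a * F a = F b := by
  rw [E.sum_profileProb_deviation (i := E.player) (fun j _ => hb j) F,
    Finset.sum_eq_single (b E.player)]
  · rw [hb, one_mul, Function.update_eq_self]
  · intro y _ hy
    rw [simplex_eq_zero_of_ne (hb E.player) hy, zero_mul]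
  · intro hn
    exact absurd (Finset.mem_univ _) hn

end Env

/-! ### Cooperation supported by trigger strategies -/

namespace Env

variable (E : Env)

/-- A player's payoff in a period without cooperation. -/
noncomputable def floorPay : Option Game → ℝ
  | none => 0
  | some g => E.pay g E.player (allPlay E.n Move.N)

open Classical in
/-- The cooperation benefit in a state, if the players cooperate in the states in `S`. -/
noncomputable def benefitIn {k : ℕ} (S : Set (State k)) (s : State k) : ℝ :=
  if s ∈ S then E.benefit s.game else 0

/-- Discounting makes the moves of an assignment transient. -/
theorem transient_discount {E : Env} (m : Assignment) {r : ℝ} (hr : r ∈ Set.Icc (0 : ℝ) 1) :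
    MoveChain.Transient (fun (s : State m.k) x => (1 - r) * E.δ * E.obsProb m s x) State.push :=
  MoveChain.transient_of_lt_one _
    (fun s x => mul_nonneg (discount_nonneg hr) (E.obsProb_nonneg m s x)) fun s => by
      rw [← Finset.mul_sum, E.sum_obsProb, mul_one]
      exact discount_lt_one hr

/-- `w` is the value of future cooperation in the states in `S`. -/
def IsWorth (m : Assignment) (r : ℝ) (S : Set (State m.k)) (w : State m.k → ℝ) : Prop :=
  ∀ s, w s = (1 - r) * E.δ * ∑ x, E.obsProb m s x * (E.benefitIn S (s.push x) + w (s.push x))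

/-- `b` is a player's expected payoff if the players never cooperate. -/
def IsFloor (m : Assignment) (r : ℝ) (b : State m.k → ℝ) : Prop :=
  ∀ s, b s = E.floorPay s.game + (1 - r) * E.δ * ∑ x, E.obsProb m s x * b (s.push x)

/-- Cooperation in the states in `S` provides sufficient incentives for itself. -/
def SelfSustaining (m : Assignment) (r : ℝ) (S : Set (State m.k)) : Prop :=
  ∃ w, E.IsWorth m r S w ∧ ∀ s ∈ S, ∀ g, s.game = some g → E.d g ≤ w s

/-- The largest set of states in which cooperation provides sufficient incentives for itself. -/
def coopSet (m : Assignment) (r : ℝ) : Set (State m.k) :=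
  {s | ∃ S, E.SelfSustaining m r S ∧ s ∈ S}

section Values

variable {E} {m : Assignment} {r : ℝ}

theorem exists_isWorth (hr : r ∈ Set.Icc (0 : ℝ) 1) (S : Set (State m.k)) :
    ∃ w, E.IsWorth m r S w := by
  obtain ⟨w, hw⟩ := (transient_discount (E := E) m hr).exists_solution fun s =>
    (1 - r) * E.δ * ∑ x, E.obsProb m s x * E.benefitIn S (s.push x)
  refine ⟨w, fun s => (hw s).trans ?_⟩
  simp only [Finset.mul_sum, mul_add, Finset.sum_add_distrib, mul_assoc]

theorem exists_isFloor (hr : r ∈ Set.Icc (0 : ℝ) 1) : ∃ b, E.IsFloor m r b := by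
  obtain ⟨w, hw⟩ := (transient_discount (E := E) m hr).exists_solution fun s => E.floorPay s.game
  refine ⟨w, fun s => (hw s).trans ?_⟩
  simp only [Finset.mul_sum, mul_assoc]

theorem benefitIn_nonneg {k : ℕ} (S : Set (State k)) (s : State k) : 0 ≤ E.benefitIn S s := by
  unfold benefitIn
  split_ifs
  · exact E.benefit_nonneg _
  · exact le_rfl

theorem benefitIn_mono {k : ℕ} {S S' : Set (State k)} (h : S ⊆ S') (s : State k) :
    E.benefitIn S s ≤ E.benefitIn S' s := by
  by_cases hs : s ∈ S
  · simp [benefitIn, hs, h hs]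
  · have : E.benefitIn S s = 0 := by simp [benefitIn, hs]
    rw [this]
    exact benefitIn_nonneg S' s

theorem IsWorth.le_of_super (hr : r ∈ Set.Icc (0 : ℝ) 1) {S : Set (State m.k)}
    {w w' : State m.k → ℝ} (hw : E.IsWorth m r S w)
    (hw' : ∀ s, (1 - r) * E.δ * ∑ x, E.obsProb m s x *
      (E.benefitIn S (s.push x) + w' (s.push x)) ≤ w' s) (s : State m.k) : w s ≤ w' s := by
  refine (transient_discount (E := E) m hr).le_of_sub_super
    (f := fun s => (1 - r) * E.δ * ∑ x, E.obsProb m s x * E.benefitIn S (s.push x))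
    (fun s => ?_) (fun s => ?_) s
  · refine le_of_eq ((hw s).trans ?_)
    simp only [Finset.mul_sum, mul_add, Finset.sum_add_distrib, mul_assoc]
  · refine le_trans (le_of_eq ?_) (hw' s)
    simp only [Finset.mul_sum, mul_add, Finset.sum_add_distrib, mul_assoc]

theorem IsWorth.ge_of_sub (hr : r ∈ Set.Icc (0 : ℝ) 1) {S : Set (State m.k)}
    {w w' : State m.k → ℝ} (hw : E.IsWorth m r S w)
    (hw' : ∀ s, w' s ≤ (1 - r) * E.δ * ∑ x, E.obsProb m s x *
      (E.benefitIn S (s.push x) + w' (s.push x))) (s : State m.k) : w' s ≤ w s := by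
  refine (transient_discount (E := E) m hr).le_of_sub_super
    (f := fun s => (1 - r) * E.δ * ∑ x, E.obsProb m s x * E.benefitIn S (s.push x))
    (fun s => ?_) (fun s => ?_) s
  · refine (hw' s).trans (le_of_eq ?_)
    simp only [Finset.mul_sum, mul_add, Finset.sum_add_distrib, mul_assoc]
  · refine le_of_eq (Eq.trans ?_ (hw s).symm)
    simp only [Finset.mul_sum, mul_add, Finset.sum_add_distrib, mul_assoc]

theorem IsWorth.mono (hr : r ∈ Set.Icc (0 : ℝ) 1) {S S' : Set (State m.k)}
    {w w' : State m.k → ℝ} (hw : E.IsWorth m r S w) (hw' : E.IsWorth m r S' w') (hS : S ⊆ S')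
    (s : State m.k) : w s ≤ w' s :=
  hw.le_of_super hr (fun s => by
    rw [hw' s]
    refine mul_le_mul_of_nonneg_left (Finset.sum_le_sum fun x _ => ?_) (discount_nonneg hr)
    exact mul_le_mul_of_nonneg_left (by linarith [benefitIn_mono (E := E) hS (s.push x)])
      (E.obsProb_nonneg m s x)) s

theorem subset_coopSet {S : Set (State m.k)} (hS : E.SelfSustaining m r S) :
    S ⊆ E.coopSet m r := fun _ hs => ⟨S, hS, hs⟩

/-- The union of self-sustaining sets is self-sustaining, because enlarging the set only raises the
value of future cooperation. -/
theorem IsWorth.d_le (hr : r ∈ Set.Icc (0 : ℝ) 1) {w : State m.k → ℝ}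
    (hw : E.IsWorth m r (E.coopSet m r) w) {s : State m.k} (hs : s ∈ E.coopSet m r) {g : Game}
    (hg : s.game = some g) : E.d g ≤ w s := by
  obtain ⟨S, hS, hsS⟩ := hs
  have hsub := subset_coopSet hS
  obtain ⟨w', hw', hinc⟩ := hS
  exact (hinc s hsS g hg).trans (hw'.mono hr hw hsub s)

end Values

/-- A node at which no player has deviated from cooperation in a state in `S`. -/
def Clean {k : ℕ} (S : Set (State k)) (s : State k) : List E.Step → Prop
  | [] => True
  -- Only failures in states of `S` are recorded, so actions in other states have no effect on later
  -- play.
  | x :: l => Clean S s l ∧ (E.curState s l ∈ S → ∀ a, x.1 = some a → a = allPlay E.n Move.C)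

open Classical in
/-- The action that trigger strategies for the set `S` prescribe to all players. -/
noncomputable def triggerMove {k : ℕ} (S : Set (State k)) (h : E.Node k) : Move :=
  if E.Clean S h.1 h.2 ∧ E.curState h.1 h.2 ∈ S then Move.C else Move.N

/-- The players cooperate in the states in `S`, until a player fails to do so. -/
noncomputable def trigger {k : ℕ} (S : Set (State k)) : E.StratProfile k :=
  fun _ h => ⟨Pi.single (E.triggerMove S h) 1, single_mem_stdSimplex ℝ _⟩

theorem trigger_apply {k : ℕ} (S : Set (State k)) (h : E.Node k) (i : Fin E.n) :
    (E.trigger S i h).1 (allPlay E.n (E.triggerMove S h) i) = 1 := by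
  simp [trigger, allPlay]

open Classical in
/-- A player's expected payoff at a node if the players use trigger strategies. -/
noncomputable def triggerValue {k : ℕ} (S : Set (State k)) (b w : State k → ℝ) (h : E.Node k) : ℝ :=
  b (E.curState h.1 h.2) + if E.Clean S h.1 h.2 then
    E.benefitIn S (E.curState h.1 h.2) + w (E.curState h.1 h.2) else 0

section Trigger

variable {E} {m : Assignment} {r : ℝ} {S : Set (State m.k)} {b w : State m.k → ℝ}

theorem pay_allPlay (g : Game) (i : Fin E.n) (x : Move) :
    E.pay g i (allPlay E.n x) = E.floorPay (some g) + if x = Move.C then E.c g else 0 := by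
  rw [E.player_update_self]
  cases x <;> simp [floorPay, c]

open Classical in
theorem sum_triggerValue (hb : E.IsFloor m r b) (hw : E.IsWorth m r S w) (h : E.Node m.k)
    (a : Option (Profile E.n)) :
    (1 - r) * E.δ * ∑ y, E.obsProb m (E.curState h.1 h.2) y *
        E.triggerValue S b w (E.extend h (a, y))
      = b (E.curState h.1 h.2) - E.floorPay (E.game h) +
        if E.Clean S h.1 h.2 ∧
            (E.curState h.1 h.2 ∈ S → ∀ a', a = some a' → a' = allPlay E.n Move.C)
          then w (E.curState h.1 h.2) else 0 := by
  have h1 := hb (E.curState h.1 h.2)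
  have h2 := hw (E.curState h.1 h.2)
  have h3 : ∀ y, E.triggerValue S b w (E.extend h (a, y))
      = b ((E.curState h.1 h.2).push y) + if E.Clean S h.1 h.2 ∧
            (E.curState h.1 h.2 ∈ S → ∀ a', a = some a' → a' = allPlay E.n Move.C)
          then E.benefitIn S ((E.curState h.1 h.2).push y) + w ((E.curState h.1 h.2).push y)
          else 0 := fun y => by simp only [triggerValue, extend, curState, Clean]
  simp only [h3, mul_add, Finset.sum_add_distrib]
  simp only [game]
  split_ifs
  · simp only [mul_add, Finset.sum_add_distrib] at h2 ⊢
    linarith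
  · simp only [mul_zero, Finset.sum_const_zero]
    linarith

/-- No player gains by a deviation in a single period from the trigger strategies. -/
theorem deviation_le (hb : E.IsFloor m r b) (hw : E.IsWorth m r S w)
    (hinc : ∀ s ∈ S, ∀ g, s.game = some g → E.d g ≤ w s) (h : E.Node m.k) {g : Game}
    (hg : E.game h = some g) (i : Fin E.n) (x : Move) :
    E.pay g i (Function.update (allPlay E.n (E.triggerMove S h)) i x)
      + (1 - r) * E.δ * ∑ y, E.obsProb m (E.curState h.1 h.2) y * E.triggerValue S b w
        (E.extend h (some (Function.update (allPlay E.n (E.triggerMove S h)) i x), y))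
      ≤ E.triggerValue S b w h ∧ (x = E.triggerMove S h →
    E.pay g i (Function.update (allPlay E.n (E.triggerMove S h)) i x)
      + (1 - r) * E.δ * ∑ y, E.obsProb m (E.curState h.1 h.2) y * E.triggerValue S b w
        (E.extend h (some (Function.update (allPlay E.n (E.triggerMove S h)) i x), y))
      = E.triggerValue S b w h) := by
  classical
  have hself : ∀ z : Move, Function.update (allPlay E.n z) i z = allPlay E.n z := fun z =>
    Function.update_eq_self i (allPlay E.n z)
  have hCN : Function.update (allPlay E.n Move.C) i Move.N ≠ allPlay E.n Move.C := fun he => by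
    have := congrFun he i
    simp [allPlay] at this
  rw [sum_triggerValue hb hw, hg]
  have hg' : (E.curState h.1 h.2).game = some g := hg
  -- When cooperation is prescribed, a deviation gains `d g` and forfeits the worth `w`. Otherwise
  -- actions leave the continuation unchanged, and N is dominant in the current game.
  by_cases hclean : E.Clean S h.1 h.2 ∧ E.curState h.1 h.2 ∈ S
  · have htm : E.triggerMove S h = Move.C := by simp only [triggerMove, if_pos hclean]
    have hv : E.triggerValue S b w h = b (E.curState h.1 h.2)
        + (E.c g + w (E.curState h.1 h.2)) := by
      simp only [triggerValue, if_pos hclean.1, benefitIn, if_pos hclean.2, hg', benefit]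
    rw [htm, hv]
    cases x with
    | C =>
      rw [hself, pay_allPlay, if_pos rfl, if_pos]
      · exact ⟨by linarith, fun _ => by ring⟩
      · exact ⟨hclean.1, fun _ a ha => (Option.some.inj ha).symm⟩
    | N =>
      refine ⟨?_, fun he => by cases he⟩
      rw [if_neg (fun hcon => hCN (hcon.2 hclean.2 _ rfl))]
      have h1 : E.pay g i (Function.update (allPlay E.n Move.C) i Move.N)
          = E.floorPay (some g) + E.c g + E.d g := by
        rw [E.pay_update_allPlay]
        simp [floorPay, c, d]
      have := hinc _ hclean.2 g hg'
      rw [h1]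
      linarith
  · have htm : E.triggerMove S h = Move.N := by simp only [triggerMove, if_neg hclean]
    have hiff : ∀ a : Profile E.n, (E.Clean S h.1 h.2 ∧ (E.curState h.1 h.2 ∈ S → ∀ a',
        some a = some a' → a' = allPlay E.n Move.C)) ↔ E.Clean S h.1 h.2 := fun a =>
      ⟨fun hc => hc.1, fun hc => ⟨hc, fun hs => absurd ⟨hc, hs⟩ hclean⟩⟩
    have hv : E.triggerValue S b w h = b (E.curState h.1 h.2)
        + if E.Clean S h.1 h.2 then w (E.curState h.1 h.2) else 0 := by
      simp only [triggerValue]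
      congr 1
      by_cases hc : E.Clean S h.1 h.2
      · have hs : E.curState h.1 h.2 ∉ S := fun hs => hclean ⟨hc, hs⟩
        simp [hc, benefitIn, hs]
      · simp [hc]
    rw [htm, hv]
    simp only [hiff]
    cases x with
    | N =>
      rw [hself, pay_allPlay, if_neg (by decide)]
      exact ⟨by linarith, fun _ => by ring⟩
    | C =>
      refine ⟨?_, fun he => by cases he⟩
      have h1 := E.dominant g i (allPlay E.n Move.N)
      rw [hself, pay_allPlay, if_neg (by decide)] at h1
      linarith

/-- Unilateral deviations from trigger strategies in a single period do not pay. -/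
theorem one_period_le (hb : E.IsFloor m r b) (hw : E.IsWorth m r S w)
    (hinc : ∀ s ∈ S, ∀ g, s.game = some g → E.d g ≤ w s) {σ : E.StratProfile m.k}
    (h : E.Node m.k) (i : Fin E.n) (hσ : ∀ j, j ≠ i → σ j h = E.trigger S j h) :
    E.stagePay σ i h + (1 - r) * E.δ *
        ∑ x, E.stepProb m σ h x * E.triggerValue S b w (E.extend h x) ≤ E.triggerValue S b w h ∧
      (σ i h = E.trigger S i h → E.stagePay σ i h + (1 - r) * E.δ *
        ∑ x, E.stepProb m σ h x * E.triggerValue S b w (E.extend h x) = E.triggerValue S b w h) := by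
  classical
  cases hg : E.game h with
  | none =>
    have hg' : (E.curState h.1 h.2).game = none := hg
    have heq : E.stagePay σ i h + (1 - r) * E.δ *
        ∑ x, E.stepProb m σ h x * E.triggerValue S b w (E.extend h x)
        = E.triggerValue S b w h := by
      rw [E.sum_stepProb_none m σ hg, sum_triggerValue hb hw]
      simp only [stagePay, hg, floorPay, triggerValue, benefitIn, hg', benefit, ite_self]
      simp
    exact ⟨heq.le, fun _ => heq⟩
  | some g =>
    have hdev : ∀ F : Profile E.n → ℝ, ∑ a, E.profileProb σ h a * F a = ∑ x, (σ i h).1 x *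
        F (Function.update (allPlay E.n (E.triggerMove S h)) i x) := fun F =>
      E.sum_profileProb_deviation (fun j hj => by rw [hσ j hj]; exact E.trigger_apply S h j) F
    have hsum : E.stagePay σ i h + (1 - r) * E.δ *
        ∑ x, E.stepProb m σ h x * E.triggerValue S b w (E.extend h x)
        = ∑ x, (σ i h).1 x * (E.pay g i
            (Function.update (allPlay E.n (E.triggerMove S h)) i x)
          + (1 - r) * E.δ * ∑ y, E.obsProb m (E.curState h.1 h.2) y * E.triggerValue S b w
            (E.extend h
              (some (Function.update (allPlay E.n (E.triggerMove S h)) i x), y))) := by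
      rw [E.sum_stepProb_some m σ hg]
      simp only [stagePay, hg]
      rw [hdev fun a => E.pay g i a, hdev fun a => ∑ y, E.obsProb m (E.curState h.1 h.2) y *
        E.triggerValue S b w (E.extend h (some a, y)), Finset.mul_sum, ← Finset.sum_add_distrib]
      exact Finset.sum_congr rfl fun x _ => by ring
    rw [hsum]
    constructor
    · calc _ ≤ ∑ x, (σ i h).1 x * E.triggerValue S b w h :=
            Finset.sum_le_sum fun x _ =>
              mul_le_mul_of_nonneg_left (deviation_le hb hw hinc h hg i x).1 ((σ i h).2.1 x)
        _ = E.triggerValue S b w h := by rw [← Finset.sum_mul, (σ i h).2.2, one_mul]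
    · intro hi
      rw [Finset.sum_eq_single (E.triggerMove S h)]
      · rw [(deviation_le hb hw hinc h hg i _).2 rfl, hi]
        simp [trigger]
      · intro y _ hy
        rw [simplex_eq_zero_of_ne (x := E.triggerMove S h) (by rw [hi]; simp [trigger]) hy,
          zero_mul]
      · intro hn
        exact absurd (Finset.mem_univ _) hn

theorem exists_triggerValue_bound (S : Set (State m.k)) (b w : State m.k → ℝ) :
    ∃ C, ∀ h, |E.triggerValue S b w h| ≤ C := by
  classical
  refine ⟨∑ s, (|b s| + (|E.benefitIn S s| + |w s|)), fun h => ?_⟩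
  refine le_trans ?_ (Finset.single_le_sum (f := fun s => |b s| + (|E.benefitIn S s| + |w s|))
    (fun s _ => by positivity) (Finset.mem_univ (E.curState h.1 h.2)))
  refine (abs_add_le _ _).trans (add_le_add le_rfl ?_)
  split_ifs
  · exact abs_add_le _ _
  · rw [abs_zero]; positivity

/-- The trigger value is a supersolution of the deviator's Bellman equation for every strategy `ρ`,
so iterating the one-period inequality bounds arbitrary deviations at once. -/
theorem util_deviation_le (hr : r ∈ Set.Icc (0 : ℝ) 1) (hb : E.IsFloor m r b)
    (hw : E.IsWorth m r S w) (hinc : ∀ s ∈ S, ∀ g, s.game = some g → E.d g ≤ w s)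
    (i : Fin E.n) (ρ : E.Strategy m.k) (h : E.Node m.k) :
    E.util m r (Function.update (E.trigger S) i ρ) i h ≤ E.triggerValue S b w h := by
  obtain ⟨C₁, hC₁⟩ := exists_util_bound hr (Function.update (E.trigger S) i ρ) i
  obtain ⟨C₂, hC₂⟩ := exists_triggerValue_bound S b w
  have := nonpos_of_le_discounted hr (Function.update (E.trigger S) i ρ) Set.univ
    (fun _ _ _ _ => Set.mem_univ _) (C := C₁ + C₂)
    (Z := fun h => E.util m r (Function.update (E.trigger S) i ρ) i h - E.triggerValue S b w h)
    (fun h _ => by linarith [(abs_le.1 (hC₁ h)).2, (abs_le.1 (hC₂ h)).1]) (fun h _ => by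
      have h1 := util_eq hr (Function.update (E.trigger S) i ρ) i h
      have h2 := (one_period_le hb hw hinc (σ := Function.update (E.trigger S) i ρ) h i
        fun j hj => by rw [Function.update_of_ne hj]).1
      simp only [mul_sub, Finset.sum_sub_distrib]
      linarith) (Set.mem_univ h)
  linarith

theorem util_trigger (hr : r ∈ Set.Icc (0 : ℝ) 1) (hb : E.IsFloor m r b)
    (hw : E.IsWorth m r S w) (hinc : ∀ s ∈ S, ∀ g, s.game = some g → E.d g ≤ w s)
    (i : Fin E.n) (h : E.Node m.k) :
    E.util m r (E.trigger S) i h = E.triggerValue S b w h := by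
  refine le_antisymm ?_ ?_
  · have := util_deviation_le hr hb hw hinc i (E.trigger S i) h
    rwa [Function.update_eq_self] at this
  · obtain ⟨C₁, hC₁⟩ := exists_util_bound hr (E.trigger S) i
    obtain ⟨C₂, hC₂⟩ := exists_triggerValue_bound S b w
    have := nonpos_of_le_discounted hr (E.trigger S) Set.univ
      (fun _ _ _ _ => Set.mem_univ _) (C := C₁ + C₂)
      (Z := fun h => E.triggerValue S b w h - E.util m r (E.trigger S) i h)
      (fun h _ => by linarith [(abs_le.1 (hC₁ h)).1, (abs_le.1 (hC₂ h)).2]) (fun h _ => by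
        have h1 := util_eq hr (E.trigger S) i h
        have h2 := (one_period_le hb hw hinc (σ := E.trigger S) h i fun j _ => rfl).2 rfl
        simp only [mul_sub, Finset.sum_sub_distrib]
        linarith) (Set.mem_univ h)
    linarith

theorem trigger_isEquilibrium (hr : r ∈ Set.Icc (0 : ℝ) 1) (hb : E.IsFloor m r b)
    (hw : E.IsWorth m r S w) (hinc : ∀ s ∈ S, ∀ g, s.game = some g → E.d g ≤ w s)
    (μ : State m.k → ℝ) : E.IsEquilibrium m r μ (E.trigger S) := by
  refine ⟨fun h i ρ => ?_, fun s _ l _ _ i => ⟨_, E.trigger_apply S (s, l) i⟩⟩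
  rw [util_trigger hr hb hw hinc]
  exact util_deviation_le hr hb hw hinc i ρ h

end Trigger

end Env

/-! ### Player-optimal equilibria -/

namespace Env

section Optimal

variable {E : Env} {m : Assignment} {r : ℝ} {μ : State m.k → ℝ} {σ : E.StratProfile m.k}

/-- The nodes on the path of play of the teams of the steady state `μ`. -/
def pathNodes (μ : State m.k → ℝ) (σ : E.StratProfile m.k) : Set (E.Node m.k) :=
  {h | 0 < μ h.1 ∧ E.OnPath m σ h.1 h.2}

theorem extend_mem_pathNodes {h : E.Node m.k} (hh : h ∈ pathNodes μ σ) (x : E.Step)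
    (hx : 0 < E.stepProb m σ h x) : E.extend h x ∈ pathNodes μ σ :=
  ⟨hh.1, hh.2, hx⟩

/-- For a player choosing the dominant action N, the minmax property makes all-N by the others the
worst case. -/
theorem floorPay_le (g : Game) (i : Fin E.n) {a : Profile E.n} (ha : a i = Move.N) :
    E.floorPay (some g) ≤ E.pay g i a := by
  have h1 := E.minmax g i a
  have h2 : Function.update a i Move.N = a := by rw [← ha, Function.update_eq_self]
  have h3 : Function.update (allPlay E.n Move.N) i Move.N = allPlay E.n Move.N :=
    Function.update_eq_self i (allPlay E.n Move.N)
  rw [max_eq_right (E.dominant g i a).le, h2, h3] at h1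
  have h4 := pay_allPlay (E := E) g i Move.N
  rw [if_neg (by decide), add_zero] at h4
  rw [← h4]
  exact (le_max_right _ _).trans h1

/-- The strategy that never cooperates. -/
noncomputable def defect (E : Env) (k : ℕ) : E.Strategy k :=
  fun _ => ⟨Pi.single Move.N 1, single_mem_stdSimplex ℝ _⟩

theorem defect_apply (k : ℕ) (h : E.Node k) : (E.defect k h).1 Move.N = 1 := by
  simp [defect]

theorem floor_le_util (hr : r ∈ Set.Icc (0 : ℝ) 1) {b : State m.k → ℝ} (hb : E.IsFloor m r b)
    {i : Fin E.n} (hσ : σ i = E.defect m.k) (h : E.Node m.k) :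
    b (E.curState h.1 h.2) ≤ E.util m r σ i h := by
  obtain ⟨C, hC⟩ := exists_util_bound hr σ i
  have := nonpos_of_le_discounted hr σ Set.univ (fun _ _ _ _ => Set.mem_univ _)
    (C := ∑ s, |b s| + C) (Z := fun h => b (E.curState h.1 h.2) - E.util m r σ i h)
    (fun h _ => by
      have h1 := (abs_le.1 (hC h)).1
      have h2 : b (E.curState h.1 h.2) ≤ ∑ s, |b s| := (le_abs_self _).trans
        (Finset.single_le_sum (f := fun s => |b s|) (fun _ _ => abs_nonneg _)
          (Finset.mem_univ (E.curState h.1 h.2)))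
      linarith) (fun h _ => by
      have h1 := util_eq hr σ i h
      have h2 := hb (E.curState h.1 h.2)
      have h3 := E.sum_stepProb_obs m σ h fun y => b ((E.curState h.1 h.2).push y)
      have h4 : E.floorPay (E.curState h.1 h.2).game ≤ E.stagePay σ i h := by
        cases hg : E.game h with
        | none =>
          have hg' : (E.curState h.1 h.2).game = none := hg
          simp [stagePay, hg, hg', floorPay]
        | some g =>
          have hg' : (E.curState h.1 h.2).game = some g := hg
          simp only [stagePay, hg, hg']
          calc E.floorPay (some g) = ∑ a, E.profileProb σ h a * E.floorPay (some g) := by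
                rw [← Finset.sum_mul, E.sum_profileProb, one_mul]
            _ ≤ _ := Finset.sum_le_sum fun a _ => by
                by_cases ha : a i = Move.N
                · exact mul_le_mul_of_nonneg_left (floorPay_le g i ha)
                    (E.profileProb_nonneg σ h a)
                · have : E.profileProb σ h a = 0 := Finset.prod_eq_zero (Finset.mem_univ i)
                    (simplex_eq_zero_of_ne (by rw [hσ]; exact defect_apply m.k h) ha)
                  rw [this, zero_mul, zero_mul]
      simp only [mul_sub, Finset.sum_sub_distrib]
      change _ ≤ (1 - r) * E.δ * ∑ x, E.stepProb m σ h x * b ((E.curState h.1 h.2).push x.2) - _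
      rw [h3]
      linarith) (Set.mem_univ h)
  linarith

theorem sum_const_fin (E : Env) (x : ℝ) : ∑ _i : Fin E.n, x = E.n * x := by
  simp

theorem n_pos (E : Env) : (0 : ℝ) < E.n := by
  have := E.two_le_n
  exact_mod_cast (by omega : 0 < E.n)

/-- A player who cooperates receives at least the payoff of never cooperating again. -/
theorem IsSPE.coop_le_util (hr : r ∈ Set.Icc (0 : ℝ) 1) (hσ : E.IsSPE m r σ)
    {b : State m.k → ℝ} (hb : E.IsFloor m r b) {h : E.Node m.k} {g : Game}
    (hg : E.game h = some g) (hC : E.AllPlayAt σ Move.C h) (i : Fin E.n) :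
    b (E.curState h.1 h.2) + E.c g + E.d g ≤ E.util m r σ i h := by
  set τ := Function.update σ i (E.defect m.k) with hτ
  have hg' : (E.curState h.1 h.2).game = some g := hg
  refine le_trans ?_ (hσ h i (E.defect m.k))
  rw [util_eq hr τ i h]
  have h1 : E.stagePay τ i h = E.floorPay (some g) + E.c g + E.d g := by
    simp only [stagePay, hg]
    rw [E.sum_profileProb_pure (b := Function.update (allPlay E.n Move.C) i Move.N) fun j => ?_,
      E.pay_update_allPlay]
    · simp [floorPay, c, d]
    · by_cases hj : j = i
      · subst hj
        simp [hτ, defect_apply]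
      · simp only [hτ, Function.update_of_ne hj]
        exact hC j
  have h2 : ∑ y, E.obsProb m (E.curState h.1 h.2) y * b ((E.curState h.1 h.2).push y)
      ≤ ∑ x, E.stepProb m τ h x * E.util m r τ i (E.extend h x) := by
    rw [← E.sum_stepProb_obs m τ h fun y => b ((E.curState h.1 h.2).push y)]
    refine Finset.sum_le_sum fun x _ => mul_le_mul_of_nonneg_left ?_ (E.stepProb_nonneg m τ h x)
    exact floor_le_util hr hb (by simp [hτ]) (E.extend h x)
  have h3 := hb (E.curState h.1 h.2)
  have h4 := mul_le_mul_of_nonneg_left h2 (discount_nonneg (E := E) hr)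
  rw [hg'] at h3
  rw [h1]
  linarith

theorem exists_profile (hσ : E.PureOnPath m μ σ) {h : E.Node m.k} (hh : h ∈ pathNodes μ σ)
    {g : Game} (hg : E.game h = some g) : ∃ a : Profile E.n, ∀ i, (σ i h).1 (a i) = 1 := by
  have := hσ h.1 hh.1 h.2 hh.2 (by rw [Prod.mk.eta, hg]; simp)
  choose a ha using this
  exact ⟨a, ha⟩

theorem sum_stagePay_pure {h : E.Node m.k} {g : Game} (hg : E.game h = some g)
    {a : Profile E.n} (ha : ∀ i, (σ i h).1 (a i) = 1) :
    ∑ i, E.stagePay σ i h = ∑ i, E.pay g i a := by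
  refine Finset.sum_congr rfl fun i _ => ?_
  simp only [stagePay, hg]
  exact E.sum_profileProb_pure ha _

theorem sum_pay_allPlay (g : Game) (x : Move) : ∑ i, E.pay g i (allPlay E.n x)
    = E.n * (E.floorPay (some g) + if x = Move.C then E.c g else 0) := by
  rw [← sum_const_fin]
  exact Finset.sum_congr rfl fun i _ => pay_allPlay g i x

/-- On the path a pure profile is played, and any profile other than `C^n` totals at most `N^n`,
with equality only there. Hence the total determines the play. -/
theorem sum_stagePay_le {S : Set (State m.k)} (hpure : E.PureOnPath m μ σ)
    {h : E.Node m.k} (hh : h ∈ pathNodes μ σ)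
    (hS : E.game h ≠ none → E.AllPlayAt σ Move.C h → E.curState h.1 h.2 ∈ S) :
    ∑ i, E.stagePay σ i h ≤ E.n * (E.floorPay (E.game h) + E.benefitIn S (E.curState h.1 h.2)) ∧
      (∑ i, E.stagePay σ i h
          = E.n * (E.floorPay (E.game h) + E.benefitIn S (E.curState h.1 h.2)) →
        E.game h ≠ none → (E.curState h.1 h.2 ∈ S → E.AllPlayAt σ Move.C h) ∧
          (E.curState h.1 h.2 ∉ S → E.AllPlayAt σ Move.N h)) := by
  have hben := benefitIn_nonneg (E := E) S (E.curState h.1 h.2)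
  have hn := n_pos E
  cases hg : E.game h with
  | none =>
    refine ⟨?_, fun _ hne => absurd rfl hne⟩
    simp only [stagePay, hg, Finset.sum_const_zero, floorPay, zero_add]
    positivity
  | some g =>
    have hg' : (E.curState h.1 h.2).game = some g := hg
    obtain ⟨a, ha⟩ := exists_profile hpure hh hg
    rw [sum_stagePay_pure hg ha]
    by_cases haC : a = allPlay E.n Move.C
    · have hC : E.AllPlayAt σ Move.C h := fun i => by
        have := ha i
        rwa [haC] at this
      have hmem := hS (by rw [hg]; simp) hC
      rw [haC, sum_pay_allPlay, if_pos rfl]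
      simp only [benefitIn, if_pos hmem, hg', benefit]
      exact ⟨le_rfl, fun _ _ => ⟨fun _ => hC, fun hn => absurd hmem hn⟩⟩
    · have h1 : ∑ i, E.pay g i a ≤ E.n * E.floorPay (some g) := by
        have h2 := sum_pay_allPlay (E := E) g Move.N
        rw [if_neg (by decide), add_zero] at h2
        rw [← h2]
        by_cases haN : a = allPlay E.n Move.N
        · rw [haN]
        · exact (E.noncoop_max g a haC haN).le
      refine ⟨h1.trans (mul_le_mul_of_nonneg_left (by linarith) hn.le), fun heq _ => ?_⟩
      have hb0 : E.n * E.benefitIn S (E.curState h.1 h.2) ≤ 0 := by linarith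
      constructor
      · intro hs
        simp only [benefitIn, if_pos hs, hg', benefit] at hb0
        have := mul_pos hn (E.c_pos g)
        linarith
      · intro _ i
        have haN : a = allPlay E.n Move.N := by
          by_contra haN
          have h3 := E.noncoop_max g a haC haN
          have h2 := sum_pay_allPlay (E := E) g Move.N
          rw [if_neg (by decide), add_zero] at h2
          have := mul_nonneg hn.le hben
          linarith
        have := ha i
        rwa [haN] at this

/-- The discounted sum of the players' payoffs, compared to cooperation in the states in `S`. -/
theorem sum_util_eq (hr : r ∈ Set.Icc (0 : ℝ) 1) {S : Set (State m.k)} {b w : State m.k → ℝ}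
    (hb : E.IsFloor m r b) (hw : E.IsWorth m r S w) (σ : E.StratProfile m.k) (h : E.Node m.k) :
    (E.n * (b (E.curState h.1 h.2) + E.benefitIn S (E.curState h.1 h.2) + w (E.curState h.1 h.2))
        - ∑ i, E.util m r σ i h)
      = (E.n * (E.floorPay (E.game h) + E.benefitIn S (E.curState h.1 h.2))
          - ∑ i, E.stagePay σ i h)
        + (1 - r) * E.δ * ∑ x, E.stepProb m σ h x *
          (E.n * (b (E.curState h.1 (x :: h.2)) + E.benefitIn S (E.curState h.1 (x :: h.2))
            + w (E.curState h.1 (x :: h.2))) - ∑ i, E.util m r σ i (E.extend h x)) := by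
  have h1 : ∑ i, E.util m r σ i h = ∑ i, E.stagePay σ i h
      + (1 - r) * E.δ * ∑ x, E.stepProb m σ h x * ∑ i, E.util m r σ i (E.extend h x) := by
    rw [Finset.sum_congr rfl fun i _ => util_eq hr σ i h, Finset.sum_add_distrib,
      ← Finset.mul_sum, Finset.sum_comm]
    simp only [Finset.mul_sum]
  have h2 := hb (E.curState h.1 h.2)
  have h3 := hw (E.curState h.1 h.2)
  have h4 := E.sum_stepProb_obs m σ h fun y => E.n * (b ((E.curState h.1 h.2).push y)
    + (E.benefitIn S ((E.curState h.1 h.2).push y) + w ((E.curState h.1 h.2).push y)))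
  have h5 : ∑ y, E.obsProb m (E.curState h.1 h.2) y * (E.n * (b ((E.curState h.1 h.2).push y)
      + (E.benefitIn S ((E.curState h.1 h.2).push y) + w ((E.curState h.1 h.2).push y))))
      = E.n * (∑ y, E.obsProb m (E.curState h.1 h.2) y * b ((E.curState h.1 h.2).push y)
        + ∑ y, E.obsProb m (E.curState h.1 h.2) y *
          (E.benefitIn S ((E.curState h.1 h.2).push y) + w ((E.curState h.1 h.2).push y))) := by
    rw [← Finset.sum_add_distrib, Finset.mul_sum]
    exact Finset.sum_congr rfl fun y _ => by ring
  rw [h5] at h4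
  simp only [mul_sub, Finset.sum_sub_distrib]
  have h6 : ∑ x, E.stepProb m σ h x * (E.n * (b (E.curState h.1 (x :: h.2))
      + E.benefitIn S (E.curState h.1 (x :: h.2)) + w (E.curState h.1 (x :: h.2))))
      = ∑ x : E.Step, E.stepProb m σ h x * (E.n * (b ((E.curState h.1 h.2).push x.2)
        + (E.benefitIn S ((E.curState h.1 h.2).push x.2)
          + w ((E.curState h.1 h.2).push x.2)))) :=
    Finset.sum_congr rfl fun x _ => by rw [curState, add_assoc]
  rw [h1, h6, h4]
  simp only [game]
  linear_combination (E.n : ℝ) * h2 + (E.n : ℝ) * h3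

theorem sum_util_le (hr : r ∈ Set.Icc (0 : ℝ) 1) {S : Set (State m.k)} {b w : State m.k → ℝ}
    (hb : E.IsFloor m r b) (hw : E.IsWorth m r S w) (hpure : E.PureOnPath m μ σ)
    (hS : ∀ h ∈ pathNodes μ σ, E.game h ≠ none → E.AllPlayAt σ Move.C h → E.curState h.1 h.2 ∈ S)
    {h : E.Node m.k} (hh : h ∈ pathNodes μ σ) :
    ∑ i, E.util m r σ i h ≤ E.n * (b (E.curState h.1 h.2)
      + E.benefitIn S (E.curState h.1 h.2) + w (E.curState h.1 h.2)) := by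
  choose C hC using fun i => exists_util_bound hr σ i
  have := nonpos_of_le_discounted hr σ (pathNodes μ σ)
    (fun h hh x hx => extend_mem_pathNodes hh x hx)
    (C := ∑ i, C i + ∑ s, |E.n * (b s + E.benefitIn S s + w s)|)
    (Z := fun h => ∑ i, E.util m r σ i h - E.n * (b (E.curState h.1 h.2)
      + E.benefitIn S (E.curState h.1 h.2) + w (E.curState h.1 h.2)))
    (fun h _ => by
      have h1 : ∑ i, E.util m r σ i h ≤ ∑ i, C i :=
        Finset.sum_le_sum fun i _ => (abs_le.1 (hC i h)).2
      have h2 := Finset.single_le_sum (f := fun s => |E.n * (b s + E.benefitIn S s + w s)|)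
        (fun _ _ => abs_nonneg _) (Finset.mem_univ (E.curState h.1 h.2))
      have h3 := neg_abs_le (E.n * (b (E.curState h.1 h.2)
        + E.benefitIn S (E.curState h.1 h.2) + w (E.curState h.1 h.2)))
      linarith) (fun h hh => by
      have h1 := sum_util_eq hr hb hw σ h
      have h2 := (sum_stagePay_le hpure hh (hS h hh)).1
      have h3 : ∑ x, E.stepProb m σ h x * (∑ i, E.util m r σ i (E.extend h x)
          - E.n * (b (E.curState (E.extend h x).1 (E.extend h x).2)
          + E.benefitIn S (E.curState (E.extend h x).1 (E.extend h x).2)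
          + w (E.curState (E.extend h x).1 (E.extend h x).2)))
          = -∑ x, E.stepProb m σ h x *
          (E.n * (b (E.curState h.1 (x :: h.2)) + E.benefitIn S (E.curState h.1 (x :: h.2))
            + w (E.curState h.1 (x :: h.2))) - ∑ i, E.util m r σ i (E.extend h x)) := by
        rw [← Finset.sum_neg_distrib]
        exact Finset.sum_congr rfl fun x _ => by simp only [extend]; ring
      rw [h3]
      linarith) hh
  linarith

/-- On the path of an equilibrium, the players cooperate in states of the cooperation set only. -/
theorem IsEquilibrium.mem_coopSet (hr : r ∈ Set.Icc (0 : ℝ) 1) (hσ : E.IsEquilibrium m r μ σ)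
    {h : E.Node m.k} (hh : h ∈ pathNodes μ σ) (hg : E.game h ≠ none)
    (hC : E.AllPlayAt σ Move.C h) : E.curState h.1 h.2 ∈ E.coopSet m r := by
  -- `S` collects the states in which this equilibrium ever cooperates. Each cooperating player must
  -- get `b + c + d`, while the total is at most `n * (b + c + w)`; summing over players disposes of
  -- unequal payoffs and gives `d ≤ w` on `S`.
  let S : Set (State m.k) := {s | ∃ h ∈ pathNodes μ σ, E.curState h.1 h.2 = s ∧
    E.game h ≠ none ∧ E.AllPlayAt σ Move.C h}
  obtain ⟨b, hb⟩ := exists_isFloor (E := E) (m := m) hr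
  obtain ⟨w, hw⟩ := exists_isWorth (E := E) hr S
  have hself : E.SelfSustaining m r S := by
    refine ⟨w, hw, fun s hs g hsg => ?_⟩
    have hsS := hs
    obtain ⟨h, hh, rfl, hg, hC⟩ := hs
    have h1 := sum_util_le hr hb hw hσ.2 (S := S)
      (fun h hh hg hC => ⟨h, hh, rfl, hg, hC⟩) hh
    have h2 : ∑ i : Fin E.n, (b (E.curState h.1 h.2) + E.c g + E.d g) ≤ ∑ i, E.util m r σ i h :=
      Finset.sum_le_sum fun i _ => hσ.1.coop_le_util hr hb hsg hC i
    rw [sum_const_fin] at h2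
    have h3 := le_of_mul_le_mul_left (h2.trans h1) (n_pos E)
    simp only [benefitIn, if_pos hsS, hsg, benefit] at h3
    linarith
  exact subset_coopSet hself ⟨h, hh, rfl, hg, hC⟩

/-- Trigger strategies for the cooperation set are player-optimal. -/
theorem trigger_isPlayerOptimal (hr : r ∈ Set.Icc (0 : ℝ) 1) (μ : State m.k → ℝ) :
    E.IsPlayerOptimal m r μ (E.trigger (E.coopSet m r)) := by
  obtain ⟨b, hb⟩ := exists_isFloor (E := E) (m := m) hr
  obtain ⟨w, hw⟩ := exists_isWorth (E := E) hr (E.coopSet m r)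
  refine ⟨trigger_isEquilibrium hr hb hw (fun s hs g hg => hw.d_le hr hs hg) μ,
    fun σ' hσ' s hs => ?_⟩
  have h1 := sum_util_le hr hb hw hσ'.2 (fun h hh hg hC => hσ'.mem_coopSet hr hh hg hC)
    (h := (s, [])) ⟨hs, trivial⟩
  refine h1.trans (le_of_eq ?_)
  rw [← sum_const_fin]
  refine Finset.sum_congr rfl fun i _ => ?_
  rw [util_trigger hr hb hw fun s hs g hg => hw.d_le hr hs hg]
  simp [triggerValue, Clean, add_assoc]

/-- On the path of a player-optimal equilibrium, all players cooperate in the states of the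
cooperation set, and no player cooperates in the other states. -/
theorem IsPlayerOptimal.play (hr : r ∈ Set.Icc (0 : ℝ) 1) (hσ : E.IsPlayerOptimal m r μ σ)
    {s : State m.k} (hs : 0 < μ s) {l : List E.Step} (hl : E.OnPath m σ s l)
    (hg : E.game (s, l) ≠ none) :
    (E.curState s l ∈ E.coopSet m r → E.AllPlayAt σ Move.C (s, l)) ∧
      (E.curState s l ∉ E.coopSet m r → E.AllPlayAt σ Move.N (s, l)) := by
  obtain ⟨b, hb⟩ := exists_isFloor (E := E) (m := m) hr
  obtain ⟨w, hw⟩ := exists_isWorth (E := E) hr (E.coopSet m r)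
  have hmem := fun h hh hg hC => hσ.1.mem_coopSet (h := h) hr hh hg hC
  have hpure := hσ.1.2
  rcases (discount_nonneg (E := E) hr).eq_or_lt with hD | hD
  · -- future periods do not matter
    have hw0 : ∀ s, w s = 0 := fun s => by rw [hw s, ← hD, zero_mul]
    have hh : ((s, l) : E.Node m.k) ∈ pathNodes μ σ := ⟨hs, hl⟩
    obtain ⟨g, hg'⟩ := Option.ne_none_iff_exists'.1 hg
    have hnot : E.curState s l ∉ E.coopSet m r := fun hmem => by
      have := hw.d_le hr hmem hg'
      rw [hw0] at this
      linarith [E.d_pos g]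
    refine ⟨fun h => absurd h hnot, fun _ i => ?_⟩
    obtain ⟨a, ha⟩ := exists_profile hpure hh hg'
    have hai : a i = Move.N := by
      by_contra hne
      have haC : a i = Move.C := by
        cases h : a i with
        | C => rfl
        | N => exact absurd h hne
      have h1 := hσ.1.1 (s, l) i (E.defect m.k)
      rw [util_eq hr, util_eq hr, ← hD, zero_mul, zero_mul, add_zero, add_zero] at h1
      simp only [stagePay, hg'] at h1
      rw [E.sum_profileProb_pure ha, E.sum_profileProb_pure (b := Function.update a i Move.N)
        fun j => ?_] at h1
      · have h2 := E.dominant g i a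
        rw [← haC, Function.update_eq_self] at h2
        linarith
      · by_cases hj : j = i
        · subst hj
          simp [defect_apply]
        · simp only [Function.update_of_ne hj]
          exact ha j
    rw [← hai]
    exact ha i
  · have hgap : ∀ h ∈ pathNodes μ σ, ∑ i, E.util m r σ i h ≤ E.n * (b (E.curState h.1 h.2)
        + E.benefitIn (E.coopSet m r) (E.curState h.1 h.2) + w (E.curState h.1 h.2)) :=
      fun h hh => sum_util_le hr hb hw hpure hmem hh
    have hnext : ∀ h ∈ pathNodes μ σ, ∀ x, 0 ≤ E.stepProb m σ h x *
          (E.n * (b (E.curState h.1 (x :: h.2))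
            + E.benefitIn (E.coopSet m r) (E.curState h.1 (x :: h.2))
            + w (E.curState h.1 (x :: h.2))) - ∑ i, E.util m r σ i (E.extend h x)) := by
      intro h hh x
      rcases (E.stepProb_nonneg m σ h x).lt_or_eq with hx | hx
      · exact mul_nonneg hx.le (sub_nonneg.2 (hgap _ (extend_mem_pathNodes hh x hx)))
      · rw [← hx, zero_mul]
    -- At the initial node optimality attains the upper bound. The gap at a node is a nonnegative
    -- stage loss plus the discounted mean of nonnegative later gaps, so a zero gap spreads along
    -- the path.
    have hall : ∀ l, E.OnPath m σ s l → ∑ i, E.util m r σ i (s, l) = E.n * (b (E.curState s l)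
        + E.benefitIn (E.coopSet m r) (E.curState s l) + w (E.curState s l)) := by
      intro l
      induction l with
      | nil =>
        intro _
        refine le_antisymm (hgap (s, []) ⟨hs, trivial⟩) ?_
        refine le_trans (le_of_eq ?_)
          (hσ.2 _ (trigger_isPlayerOptimal (E := E) hr μ).1 s hs)
        rw [← sum_const_fin]
        refine Finset.sum_congr rfl fun i _ => ?_
        rw [util_trigger hr hb hw fun s hs g hg => hw.d_le hr hs hg]
        simp [triggerValue, Clean, add_assoc, curState]
      | cons x l ih =>
        intro hl
        have hh : ((s, l) : E.Node m.k) ∈ pathNodes μ σ := ⟨hs, hl.1⟩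
        have h1 := sum_util_eq hr hb hw σ (s, l)
        rw [ih hl.1, sub_self] at h1
        have h2 := (sum_stagePay_le hpure hh (hmem _ hh)).1
        have h3 := Finset.sum_nonneg fun x (_ : x ∈ Finset.univ) => hnext _ hh x
        have h4 := mul_nonneg hD.le h3
        have h5 : ∑ x, E.stepProb m σ (s, l) x * (E.n * (b (E.curState s (x :: l))
            + E.benefitIn (E.coopSet m r) (E.curState s (x :: l))
            + w (E.curState s (x :: l))) - ∑ i, E.util m r σ i (E.extend (s, l) x)) = 0 := by
          refine le_antisymm ?_ h3
          by_contra hcon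
          have := mul_pos hD (not_le.1 hcon)
          linarith
        have h6 := (Finset.sum_eq_zero_iff_of_nonneg fun x _ => hnext _ hh x).1 h5 x
          (Finset.mem_univ x)
        rcases mul_eq_zero.1 h6 with h7 | h7
        · exact absurd h7 hl.2.ne'
        · exact (sub_eq_zero.1 h7).symm
    have hh : ((s, l) : E.Node m.k) ∈ pathNodes μ σ := ⟨hs, hl⟩
    have h1 := sum_util_eq hr hb hw σ (s, l)
    rw [hall l hl, sub_self] at h1
    have h2 := sum_stagePay_le hpure hh (hmem _ hh)
    have h3 := Finset.sum_nonneg fun x (_ : x ∈ Finset.univ) => hnext _ hh x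
    have h4 := mul_nonneg hD.le h3
    exact h2.2 (le_antisymm h2.1 (by linarith)) hg

/-- In a player-optimal equilibrium, there is cooperation in the states of the cooperation set. -/
theorem IsPlayerOptimal.coopInState_iff (hr : r ∈ Set.Icc (0 : ℝ) 1)
    (hσ : E.IsPlayerOptimal m r μ σ) {s : State m.k} (hs : 0 < μ s) (hg : s.game ≠ none) :
    E.CoopInState m μ σ s ↔ s ∈ E.coopSet m r := by
  constructor
  · intro h
    by_contra hn
    have h1 := h s hs [] trivial rfl E.player
    have h2 := (hσ.play hr hs (l := []) trivial hg).2 hn E.player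
    rw [simplex_eq_zero_of_ne h1 (by decide)] at h2
    exact zero_ne_one h2
  · intro h s₀ hs₀ l hl hcur
    refine (hσ.play hr hs₀ hl ?_).1 (by rw [hcur]; exact h)
    simp only [game, hcur]
    exact hg

end Optimal

end Env

/-! ### Recurrent classes of an assignment -/

namespace Env

namespace CoopChain

variable {E : Env} {X : Type} [Fintype X] (K : E.CoopChain X)

/-- If cooperation on good tasks only is not incentive compatible, then there is cooperation on bad
tasks wherever there is cooperation on good tasks. -/
theorem exists_coop_bad (hG : E.δ * E.flow Game.G < (1 - E.δ) * E.d Game.G) {s₀ : X}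
    (h₀ : 0 < K.coop s₀ Game.G) : ∃ s, 0 < K.coop s Game.B := by
  by_contra hne
  push Not at hne
  have hδ : 0 < 1 - E.δ := sub_pos.2 E.δ_lt_one
  -- `M` is the value of cooperating on good tasks forever, which is too small to deter a deviation
  -- in the good game.
  obtain ⟨M, hM⟩ : ∃ M, M = E.δ * E.flow Game.G / (1 - E.δ) := ⟨_, rfl⟩
  have hM1 : (1 - E.δ) * M = E.δ * E.flow Game.G := by
    rw [hM]; exact mul_div_cancel₀ _ hδ.ne'
  have hflow := E.flow_pos Game.G
  have hM0 : 0 ≤ M := by rw [hM]; exact div_nonneg (mul_nonneg E.δ_pos.le hflow.le) hδ.le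
  have hle : ∀ s, K.u s ≤ M := by
    refine (MoveChain.transient_of_lt_one K.nx K.discounted_nonneg fun s => by
      rw [K.sum_discounted]; exact K.disc_lt_one).le_of_sub_super
      (f := fun s => K.disc * ∑ x, K.v s x * E.benefit x.2) (z := fun _ => M)
      (fun s => (K.u_eq' s).le) fun s => ?_
    rw [← Finset.sum_mul, K.sum_discounted, K.sum_v_benefit, Game.sum_eq,
      le_antisymm (hne s) (K.coop_nonneg s _)]
    have h1 : K.coop s Game.G ≤ 1 := by
      have h2 := K.task_sum s
      rw [Game.sum_eq] at h2
      linarith [K.coop_le s Game.G, K.task_nonneg s Game.B]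
    have h3 : K.coop s Game.G * E.flow Game.G ≤ E.flow Game.G :=
      mul_le_of_le_one_left hflow.le h1
    have h4 := mul_le_mul_of_nonneg_left h3 K.disc_nonneg
    have h5 := mul_le_mul_of_nonneg_right K.disc_le (add_nonneg hflow.le hM0)
    linarith
  have h1 := (K.incentive s₀ _ h₀).trans (hle _)
  have h2 := mul_le_mul_of_nonneg_left h1 hδ.le
  linarith

end CoopChain

section Classes

variable {E : Env} {m : Assignment} {μ : State m.k → ℝ}

theorem Reaches.step {s t : State m.k} (h : E.Reaches m s t) {x : Obs}
    (hx : 0 < E.obsProb m t x) : E.Reaches m s (t.push x) :=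
  Relation.ReflTransGen.tail h ((E.trans_pos_iff m t _).2 ⟨x, hx, rfl⟩)

theorem reaches_push {s : State m.k} {x : Obs} (hx : 0 < E.obsProb m s x) :
    E.Reaches m s (s.push x) :=
  Reaches.step Relation.ReflTransGen.refl hx

theorem IsSteady.pos_push (hμ : E.IsSteady m μ) {s : State m.k} (hs : 0 < μ s) {x : Obs}
    (hx : 0 < E.obsProb m s x) : 0 < μ (s.push x) := by
  rw [hμ.2]
  refine Finset.sum_pos' (fun t _ => mul_nonneg (E.trans_nonneg m _ _) (hμ.1.1 t))
    ⟨s, Finset.mem_univ s, mul_pos ?_ hs⟩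
  exact (E.trans_pos_iff m s _).2 ⟨x, hx, rfl⟩

theorem IsSteady.pos_of_reaches (hμ : E.IsSteady m μ) {s t : State m.k} (hs : 0 < μ s)
    (hst : E.Reaches m s t) : 0 < μ t := by
  induction hst with
  | refl => exact hs
  | tail _ hstep ih =>
    obtain ⟨x, hx, rfl⟩ := (E.trans_pos_iff m _ _).1 hstep
    exact hμ.pos_push ih hx

/-- In the support of a steady state, every transition can be undone. -/
theorem IsSteady.reaches_symm (hμ : E.IsSteady m μ) {s t : State m.k} (hs : 0 < μ s)
    (hst : E.Reaches m s t) : E.Reaches m t s := by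
  classical
  -- The states reachable from `t` form an absorbing set, so its indicator is subharmonic.
  -- Stationarity forces equality where `μ` is positive: no mass can enter the set from outside, and
  -- `s` must belong to it.
  let f : State m.k → ℝ := fun a => if E.Reaches m t a then 1 else 0
  have hf0 : ∀ a, 0 ≤ f a := fun a => by simp only [f]; split_ifs <;> norm_num
  have hge : ∀ a, f a ≤ ∑ x, E.obsProb m a x * f (a.push x) := by
    intro a
    by_cases ha : E.Reaches m t a
    · have : ∑ x, E.obsProb m a x * f (a.push x) = ∑ x, E.obsProb m a x := by
        refine Finset.sum_congr rfl fun x _ => ?_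
        rcases (E.obsProb_nonneg m a x).lt_or_eq with hx | hx
        · simp only [f, if_pos (ha.step hx), mul_one]
        · rw [← hx, zero_mul]
      rw [this, E.sum_obsProb]
      simp only [f, if_pos ha, le_refl]
    · simp only [f, if_neg ha]
      exact Finset.sum_nonneg fun x _ => mul_nonneg (E.obsProb_nonneg m a x) (hf0 _)
  have heq : ∀ a, μ a * f a = μ a * ∑ x, E.obsProb m a x * f (a.push x) := fun a =>
    (Finset.sum_eq_sum_iff_of_le fun a _ =>
      mul_le_mul_of_nonneg_left (hge a) (hμ.1.1 a)).1 (hμ.sum_mul f) a (Finset.mem_univ a)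
  have hback : ∀ a, 0 < μ a → ∀ x, 0 < E.obsProb m a x → E.Reaches m t (a.push x) →
      E.Reaches m t a := by
    intro a ha x hx hr
    by_contra hn
    have h1 := heq a
    simp only [f, if_neg hn, mul_zero] at h1
    have h2 : 0 < ∑ x, E.obsProb m a x * f (a.push x) :=
      Finset.sum_pos' (fun x _ => mul_nonneg (E.obsProb_nonneg m a x) (hf0 _))
        ⟨x, Finset.mem_univ x, by simp only [f, if_pos hr, mul_one]; exact hx⟩
    exact (mul_pos ha h2).ne h1
  have key : ∀ a, E.Reaches m s a → E.Reaches m t a → E.Reaches m t s := by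
    intro a hsa
    induction hsa with
    | refl => exact id
    | tail hsb hstep ih =>
      intro hta
      obtain ⟨x, hx, rfl⟩ := (E.trans_pos_iff m _ _).1 hstep
      exact ih (hback _ (hμ.pos_of_reaches hs hsb) x hx hta)
  exact key t hst Relation.ReflTransGen.refl

/-- A state with the game `g` in the support of a steady state has a predecessor there. -/
theorem IsSteady.exists_pred (hμ : E.IsSteady m μ) {s : State m.k} (hs : 0 < μ s) {g : Game}
    (hg : s.game = some g) : ∃ p, 0 < μ p ∧ E.Reaches m p s ∧ 0 < (m.next p).1 g ∧
      p.push (g, some g) = s := by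
  have h1 := hs
  rw [hμ.2] at h1
  obtain ⟨p, _, hp⟩ := Finset.exists_lt_of_sum_lt (s := Finset.univ)
    (f := fun _ : State m.k => (0 : ℝ)) (by simpa using h1)
  have htr : 0 < E.trans m p s := lt_of_le_of_ne (E.trans_nonneg m p s) fun h => by
    rw [← h, zero_mul] at hp; exact lt_irrefl _ hp
  have hμp : 0 < μ p := lt_of_le_of_ne (hμ.1.1 p) fun h => by
    rw [← h, mul_zero] at hp; exact lt_irrefl _ hp
  obtain ⟨⟨t, o⟩, hx, hpush⟩ := (E.trans_pos_iff m p s).1 htr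
  have ho : o = some g := by
    rw [← hg, ← hpush]
    simp [State.game, State.push]
  subst ho
  have htg : g = t := by
    by_contra hne
    simp [obsProb, gameProb, hne] at hx
  subst htg
  refine ⟨p, hμp, ?_, ?_, hpush⟩
  · rw [← hpush]
    exact reaches_push hx
  · exact lt_of_le_of_ne ((m.next p).2.1 _) fun h => by
      simp [obsProb, ← h] at hx

open Classical in
/-- The probability of cooperation on task `t` in the period after state `s`. -/
noncomputable def coopTask (E : Env) (m : Assignment) (r : ℝ) (s : State m.k) (t : WorkTask) : ℝ :=
  -- A period counts as cooperative according to its task, even if no game arrives; within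
  -- cooperative periods the games thus keep their arrival law.
  if s.push (t, some t) ∈ E.coopSet m r then (m.next s).1 t else 0

theorem coopTask_nonneg (r : ℝ) (s : State m.k) (t : WorkTask) : 0 ≤ E.coopTask m r s t := by
  unfold coopTask
  split_ifs
  · exact (m.next s).2.1 t
  · exact le_rfl

theorem coopTask_le (r : ℝ) (s : State m.k) (t : WorkTask) :
    E.coopTask m r s t ≤ (m.next s).1 t := by
  unfold coopTask
  split_ifs
  · exact le_rfl
  · exact (m.next s).2.1 t

open Classical in
theorem sum_obsProb_coop {r : ℝ} (s : State m.k) (f : Option Game → ℝ) (hf : f none = 0) :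
    (∑ x, E.obsProb m s x * if s.push x ∈ E.coopSet m r then f (s.push x).game else 0)
      = ∑ x : Obs, E.coopTask m r s x.1 * E.gameProb x.1 x.2 * f x.2 := by
  refine Finset.sum_congr rfl fun x _ => ?_
  obtain ⟨t, o⟩ := x
  have hgame : (s.push (t, o)).game = o := by simp [State.game, State.push]
  rw [hgame]
  cases o with
  | none => simp [hf]
  | some g =>
    by_cases hgt : g = t
    · subst hgt
      simp only [obsProb, coopTask]
      split_ifs <;> ring
    · simp [obsProb, gameProb, hgt]

/-- The states that can be reached from `z`. -/
abbrev ReachClass (E : Env) (m : Assignment) (z : State m.k) : Type :=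
  {s : State m.k // E.Reaches m z s}

open Classical in
noncomputable instance (z : State m.k) : Fintype (E.ReachClass m z) := Subtype.fintype _

theorem sum_class {z : State m.k} {f : State m.k → ℝ} (hf : ∀ s, ¬ E.Reaches m z s → f s = 0) :
    ∑ s : E.ReachClass m z, f s.1 = ∑ s, f s :=
  Fintype.sum_of_injective Subtype.val Subtype.val_injective _ _
    (fun s hs => hf s fun h => hs ⟨⟨s, h⟩, rfl⟩) fun _ => rfl

open Classical in
/-- The next state in a class. -/
noncomputable def classNext {z : State m.k} (s : E.ReachClass m z) (x : Obs) : E.ReachClass m z :=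
  -- Observations of probability zero could leave the class; the value for them is irrelevant.
  if h : 0 < E.obsProb m s.1 x then ⟨s.1.push x, s.2.step h⟩ else s

theorem obsProb_mul_classNext {z : State m.k} (s : E.ReachClass m z) (x : Obs)
    (f : E.ReachClass m z → ℝ) (F : State m.k → ℝ) (hF : ∀ s : E.ReachClass m z, F s.1 = f s) :
    E.obsProb m s.1 x * f (classNext s x) = E.obsProb m s.1 x * F (s.1.push x) := by
  rcases (E.obsProb_nonneg m s.1 x).lt_or_eq with hx | hx
  · rw [classNext, dif_pos hx, ← hF]
  · rw [← hx, zero_mul, zero_mul]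

theorem leads_class {z : State m.k} (s t : E.ReachClass m z) (h : E.Reaches m s.1 t.1) :
    MoveChain.Leads (fun (s : E.ReachClass m z) x => (m.next s.1).1 x.1 * E.gameProb x.1 x.2)
      classNext s t := by
  obtain ⟨t, ht⟩ := t
  change E.Reaches m s.1 t at h
  induction h with
  | refl => exact Relation.ReflTransGen.refl
  | tail hsb hstep ih =>
    rename_i b c
    obtain ⟨x, hx, rfl⟩ := (E.trans_pos_iff m _ _).1 hstep
    have hb : E.Reaches m z b := Relation.ReflTransGen.trans s.2 hsb
    refine Relation.ReflTransGen.tail (ih hb) ⟨x, hx, ?_⟩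
    rw [classNext, dif_pos hx]

/-- The chain of the states that can be reached from `z`, with cooperation in the states of the
cooperation set. -/
noncomputable def classChain {r : ℝ} (hr : r ∈ Set.Icc (0 : ℝ) 1) (hμ : E.IsSteady m μ)
    {z : State m.k} (hz : 0 < μ z) : E.CoopChain (E.ReachClass m z) where
  task s := (m.next s.1).1
  task_nonneg s := (m.next s.1).2.1
  task_sum s := (m.next s.1).2.2
  nx := classNext
  irreducible s t := leads_class s t
    (Relation.ReflTransGen.trans (hμ.reaches_symm hz s.2) t.2)
  μ s := μ s.1
  μ_pos s := hμ.pos_of_reaches hz s.2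
  stationary f := by
    classical
    let F : State m.k → ℝ := fun s => if h : E.Reaches m z s then f ⟨s, h⟩ else 0
    have hF : ∀ s : E.ReachClass m z, F s.1 = f s := fun s => dif_pos s.2
    have hF0 : ∀ s, ¬ E.Reaches m z s → F s = 0 := fun s hs => dif_neg hs
    have h1 : ∑ s : E.ReachClass m z, μ s.1 * f s = ∑ s, μ s * F s := by
      rw [← sum_class (z := z) fun s hs => by rw [hF0 s hs, mul_zero]]
      exact Finset.sum_congr rfl fun s _ => by rw [hF]
    have h2 : ∑ s : E.ReachClass m z, μ s.1 * ∑ x, E.obsProb m s.1 x * f (classNext s x)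
        = ∑ s, μ s * ∑ x, E.obsProb m s x * F (s.push x) := by
      rw [← sum_class (z := z) (f := fun s => μ s * ∑ x, E.obsProb m s x * F (s.push x))]
      · exact Finset.sum_congr rfl fun s _ => by
          congr 1
          exact Finset.sum_congr rfl fun x _ => obsProb_mul_classNext s x f F hF
      · intro s hs
        rcases (hμ.1.1 s).lt_or_eq with h3 | h3
        · rw [Finset.sum_eq_zero, mul_zero]
          intro x _
          rcases (E.obsProb_nonneg m s x).lt_or_eq with hx | hx
          · rw [hF0, mul_zero]
            intro hz
            exact hs (Relation.ReflTransGen.trans hz (hμ.reaches_symm h3 (reaches_push hx)))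
          · rw [← hx, zero_mul]
        · rw [← h3, zero_mul]
    exact h1.trans ((hμ.sum_mul F).trans h2.symm)
  vis s t := s.1.push (t, some t) ∈ E.coopSet m r
  disc := (1 - r) * E.δ
  disc_nonneg := discount_nonneg hr
  disc_le := discount_le hr
  u s := (exists_isWorth (E := E) hr (E.coopSet m r)).choose s.1
  coop s := E.coopTask m r s.1
  coop_of_vis s t h := if_pos h
  coop_of_not_vis s t h := if_neg h
  u_eq s := by
    have hw := (exists_isWorth (E := E) hr (E.coopSet m r)).choose_spec
    rw [hw s.1]
    congr 1
    simp only [mul_add, Finset.sum_add_distrib]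
    congr 1
    · exact sum_obsProb_coop s.1 E.benefit rfl
    · exact Finset.sum_congr rfl fun x _ =>
        (obsProb_mul_classNext s x _ _ fun _ => rfl).symm
  incentive s t h := by
    have hw := (exists_isWorth (E := E) hr (E.coopSet m r)).choose_spec
    have hmem : s.1.push (t, some t) ∈ E.coopSet m r := by
      by_contra hn
      simp [coopTask, hn] at h
    have hx : 0 < E.obsProb m s.1 (t, some t) := by
      refine mul_pos (h.trans_le (coopTask_le r s.1 t)) ?_
      simp only [gameProb, if_true]
      exact E.arrival_pos t
    rw [classNext, dif_pos hx]
    exact hw.d_le hr hmem (by simp [State.game, State.push])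

theorem reaches_curState {σ : E.StratProfile m.k} {s : State m.k} {l : List E.Step}
    (h : E.OnPath m σ s l) : E.Reaches m s (E.curState s l) := by
  induction l with
  | nil => exact Relation.ReflTransGen.refl
  | cons x l ih =>
    refine (ih h.1).step (lt_of_le_of_ne (E.obsProb_nonneg m _ _) fun h0 => ?_)
    have := h.2
    rw [stepProb, ← h0, mul_zero] at this
    exact lt_irrefl _ this

end Classes

end Env

/-! ### The designer's problem -/

namespace Env

section Designer

variable {E : Env}

/-- The share of the periods with cooperation on task `t`. -/
noncomputable def coopShare (E : Env) (m : Assignment) (r : ℝ) (μ : State m.k → ℝ) (t : WorkTask) :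
    ℝ :=
  ∑ s, μ s * E.coopTask m r s t

open Classical in
/-- The social value of an assignment with a player-optimal equilibrium. -/
theorem IsPlayerOptimal.sum_value {m : Assignment} {r : ℝ} {μ : State m.k → ℝ}
    {σ : E.StratProfile m.k} (hr : r ∈ Set.Icc (0 : ℝ) 1) (hμ : E.IsSteady m μ)
    (hσ : E.IsPlayerOptimal m r μ σ) :
    (∑ s, if E.CoopInState m μ σ s then μ s * E.stateValue s else 0)
      = ∑ t, E.arrival t * E.V t * E.coopShare m r μ t := by
  let v : Option Game → ℝ := fun o => match o with
    | none => 0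
    | some g => E.V g
  have hv : ∀ s : State m.k, E.stateValue s = v s.game := fun s => rfl
  have h1 : (∑ s, if E.CoopInState m μ σ s then μ s * E.stateValue s else 0)
      = ∑ s, μ s * if s ∈ E.coopSet m r then v s.game else 0 := by
    refine Finset.sum_congr rfl fun s _ => ?_
    rcases (hμ.1.1 s).lt_or_eq with hs | hs
    · cases hg : s.game with
      | none => simp [hv, hg, v]
      | some g =>
        rw [hv, hg]
        simp only [hσ.coopInState_iff hr hs (by rw [hg]; simp), mul_ite, mul_zero]
    · rw [← hs]; simp
  rw [h1, hμ.sum_mul]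
  simp only [coopShare, Finset.mul_sum]
  rw [Finset.sum_comm (s := (Finset.univ : Finset WorkTask))]
  refine Finset.sum_congr rfl fun s _ => ?_
  rw [← Finset.mul_sum, sum_obsProb_coop s v rfl, sum_obs, Finset.mul_sum]
  refine Finset.sum_congr rfl fun t _ => ?_
  have h2 := E.sum_gameProb_mul t v
  simp only [v, mul_zero, zero_add] at h2
  simp only [mul_assoc, ← Finset.mul_sum]
  rw [h2]
  ring

theorem coopShare_nonneg {m : Assignment} {r : ℝ} {μ : State m.k → ℝ} (hμ : E.IsSteady m μ)
    (t : WorkTask) : 0 ≤ E.coopShare m r μ t :=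
  Finset.sum_nonneg fun s _ => mul_nonneg (hμ.1.1 s) (coopTask_nonneg r s t)

theorem coopShare_le {m : Assignment} {r : ℝ} {μ : State m.k → ℝ} (hμ : E.IsSteady m μ)
    (t : WorkTask) : E.coopShare m r μ t ≤ ∑ s : State m.k, if s.task = t then μ s else 0 := by
  rw [hμ.sum_task]
  exact Finset.sum_le_sum fun s _ =>
    mul_le_mul_of_nonneg_left (coopTask_le r s t) (hμ.1.1 s)

theorem sum_task_share {m : Assignment} {μ : State m.k → ℝ} (hμ : E.IsSteady m μ) :
    ∑ t, (∑ s : State m.k, if s.task = t then μ s else 0) = 1 := by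
  rw [Finset.sum_comm]
  simpa using hμ.1.2

/-- If no players cooperate under complete reshuffling, the share of cooperation is zero. -/
theorem coopTask_one (m : Assignment) (s : State m.k) (t : WorkTask) :
    E.coopTask m 1 s t = 0 := by
  unfold coopTask
  split_ifs with h
  · exfalso
    have hr : (1 : ℝ) ∈ Set.Icc (0 : ℝ) 1 := by norm_num
    obtain ⟨w, hw⟩ := exists_isWorth (E := E) hr (E.coopSet m 1)
    have h1 := hw.d_le hr h (g := t) (by simp [State.game, State.push])
    rw [hw] at h1
    simp only [sub_self, zero_mul] at h1
    linarith [E.d_pos t]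
  · rfl

/-- A steady state of an assignment. -/
noncomputable def steadyOf (E : Env) (m : Assignment) : State m.k → ℝ :=
  (E.exists_isSteady m).choose

theorem steadyOf_spec (E : Env) (m : Assignment) : E.IsSteady m (E.steadyOf m) :=
  (E.exists_isSteady m).choose_spec

open Classical in
/-- The team structure with an assignment `m` for the share `α` of the teams, and with completely
reshuffled teams with independent tasks. -/
noncomputable def mixture (E : Env) (m : Assignment) (p : stdSimplex ℝ WorkTask) {α : ℝ}
    (h0 : 0 ≤ α) (h1 : α ≤ 1) : E.TeamStructure where
  weight := Finsupp.single m α + Finsupp.single ⟨0, fun _ => p⟩ (1 - α)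
  weight_nonneg m' := by
    rw [Finsupp.add_apply, Finsupp.single_apply, Finsupp.single_apply]
    have : 0 ≤ 1 - α := by linarith
    split_ifs <;> simp [h0, this]
  weight_sum := by
    rw [Finsupp.sum_add_index' (fun _ => rfl) fun _ _ _ => rfl, Finsupp.sum_single_index rfl,
      Finsupp.sum_single_index rfl]
    ring
  -- The memory length tells the two assignments apart: the filler has `k = 0`, and `m` will have `k
  -- ≠ 0`.
  rate m' := if m'.k = 0 then 1 else 0
  rate_mem m' _ := by
    split_ifs <;> norm_num
  steady := E.steadyOf
  steady_isSteady m' _ := E.steadyOf_spec m'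

theorem sum_mixture_weight (m : Assignment) (p : stdSimplex ℝ WorkTask) {α : ℝ}
    (h0 : 0 ≤ α) (h1 : α ≤ 1) (f : Assignment → ℝ) :
    ((E.mixture m p h0 h1).weight.sum fun m' w => w * f m')
      = α * f m + (1 - α) * f ⟨0, fun _ => p⟩ := by
  classical
  simp only [mixture]
  rw [Finsupp.sum_add_index' (fun _ => by simp) fun _ _ _ => by ring,
    Finsupp.sum_single_index (by simp), Finsupp.sum_single_index (by simp)]

/-- A lower bound for the value of a designer-optimal team structure. -/
theorem le_of_optimal {v : ℝ}
    (hv : ∀ (T' : E.TeamStructure) (v' : ℝ), E.CoversTasks T' → E.IsSocialValue T' v' → v' ≤ v)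
    {m : Assignment} (hk : m.k ≠ 0) {α : ℝ} (h0 : 0 ≤ α) (h1 : α ≤ 1)
    (hα : ∀ t, α * (∑ s : State m.k, if s.task = t then E.steadyOf m s else 0) ≤ E.q t) :
    α * ∑ t, E.arrival t * E.V t * E.coopShare m 0 (E.steadyOf m) t ≤ v := by
  classical
  obtain ⟨p, hp⟩ : ∃ p : stdSimplex ℝ WorkTask, ∀ t,
      α * (∑ s : State m.k, if s.task = t then E.steadyOf m s else 0) + (1 - α) * p.1 t
        = E.q t := by
    have hsum := sum_task_share (E.steadyOf_spec m)
    -- The filler teams take on the tasks left over by `m`. If `α = 1`, both sides have total `1`,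
    -- so the tasks are covered exactly.
    rcases h1.lt_or_eq with h2 | h2
    · have h3 : 0 < 1 - α := by linarith
      refine ⟨⟨fun t => (E.q t - α * (∑ s : State m.k, if s.task = t then E.steadyOf m s else 0))
        / (1 - α), fun t => div_nonneg (by linarith [hα t]) h3.le, ?_⟩, fun t => ?_⟩
      · rw [← Finset.sum_div, Finset.sum_sub_distrib, ← Finset.mul_sum, hsum, E.q_sum, mul_one,
          div_self h3.ne']
      · simp only
        rw [mul_div_cancel₀ _ h3.ne']
        ring
    · refine ⟨⟨E.q, E.q_nonneg, E.q_sum⟩, fun t => ?_⟩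
      subst h2
      simp only [one_mul, sub_self, zero_mul, add_zero] at hα ⊢
      exact (Finset.sum_eq_sum_iff_of_le fun t _ => hα t).1 (by rw [hsum, E.q_sum]) t
        (Finset.mem_univ t)
  refine hv (E.mixture m p h0 h1) _ (fun t => ?_) ⟨fun m' =>
    E.trigger (E.coopSet m' (if m'.k = 0 then 1 else 0)), fun m' hm' => ?_, ?_⟩
  · have h2 := sum_mixture_weight (E := E) m p h0 h1 fun m' =>
      ∑ s : State m'.k, if s.task = t then E.steadyOf m' s else 0
    refine h2.trans ?_
    have h3 : ∑ s, E.steadyOf ⟨0, fun _ => p⟩ s * p.1 t = p.1 t := by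
      rw [← Finset.sum_mul, (E.steadyOf_spec ⟨0, fun _ => p⟩).1.2, one_mul]
    rw [(E.steadyOf_spec ⟨0, fun _ => p⟩).sum_task t]
    exact (congrArg (fun x => _ + (1 - α) * x) h3).trans (hp t)
  · exact trigger_isPlayerOptimal ((E.mixture m p h0 h1).rate_mem m' hm') _
  · have h2 := sum_mixture_weight (E := E) m p h0 h1 fun m' =>
      ∑ s, if E.CoopInState m' (E.steadyOf m')
        (E.trigger (E.coopSet m' (if m'.k = 0 then 1 else 0))) s
      then E.steadyOf m' s * E.stateValue s else 0
    refine Eq.trans ?_ h2.symm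
    have hval : ∀ m' : Assignment, (∑ s, if E.CoopInState m' (E.steadyOf m')
        (E.trigger (E.coopSet m' (if m'.k = 0 then 1 else 0))) s
        then E.steadyOf m' s * E.stateValue s else 0)
        = ∑ t, E.arrival t * E.V t *
          E.coopShare m' (if m'.k = 0 then 1 else 0) (E.steadyOf m') t := fun m' => by
      have hr : (if m'.k = 0 then (1 : ℝ) else 0) ∈ Set.Icc (0 : ℝ) 1 := by
        split_ifs <;> norm_num
      exact (trigger_isPlayerOptimal hr (E.steadyOf m')).sum_value hr (E.steadyOf_spec m')
    rw [hval m, hval ⟨0, fun _ => p⟩]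
    simp only [if_neg hk, if_true]
    simp [coopShare, coopTask_one]

/-- An assignment all of whose states have sufficient incentives for cooperation. -/
theorem coopTask_eq_of_value {m : Assignment} {V : State m.k → ℝ}
    (hV : ∀ s, V s ≤ E.δ * ∑ x, E.obsProb m s x * (E.benefit x.2 + V (s.push x)))
    (hinc : ∀ s g, s.game = some g → E.d g ≤ V s) (s : State m.k) (t : WorkTask) :
    E.coopTask m 0 s t = (m.next s).1 t := by
  have hr : (0 : ℝ) ∈ Set.Icc (0 : ℝ) 1 := by norm_num
  obtain ⟨w, hw⟩ := exists_isWorth (E := E) (m := m) hr Set.univ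
  have hle := hw.ge_of_sub hr (w' := V) fun s => by
    rw [sub_zero, one_mul]
    refine (hV s).trans (le_of_eq ?_)
    congr 1
    exact Finset.sum_congr rfl fun x _ => by simp [benefitIn, State.game, State.push]
  have hself : E.SelfSustaining m 0 Set.univ :=
    ⟨w, hw, fun s _ g hg => (hinc s g hg).trans (hle s)⟩
  rw [coopTask, if_pos (subset_coopSet hself (Set.mem_univ _))]

/-- Integrate the inequality against the steady state; the potential cancels and the mean cost
remains. -/
theorem sum_cost_nonpos {m : Assignment} {μ : State m.k → ℝ} (hμ : E.IsSteady m μ) {ρ : ℝ}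
    {W : State m.k → ℝ}
    (hW : ∀ s, ∑ x, E.obsProb m s x * (taskCost ρ x.1 + W (s.push x)) ≤ W s) :
    (∑ s : State m.k, if s.task = Game.B then μ s else 0)
      ≤ ρ * ∑ s : State m.k, if s.task = Game.G then μ s else 0 := by
  have h1 : ∑ s, μ s * ∑ x, E.obsProb m s x * (taskCost ρ x.1 + W (s.push x)) ≤ ∑ s, μ s * W s :=
    Finset.sum_le_sum fun s _ => mul_le_mul_of_nonneg_left (hW s) (hμ.1.1 s)
  have h2 : ∑ s, μ s * ∑ x, E.obsProb m s x * (taskCost ρ x.1 + W (s.push x))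
      = ∑ s, μ s * ((m.next s).1 Game.B - ρ * (m.next s).1 Game.G) + ∑ s, μ s * W s := by
    rw [hμ.sum_mul W, ← Finset.sum_add_distrib]
    refine Finset.sum_congr rfl fun s _ => ?_
    rw [← mul_add]
    congr 1
    have h3 := E.sum_task_gameProb_const (m.next s).1 (taskCost ρ)
    rw [Game.sum_eq] at h3
    simp only [mul_add, Finset.sum_add_distrib]
    congr 1
    refine h3.trans ?_
    simp only [taskCost]
    ring
  rw [hμ.sum_task, hμ.sum_task]
  simp only [mul_sub, Finset.sum_sub_distrib] at h2
  rw [Finset.mul_sum]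
  have h4 : ∑ s, μ s * (ρ * (m.next s).1 Game.G) = ∑ s, ρ * (μ s * (m.next s).1 Game.G) :=
    Finset.sum_congr rfl fun s _ => by ring
  linarith

/-- The mean over the states of the averages over their classes is the mean. -/
theorem sum_class_average {m : Assignment} {μ : State m.k → ℝ} (hμ : E.IsSteady m μ)
    (κ : State m.k → ℝ) :
    ∑ z, μ z * ((∑ s : E.ReachClass m z, μ s.1 * κ s.1) / ∑ s : E.ReachClass m z, μ s.1)
      = ∑ s, μ s * κ s := by
  classical
  have hcl : ∀ (z : State m.k) (f : State m.k → ℝ), ∑ s : E.ReachClass m z, f s.1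
      = ∑ s, if E.Reaches m z s then f s else 0 := fun z f => by
    rw [← sum_class (z := z) (fun s hs => if_neg hs)]
    exact Finset.sum_congr rfl fun s _ => (if_pos s.2).symm
  have hmass : ∀ z, 0 < μ z → 0 < ∑ s : E.ReachClass m z, μ s.1 := fun z hz =>
    Finset.sum_pos' (fun s _ => hμ.1.1 s.1)
      ⟨⟨z, Relation.ReflTransGen.refl⟩, Finset.mem_univ _, hz⟩
  -- Reachability is symmetric on the support, so states that reach each other have the same class
  -- and the same class mass.
  have hsame : ∀ z s, 0 < μ z → E.Reaches m z s →
      ∑ a : E.ReachClass m z, μ a.1 = ∑ a : E.ReachClass m s, μ a.1 := fun z s hz hzs => by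
    rw [hcl, hcl]
    refine Finset.sum_congr rfl fun a _ => ?_
    have : E.Reaches m z a ↔ E.Reaches m s a :=
      ⟨fun h => Relation.ReflTransGen.trans (hμ.reaches_symm hz hzs) h,
        fun h => Relation.ReflTransGen.trans hzs h⟩
    simp only [this]
  calc ∑ z, μ z * ((∑ s : E.ReachClass m z, μ s.1 * κ s.1) / ∑ s : E.ReachClass m z, μ s.1)
      = ∑ z, ∑ s, if E.Reaches m z s then
          μ z * (μ s * κ s) / ∑ a : E.ReachClass m z, μ a.1 else 0 := by
        refine Finset.sum_congr rfl fun z _ => ?_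
        rw [hcl z fun s => μ s * κ s, Finset.sum_div, Finset.mul_sum]
        refine Finset.sum_congr rfl fun s _ => ?_
        split_ifs <;> ring
    _ = ∑ s, ∑ z, if E.Reaches m z s then
          μ z * (μ s * κ s) / ∑ a : E.ReachClass m z, μ a.1 else 0 := Finset.sum_comm
    _ = ∑ s, μ s * κ s := by
        refine Finset.sum_congr rfl fun s _ => ?_
        rcases (hμ.1.1 s).lt_or_eq with hs | hs
        · have h1 : ∀ z, (if E.Reaches m z s then
              μ z * (μ s * κ s) / ∑ a : E.ReachClass m z, μ a.1 else 0)
              = (if E.Reaches m s z then μ z else 0) *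
                ((μ s * κ s) / ∑ a : E.ReachClass m s, μ a.1) := by
            intro z
            rcases (hμ.1.1 z).lt_or_eq with hz | hz
            · by_cases hzs : E.Reaches m z s
              · rw [if_pos hzs, if_pos (hμ.reaches_symm hz hzs), hsame z s hz hzs]
                ring
              · rw [if_neg hzs, if_neg fun h => hzs (hμ.reaches_symm hs h), zero_mul]
            · rw [← hz]; simp
          simp only [h1]
          rw [← Finset.sum_mul, ← hcl s μ, mul_div_cancel₀ _ (hmass s hs).ne']
        · rw [← hs]; simp

end Designer

end Env

/-! ### Improving on a team structure that wastes incentives -/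

theorem lemma3 (E : Env)
    (hG : E.δ / (1 - E.δ) * E.arrival Game.G * E.c Game.G < E.d Game.G)
    (hB : max (E.d Game.G) (E.d Game.B) < E.δ / (1 - E.δ) * E.arrival Game.B * E.c Game.B)
    (T : E.TeamStructure) (hT : E.IsDesignerOptimal T)
    (m : Assignment) (hm : m ∈ T.weight.support)
    (σ : E.StratProfile m.k) (hσ : E.IsPlayerOptimal m (T.rate m) (T.steady m) σ)
    (s₀ : State m.k) (hs₀ : 0 < T.steady m s₀) :
    ((∀ s, E.Reaches m s₀ s → E.AlwaysPlays m σ Move.C s) ∧ T.rate m = 0) ∨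
      (∀ s, E.Reaches m s₀ s → E.AlwaysPlays m σ Move.N s) := by
  classical
  obtain ⟨hcov, v, ⟨τ, hτ, hv⟩, hopt⟩ := hT
  have hδ : 0 < 1 - E.δ := sub_pos.2 E.δ_lt_one
  have hscale : ∀ t, (1 - E.δ) * (E.δ / (1 - E.δ) * E.arrival t * E.c t) = E.δ * E.flow t := by
    intro t
    simp only [Env.flow]
    field_simp
  have hG' : E.δ * E.flow Game.G < (1 - E.δ) * E.d Game.G := by
    rw [← hscale]; exact mul_lt_mul_of_pos_left hG hδ
  have hd : ∀ g, (1 - E.δ) * E.d g < E.δ * E.flow Game.B := fun g => by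
    rw [← hscale]
    refine mul_lt_mul_of_pos_left (lt_of_le_of_lt ?_ hB) hδ
    cases g
    · exact le_max_left _ _
    · exact le_max_right _ _
  have hflow : E.flow Game.G < E.flow Game.B :=
    lt_of_mul_lt_mul_left (hG'.trans (hd Game.G)) E.δ_pos.le
  have hrate := T.rate_mem
  have hste := T.steady_isSteady
  have hμ := hste m hm
  have hr := hrate m hm
  have hw0 : ∀ m' ∈ T.weight.support, 0 < T.weight m' := fun m' hm' =>
    lt_of_le_of_ne (T.weight_nonneg m') (Ne.symm (Finsupp.mem_support_iff.1 hm'))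
  by_contra hcon
  push Not at hcon
  obtain ⟨hcon₁, s₁, hs₁, hN⟩ := hcon
  -- the class of `s₀` has cooperation
  let K := Env.classChain hr hμ hs₀
  obtain ⟨z₁, t₁, hcoop⟩ : ∃ z t, 0 < K.coop z t := by
    simp only [Env.AlwaysPlays] at hN
    push Not at hN
    obtain ⟨l, hl, hg, hnot⟩ := hN
    obtain ⟨g, hg'⟩ := Option.ne_none_iff_exists'.1 hg
    have hμs := hμ.pos_of_reaches hs₀ hs₁
    have hmem : E.curState s₁ l ∈ E.coopSet m (T.rate m) := by
      by_contra hn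
      exact hnot ((hσ.play hr hμs hl hg).2 hn)
    have hreach := Relation.ReflTransGen.trans hs₁ (Env.reaches_curState hl)
    -- Cooperation in the chain is indexed by the state before the task is drawn, hence the passage
    -- to a predecessor in the same class.
    obtain ⟨p, hp, hpr, hpt, hpush⟩ := hμ.exists_pred (hμ.pos_of_reaches hs₀ hreach) hg'
    refine ⟨⟨p, Relation.ReflTransGen.trans hreach (hμ.reaches_symm hp hpr)⟩, g, ?_⟩
    change 0 < E.coopTask m (T.rate m) p g
    rw [Env.coopTask, if_pos (by rw [hpush]; exact hmem)]
    exact hpt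
  have hwaste : K.disc < E.δ ∨ ∃ z t, K.coop z t < K.task z t := by
    by_cases hr0 : T.rate m = 0
    · right
      have h1 : ∃ s, E.Reaches m s₀ s ∧ ¬ E.AlwaysPlays m σ Move.C s := by
        by_contra hn
        push Not at hn
        exact hcon₁ hn hr0
      obtain ⟨s₂, hs₂, hC⟩ := h1
      simp only [Env.AlwaysPlays] at hC
      push Not at hC
      obtain ⟨l, hl, hg, hnot⟩ := hC
      obtain ⟨g, hg'⟩ := Option.ne_none_iff_exists'.1 hg
      have hμs := hμ.pos_of_reaches hs₀ hs₂
      have hmem : E.curState s₂ l ∉ E.coopSet m (T.rate m) := fun hn =>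
        hnot ((hσ.play hr hμs hl hg).1 hn)
      have hreach := Relation.ReflTransGen.trans hs₂ (Env.reaches_curState hl)
      obtain ⟨p, hp, hpr, hpt, hpush⟩ := hμ.exists_pred (hμ.pos_of_reaches hs₀ hreach) hg'
      refine ⟨⟨p, Relation.ReflTransGen.trans hreach (hμ.reaches_symm hp hpr)⟩, g, ?_⟩
      change E.coopTask m (T.rate m) p g < (m.next p).1 g
      rw [Env.coopTask, if_neg (by rw [hpush]; exact hmem)]
      exact hpt
    · left
      change (1 - T.rate m) * E.δ < E.δ
      have : 0 < T.rate m := lt_of_le_of_ne hr.1 (Ne.symm hr0)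
      nlinarith [E.δ_pos]
  obtain ⟨z₂, hcoopB⟩ : ∃ z, 0 < K.coop z Game.B := by
    cases t₁ with
    | G => exact K.exists_coop_bad hG' hcoop
    | B => exact ⟨z₁, hcoop⟩
  have hshareB : 0 < K.share Game.B :=
    Finset.sum_pos' (fun s _ => mul_nonneg (K.μ_pos s).le (K.coop_nonneg s _))
      ⟨z₂, Finset.mem_univ _, mul_pos (K.μ_pos z₂) hcoopB⟩
  -- aggregate cooperation
  obtain ⟨y, hy⟩ : ∃ y : Assignment → WorkTask → ℝ, ∀ m' t,
      y m' t = E.coopShare m' (T.rate m') (T.steady m') t := ⟨_, fun _ _ => rfl⟩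
  obtain ⟨Y, hY⟩ : ∃ Y : WorkTask → ℝ, ∀ t,
      Y t = ∑ m' ∈ T.weight.support, T.weight m' * y m' t := ⟨_, fun _ => rfl⟩
  have hvY : v = ∑ t, E.arrival t * E.V t * Y t := by
    rw [hv, Env.socialValue, Finsupp.sum]
    have h1 : ∀ t, E.arrival t * E.V t * Y t
        = ∑ m' ∈ T.weight.support, E.arrival t * E.V t * (T.weight m' * y m' t) := fun t => by
      rw [hY, Finset.mul_sum]
    simp only [h1]
    rw [Finset.sum_comm]
    refine Finset.sum_congr rfl fun m' hm' => ?_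
    rw [(hτ m' hm').sum_value (hrate m' hm') (hste m' hm'), Finset.mul_sum]
    exact Finset.sum_congr rfl fun t _ => by rw [hy]; ring
  have hy0 : ∀ m' ∈ T.weight.support, ∀ t, 0 ≤ y m' t := fun m' hm' t => by
    rw [hy]; exact Env.coopShare_nonneg (hste m' hm') t
  have hY0 : ∀ t, 0 ≤ Y t := fun t => by
    rw [hY]
    exact Finset.sum_nonneg fun m' hm' => mul_nonneg (T.weight_nonneg m') (hy0 m' hm' t)
  have hYq : ∀ t, Y t ≤ E.q t := fun t => by
    rw [← hcov t, hY, Finsupp.sum]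
    refine Finset.sum_le_sum fun m' hm' => mul_le_mul_of_nonneg_left ?_ (T.weight_nonneg m')
    rw [hy]
    exact Env.coopShare_le (hste m' hm') t
  have hq1 := E.q_sum
  rw [Game.sum_eq] at hvY hq1
  have hYB : 0 < Y Game.B := by
    rw [hY]
    refine Finset.sum_pos' (fun m' hm' => mul_nonneg (T.weight_nonneg m') (hy0 m' hm' _))
      ⟨m, hm, mul_pos (hw0 m hm) ?_⟩
    rw [hy]
    refine Finset.sum_pos' (fun s _ => mul_nonneg (hμ.1.1 s) (Env.coopTask_nonneg _ s _))
      ⟨z₂.1, Finset.mem_univ _, mul_pos (K.μ_pos z₂) hcoopB⟩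
  have haV := mul_pos (E.arrival_pos Game.G) E.V_good
  have haB := mul_neg_of_pos_of_neg (E.arrival_pos Game.B) E.V_bad
  -- Reshuffling all teams completely, that is `α = 0`, is always feasible and yields zero.
  have hv0 : 0 ≤ v := by
    have := Env.le_of_optimal (E := E) hopt (m := ⟨1, fun _ => ⟨E.q, E.q_nonneg, E.q_sum⟩⟩)
      one_ne_zero le_rfl zero_le_one fun t => by rw [zero_mul]; exact E.q_nonneg t
    rwa [zero_mul] at this
  have hYG : 0 < Y Game.G := by
    refine lt_of_le_of_ne (hY0 _) fun h0 => ?_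
    rw [← h0, mul_zero, zero_add] at hvY
    have := mul_neg_of_neg_of_pos haB hYB
    linarith
  obtain ⟨ρ, hρ⟩ : ∃ ρ, ρ = Y Game.B / Y Game.G := ⟨_, rfl⟩
  have hρ0 : 0 < ρ := by rw [hρ]; exact div_pos hYB hYG
  have hρY : ρ * Y Game.G = Y Game.B := by rw [hρ]; exact div_mul_cancel₀ _ hYG.ne'
  -- an assignment with complete cooperation and fewer bad tasks
  obtain ⟨m₁, ρ₁, hρ₁, hk, ⟨V, hV, hinc⟩, W, hW⟩ : ∃ m : Assignment, ∃ ρ₁ < ρ, m.k ≠ 0 ∧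
      (∃ V : State m.k → ℝ,
        (∀ s, V s ≤ E.δ * ∑ x, E.obsProb m s x * (E.benefit x.2 + V (s.push x))) ∧
        ∀ s g, s.game = some g → E.d g ≤ V s) ∧
      ∃ W : State m.k → ℝ,
        ∀ s, ∑ x, E.obsProb m s x * (taskCost ρ₁ x.1 + W (s.push x)) ≤ W s := by
    -- If the class of `s₀` is no worse than the aggregate ratio, its waste gives the strict
    -- improvement.
    by_cases hK : K.share Game.B ≤ ρ * K.share Game.G
    · exact K.exists_assignment hflow hd hρ0 hK
        (pos_of_mul_pos_right (hshareB.trans_le hK) hρ0.le) (Or.inr hwaste)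
    · -- another class needs fewer bad tasks
      obtain ⟨cost, hcost⟩ : ∃ cost : (m' : Assignment) → State m'.k → ℝ, ∀ m' s, cost m' s
          = E.coopTask m' (T.rate m') s Game.B - ρ * E.coopTask m' (T.rate m') s Game.G :=
        ⟨_, fun _ _ => rfl⟩
      have hcostsum : ∑ m' ∈ T.weight.support, T.weight m' * ∑ s, T.steady m' s * cost m' s = 0 := by
        have h1 : ∀ m', ∑ s, T.steady m' s * cost m' s = y m' Game.B - ρ * y m' Game.G := by
          intro m'
          rw [hy, hy, Env.coopShare, Env.coopShare, Finset.mul_sum, ← Finset.sum_sub_distrib]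
          exact Finset.sum_congr rfl fun s _ => by rw [hcost]; ring
        simp only [h1, mul_sub, Finset.sum_sub_distrib]
        have h2 : ∑ m' ∈ T.weight.support, T.weight m' * (ρ * y m' Game.G) = ρ * Y Game.G := by
          rw [hY, Finset.mul_sum]
          exact Finset.sum_congr rfl fun m' _ => by ring
        rw [h2, hρY, ← hY, sub_self]
      -- By the choice of `ρ` the mean cost over all classes of the structure is zero. The class of
      -- `s₀` has positive cost, so some class has negative cost.
      obtain ⟨m₂, hm₂, z, hz, hneg⟩ : ∃ m' ∈ T.weight.support, ∃ z, 0 < T.steady m' z ∧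
          ∑ s : E.ReachClass m' z, T.steady m' s.1 * cost m' s.1 < 0 := by
        by_contra hne
        push Not at hne
        have hterm : ∀ m' ∈ T.weight.support, ∀ z, 0 ≤ T.steady m' z *
            ((∑ s : E.ReachClass m' z, T.steady m' s.1 * cost m' s.1) /
              ∑ s : E.ReachClass m' z, T.steady m' s.1) := by
          intro m' hm' z
          rcases ((hste m' hm').1.1 z).lt_or_eq with hz | hz
          · exact mul_nonneg hz.le (div_nonneg (hne m' hm' z hz)
              (Finset.sum_nonneg fun s _ => (hste m' hm').1.1 s.1))
          · rw [← hz, zero_mul]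
        have hpos : 0 < ∑ m' ∈ T.weight.support,
            T.weight m' * ∑ s, T.steady m' s * cost m' s := by
          refine Finset.sum_pos' (fun m' hm' => mul_nonneg (T.weight_nonneg m') ?_)
            ⟨m, hm, mul_pos (hw0 m hm) ?_⟩
          · rw [← Env.sum_class_average (hste m' hm')]
            exact Finset.sum_nonneg fun z _ => hterm m' hm' z
          · rw [← Env.sum_class_average hμ]
            refine Finset.sum_pos' (fun z _ => hterm m hm z)
              ⟨s₀, Finset.mem_univ _, mul_pos hs₀ (div_pos ?_ ?_)⟩
            · have h1 : ∑ s : E.ReachClass m s₀, T.steady m s.1 * cost m s.1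
                  = K.share Game.B - ρ * K.share Game.G := by
                rw [Env.CoopChain.share, Env.CoopChain.share, Finset.mul_sum,
                  ← Finset.sum_sub_distrib]
                refine Finset.sum_congr rfl fun s _ => ?_
                rw [hcost]
                change _ = T.steady m s.1 * E.coopTask m (T.rate m) s.1 Game.B
                  - ρ * (T.steady m s.1 * E.coopTask m (T.rate m) s.1 Game.G)
                ring
              rw [h1]
              linarith
            · exact Finset.sum_pos' (fun s _ => hμ.1.1 s.1)
                ⟨⟨s₀, Relation.ReflTransGen.refl⟩, Finset.mem_univ _, hs₀⟩
        exact hpos.ne' hcostsum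
      let K₂ := Env.classChain (hrate m₂ hm₂) (hste m₂ hm₂) hz
      have h1 : ∑ s : E.ReachClass m₂ z, T.steady m₂ s.1 * cost m₂ s.1
          = K₂.share Game.B - ρ * K₂.share Game.G := by
        rw [Env.CoopChain.share, Env.CoopChain.share, Finset.mul_sum, ← Finset.sum_sub_distrib]
        refine Finset.sum_congr rfl fun s _ => ?_
        rw [hcost]
        change _ = T.steady m₂ s.1 * E.coopTask m₂ (T.rate m₂) s.1 Game.B
          - ρ * (T.steady m₂ s.1 * E.coopTask m₂ (T.rate m₂) s.1 Game.G)
        ring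
      have h2 : K₂.share Game.B < ρ * K₂.share Game.G := by linarith
      have h3 : 0 ≤ K₂.share Game.B := Finset.sum_nonneg fun s _ =>
        mul_nonneg (K₂.μ_pos s).le (K₂.coop_nonneg s _)
      exact K₂.exists_assignment hflow hd hρ0 h2.le
        (pos_of_mul_pos_right (h3.trans_lt h2) hρ0.le) (Or.inl h2)
  -- this assignment improves on the given team structure
  have hst₁ := E.steadyOf_spec m₁
  obtain ⟨x, hx⟩ : ∃ x : WorkTask → ℝ, ∀ t, x t =
      ∑ s : State m₁.k, if s.task = t then E.steadyOf m₁ s else 0 := ⟨_, fun _ => rfl⟩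
  have hshare : ∀ t, E.coopShare m₁ 0 (E.steadyOf m₁) t = x t := fun t => by
    rw [hx, hst₁.sum_task]
    exact Finset.sum_congr rfl fun s _ => by rw [Env.coopTask_eq_of_value hV hinc]
  have hx0 : ∀ t, 0 ≤ x t := fun t => by
    rw [← hshare]; exact Env.coopShare_nonneg hst₁ t
  have hx1 : x Game.G + x Game.B = 1 := by
    have := Env.sum_task_share hst₁
    rw [Game.sum_eq] at this
    rw [hx, hx]
    exact this
  have hxρ : x Game.B ≤ ρ₁ * x Game.G := by
    rw [hx, hx]; exact Env.sum_cost_nonpos hst₁ hW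
  have hxG : 0 < x Game.G := by
    refine lt_of_le_of_ne (hx0 _) fun h0 => ?_
    rw [← h0] at hxρ hx1
    linarith
  -- The share of teams that reproduces the good cooperation `Y G` exactly; bad cooperation then
  -- falls below `Y B`.
  obtain ⟨α, hα⟩ : ∃ α, α = Y Game.G / x Game.G := ⟨_, rfl⟩
  have hα0 : 0 < α := by rw [hα]; exact div_pos hYG hxG
  have hαG : α * x Game.G = Y Game.G := by rw [hα]; exact div_mul_cancel₀ _ hxG.ne'
  have hαB : α * x Game.B < Y Game.B := by
    have h1 := mul_le_mul_of_nonneg_left hxρ hα0.le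
    have h2 := mul_lt_mul_of_pos_right hρ₁ hYG
    calc α * x Game.B ≤ α * (ρ₁ * x Game.G) := h1
      _ = ρ₁ * Y Game.G := by rw [← hαG]; ring
      _ < Y Game.B := by rw [← hρY]; exact h2
  -- The new teams perform at most `Y t ≤ q t` of each task, and the shares `q` sum to one.
  have hα1 : α ≤ 1 := by
    have h1 : α * (x Game.G + x Game.B) = α := by rw [hx1, mul_one]
    have h2 := hYq Game.G
    have h3 := hYq Game.B
    linarith
  have hfinal := Env.le_of_optimal hopt hk hα0.le hα1 fun t => by
    rw [← hx]
    cases t with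
    | G => rw [hαG]; exact hYq _
    | B => exact hαB.le.trans (hYq _)
  rw [Game.sum_eq, hshare, hshare] at hfinal
  have h1 := mul_lt_mul_of_neg_left hαB haB
  have h2 : α * (E.arrival Game.G * E.V Game.G * x Game.G
      + E.arrival Game.B * E.V Game.B * x Game.B)
      = E.arrival Game.G * E.V Game.G * (α * x Game.G)
        + E.arrival Game.B * E.V Game.B * (α * x Game.B) := by ring
  rw [h2, hαG] at hfinal
  linarith
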